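/- Let $\varepsilon>0$. There is a constant $C=C(\varepsilon)$, depending only on $\varepsilon$, for which the following holds. Let $q\equiv 1 \pmod 3$ be a prime power and let $d_1,d_2\ge 0$ be integers. All polynomials below are in $\mathbb{F}_q[X]$, and $|f|=q^{\deg f}$ for $f\neq 0$. Let $$\mathcal{F}_{(d_1,d_2)}=\{F_1F_2^2 \;:\; F_1,F_2 \text{ monic, square-free and coprime},\ \deg F_1=d_1,\ \deg F_2=d_2\},$$ $$\zeta_q(s)=\sum_{f \text{ monic}}|f|^{-s}=(1-q^{1-s})^{-1}\quad(s>1),\qquad K=\prod_{P}\left(1-\frac{1}{(|P|+1)^2}\right),$$ where $P$ runs over the monic irreducible polynomials. Let $\chi_3:\mathbb{F}_q\to\mathbb{C}$ be a multiplicative character of order $3$ (with $\chi_3(0)=0$), let $\omega\in\mathbb{C}$ be a primitive cube root of unity, let $x_1,\dots,x_q$ be the elements of $\mathbb{F}_q$, let $\varepsilon_1,\dots,\varepsilon_q\in\{0,1,\omega,\omega^2\}$, let $m$ be the number of indices $i$ with $\varepsilon_i=0$, and put $$\mathcal{N}=\left|\left\{F\in\mathcal{F}_{(d_1,d_2)}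 : \chi_3(F(x_i))=\varepsilon_i,\ 1\le i\le q\right\}\right|.$$ Then $$\left|\mathcal{F}_{(d_1,d_2)}\right|=\frac{Kq^{d_1+d_2}}{\zeta_q(2)^2}\left(1+O\left(q^{-(1-\varepsilon)d_2}+q^{-d_1/2}\right)\right),$$ $$\mathcal{N}=\frac{Kq^{d_1+d_2}}{\zeta_q(2)^2}\left(\frac{2}{q+2}\right)^m\left(\frac{q}{3(q+2)}\right)^{q-m}\left(1+O\left(q^{-(1-\varepsilon)(d_2-m)+\varepsilon q}+q^{-(d_1-m)/2+q}\right)\right),$$ $$\frac{\mathcal{N}}{\left|\mathcal{F}_{(d_1,d_2)}\right|}=\left(\frac{2}{q+2}\right)^m\left(\frac{q}{3(q+2)}\right)^{q-m}\left(1+O\left(q^{-(1-\varepsilon)(d_2-m)+\varepsilon q}+q^{-(d_1-m)/2+q}\right)\right),$$ where $O(E)$ stands for a real number of absolute value at most $C\,E$. -/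

import Mathlib

namespace TrigonalCount

noncomputable section

/-- The norm `|f| = q ^ deg f` of a nonzero polynomial over a field with `q` elements. -/
def polyNorm {F : Type*} [Field F] [Fintype F] (f : Polynomial F) : ℝ :=
  (Fintype.card F : ℝ) ^ f.natDegree

/-- The (incomplete) zeta function of the rational function field: the sum of `|f| ^ (-s)` over the
monic polynomials `f`, for real `s > 1`. -/
def zetaQ (F : Type*) [Field F] [Fintype F] (s : ℝ) : ℝ :=
  ∑' f : {f : Polynomial F // f.Monic}, polyNorm f.1 ^ (-s)

/-- The Euler product `K`, over the monic irreducible polynomials `P`, of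
`1 - 1 / (|P| + 1) ^ 2`. -/
def constK (F : Type*) [Field F] [Fintype F] : ℝ :=
  ∏' P : {P : Polynomial F // P.Monic ∧ Irreducible P}, (1 - 1 / (polyNorm P.1 + 1) ^ 2)

/-- The set of the polynomials `F₁ * F₂ ^ 2`, where `F₁` and `F₂` are monic, square-free and
coprime, of degrees `d₁` and `d₂`. -/
def cubeFreePolys (F : Type*) [Field F] (d₁ d₂ : ℕ) : Set (Polynomial F) :=
  {G | ∃ F₁ F₂ : Polynomial F, F₁.Monic ∧ F₂.Monic ∧ Squarefree F₁ ∧ Squarefree F₂ ∧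
    IsCoprime F₁ F₂ ∧ F₁.natDegree = d₁ ∧ F₂.natDegree = d₂ ∧ G = F₁ * F₂ ^ 2}

/-- The members `G` of `cubeFreePolys F d₁ d₂` with `χ (G (x i)) = e i` for all `i`. -/
def cubeFreePolysWithValues {F : Type*} [Field F] {ι : Type*} (χ : MulChar F ℂ)
    (x : ι → F) (e : ι → ℂ) (d₁ d₂ : ℕ) : Set (Polynomial F) :=
  {G | G ∈ cubeFreePolys F d₁ d₂ ∧ ∀ i, χ (G.eval (x i)) = e i}

/-! The sets are finite, and the series and the product converge. -/

/-- There are `q ^ n` monic polynomials of degree `n`. -/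
def monicDegreeEquiv (F : Type*) [Field F] (n : ℕ) :
    {f : {f : Polynomial F // f.Monic} // f.1.natDegree = n} ≃ (Fin n → F) :=
  (Equiv.subtypeSubtypeEquivSubtypeInter (fun f : Polynomial F => f.Monic)
    (fun f => f.natDegree = n)).trans
    ((Polynomial.monicEquivDegreeLT n).trans (Polynomial.degreeLTEquiv F n).toEquiv)

theorem cubeFreePolys_finite (F : Type*) [Field F] [Fintype F] (d₁ d₂ : ℕ) :
    (cubeFreePolys F d₁ d₂).Finite := by
  have hfin : ∀ n : ℕ, {f : Polynomial F | f.Monic ∧ f.natDegree = n}.Finite := by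
    intro n
    have : Finite {p : Polynomial F // p.Monic ∧ p.natDegree = n} :=
      Finite.of_equiv _ ((Polynomial.monicEquivDegreeLT n).trans
        (Polynomial.degreeLTEquiv F n).toEquiv).symm
    exact Set.finite_coe_iff.mp this
  refine ((hfin d₁).image2 (fun a b => a * b ^ 2) (hfin d₂)).subset ?_
  rintro G ⟨a, b, ha, hb, -, -, -, hda, hdb, rfl⟩
  exact ⟨a, ⟨ha, hda⟩, b, ⟨hb, hdb⟩, rfl⟩

theorem polyNorm_pos {F : Type*} [Field F] [Fintype F] (f : Polynomial F) : 0 < polyNorm f := by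
  have : (0 : ℝ) < Fintype.card F := by exact_mod_cast Fintype.card_pos
  exact pow_pos this _

theorem hasSum_zetaQ (F : Type*) [Field F] [Fintype F] (s : ℝ) (hs : 1 < s) :
    HasSum (fun f : {f : Polynomial F // f.Monic} => polyNorm f.1 ^ (-s))
      (1 - (Fintype.card F : ℝ) ^ (1 - s))⁻¹ := by
  have hq : (1 : ℝ) < Fintype.card F := by exact_mod_cast Fintype.one_lt_card
  have hq0 : (0 : ℝ) < Fintype.card F := by linarith
  set q : ℝ := (Fintype.card F : ℝ) with hqdef
  rw [← (Equiv.sigmaFiberEquiv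
    (fun f : {f : Polynomial F // f.Monic} => f.1.natDegree)).hasSum_iff]
  have hfib : ∀ n : ℕ, HasSum
      (fun f : {f : {f : Polynomial F // f.Monic} // f.1.natDegree = n} =>
        polyNorm f.1.1 ^ (-s)) ((q ^ (1 - s)) ^ n) := by
    intro n
    rw [← (monicDegreeEquiv F n).symm.hasSum_iff]
    have h1 : ((fun f : {f : {f : Polynomial F // f.Monic} // f.1.natDegree = n} =>
        polyNorm f.1.1 ^ (-s)) ∘ (monicDegreeEquiv F n).symm) = fun _ => (q ^ n) ^ (-s) := by
      funext v
      simp only [Function.comp, polyNorm]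
      rw [((monicDegreeEquiv F n).symm v).2]
    rw [h1]
    have h2 := hasSum_fintype (fun _ : Fin n → F => (q ^ n) ^ (-s))
    convert h2 using 1
    rw [Finset.sum_const, Finset.card_univ, nsmul_eq_mul, Fintype.card_fun, Fintype.card_fin]
    push_cast
    rw [← hqdef, ← Real.rpow_natCast, ← Real.rpow_mul hq0.le, ← Real.rpow_natCast,
      ← Real.rpow_mul hq0.le, ← Real.rpow_add hq0]
    congr 1
    ring
  have hgeo : HasSum (fun n : ℕ => (q ^ (1 - s)) ^ n) (1 - q ^ (1 - s))⁻¹ :=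
    hasSum_geometric_of_lt_one (Real.rpow_nonneg hq0.le _)
      (Real.rpow_lt_one_of_one_lt_of_neg hq (by linarith))
  refine HasSum.sigma_of_hasSum hgeo hfib ?_
  rw [summable_sigma_of_nonneg]
  · refine ⟨fun n => (hfib n).summable, ?_⟩
    convert hgeo.summable using 2 with n
    exact (hfib n).tsum_eq
  · rintro ⟨n, f⟩
    exact Real.rpow_nonneg (polyNorm_pos _).le _

theorem multipliable_constK (F : Type*) [Field F] [Fintype F] :
    Multipliable (fun P : {P : Polynomial F // P.Monic ∧ Irreducible P} =>
      (1 - 1 / (polyNorm P.1 + 1) ^ 2)) := by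
  simp only [sub_eq_add_neg]
  refine Real.multipliable_one_add_of_summable (Summable.neg ?_)
  have h := (hasSum_zetaQ F 2 (by norm_num)).summable.comp_injective
    (i := fun P : {P : Polynomial F // P.Monic ∧ Irreducible P} =>
      (⟨P.1, P.2.1⟩ : {f : Polynomial F // f.Monic}))
    (fun P Q h => Subtype.ext (congrArg (fun f => f.1) h))
  refine Summable.of_nonneg_of_le (fun P => by positivity) (fun P => ?_) h
  have hP := polyNorm_pos P.1
  simp only [Function.comp]
  rw [Real.rpow_neg hP.le, one_div]
  have : polyNorm P.1 ^ (2 : ℝ) = polyNorm P.1 ^ (2 : ℕ) := by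
    exact_mod_cast Real.rpow_natCast _ 2
  rw [this]
  gcongr
  linarith

end

end TrigonalCount

/-! A squarefree monic polynomial is the same as a finite set of primes, and `F₁ * F₂ ^ 2`
determines the pair (`primeProd_mul_sq_injective`). So the task is to count disjoint pairs of finite
sets of primes. For fixed `F₂` the admissible `F₁` are counted, and the result is summed over `F₂`;
no L-functions enter.

Counting `F₁`: by interpolation, the values of monic polynomials of large degree at given points are
equidistributed. Inclusion-exclusion over square divisors gives the squarefree ones with given
nonzero values, with error `O(q ^ (n / 2))` in degree `n` (`abs_card_sqfValues_empty_sub_le`).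
Coprimality to `F₂` is imposed one prime at a time (`abs_card_sqfValues_sub_le`): each prime
multiplies the density by `(1 + 1 / |P|)⁻¹` and the error bound by `(1 - |P| ^ (-1/2))⁻¹`. A cubic
character takes each cube root of unity `(q - 1) / 3` times, so a character condition is a union of
that many value conditions at each point (`abs_card_charValues_sub_le`).

Summing over `F₂`: each `F₂` now carries the weight `∏ (1 + 1 / |P|)⁻¹ = ∏ (1 - 1 / (|P| + 1))` over
its primes. Expanding the product and counting squarefree polynomials prime to the expansion set
produces the local factors `1 - 1 / (|P| + 1) ^ 2` of `K` (`abs_weightedCount_sub_le`). No values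
are prescribed here, and the number of squarefree polynomials is given exactly by its main term from
degree 2 on, so the error can be bounded by `z ^ n` times a constant for any `1 < z ≤ q`. The choice
`z = q ^ ε` yields the saving `q ^ (-(1 - ε) d₂)`, while `F₁` contributes `q ^ (-d₁ / 2)`.

Zeros: at a point where the value is 0, exactly one of `F₁`, `F₂` vanishes. Pairs are sorted by the
set `T` of zeros of `F₂` (`card_pairValues_eq`). The main term does not depend on `T`
(`mainTerm_eq`), so the `2 ^ m` choices of `T` turn `1 / (q + 2)` into `2 / (q + 2)`.

The size of the whole family is the case of no prescribed points. For the quotient, a lower bound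
for that size valid in all degrees is also needed (`le_card_pairValues_empty`), since the asymptotic
formula says nothing when its error term is large. -/

namespace TrigonalCount

noncomputable section

open Polynomial Finset
open scoped Classical

/-! ### Squarefree polynomials as finite sets of primes -/

/-- The monic irreducible polynomials over `F`. -/
abbrev PrimePoly (F : Type*) [Field F] := {P : Polynomial F // P.Monic ∧ Irreducible P}

/-- The squarefree monic polynomial with a given set of prime factors. -/
def primeProd {F : Type*} [Field F] (s : Finset (PrimePoly F)) : F[X] := ∏ P ∈ s, P.1

/-- The degree of `primeProd s`. -/
def primeDeg {F : Type*} [Field F] (s : Finset (PrimePoly F)) : ℕ := ∑ P ∈ s, P.1.natDegree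

section Field

variable {F : Type*} [Field F]

theorem primeProd_monic (s : Finset (PrimePoly F)) : (primeProd s).Monic :=
  monic_prod_of_monic _ _ fun P _ => P.2.1

theorem natDegree_primeProd (s : Finset (PrimePoly F)) :
    (primeProd s).natDegree = primeDeg s :=
  natDegree_prod_of_monic _ _ fun P _ => P.2.1

theorem primeProd_union {s t : Finset (PrimePoly F)} (h : Disjoint s t) :
    primeProd (s ∪ t) = primeProd s * primeProd t := prod_union h

theorem primeDeg_union {s t : Finset (PrimePoly F)} (h : Disjoint s t) :
    primeDeg (s ∪ t) = primeDeg s + primeDeg t := sum_union h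

theorem primeProd_insert {s : Finset (PrimePoly F)} {P : PrimePoly F} (h : P ∉ s) :
    primeProd (insert P s) = P.1 * primeProd s := prod_insert h

theorem primeDeg_insert {s : Finset (PrimePoly F)} {P : PrimePoly F} (h : P ∉ s) :
    primeDeg (insert P s) = P.1.natDegree + primeDeg s := sum_insert h

theorem PrimePoly.natDegree_pos (P : PrimePoly F) : 0 < P.1.natDegree := P.2.2.natDegree_pos

theorem PrimePoly.isCoprime {P Q : PrimePoly F} (h : P ≠ Q) : IsCoprime P.1 Q.1 := by
  rw [P.2.2.coprime_iff_not_dvd]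
  intro hd
  exact h (Subtype.ext (eq_of_monic_of_associated P.2.1 Q.2.1
    (P.2.2.associated_of_dvd Q.2.2 hd)))

theorem primeProd_pow_dvd_iff (s : Finset (PrimePoly F)) (k : ℕ) (G : F[X]) :
    primeProd s ^ k ∣ G ↔ ∀ P ∈ s, P.1 ^ k ∣ G := by
  rw [primeProd, ← prod_pow]
  constructor
  · intro h P hP
    exact (dvd_prod_of_mem (fun P : PrimePoly F => P.1 ^ k) hP).trans h
  · intro h
    refine prod_dvd_of_coprime ?_ h
    intro P _ Q _ hPQ
    exact (PrimePoly.isCoprime hPQ).pow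

theorem dvd_primeProd_iff (P : PrimePoly F) (s : Finset (PrimePoly F)) :
    P.1 ∣ primeProd s ↔ P ∈ s := by
  constructor
  · intro h
    obtain ⟨Q, hQ, hd⟩ := (P.2.2.prime.dvd_finsetProd_iff _).1 h
    by_contra hP
    have hne : P ≠ Q := fun h => hP (h ▸ hQ)
    exact (P.2.2.coprime_iff_not_dvd.1 (PrimePoly.isCoprime hne)) hd
  · exact fun h => dvd_prod_of_mem (fun P : PrimePoly F => P.1) h

theorem primeProd_injective : Function.Injective (primeProd (F := F)) := by
  intro s t h
  ext P
  rw [← dvd_primeProd_iff, h, dvd_primeProd_iff]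

theorem primeProd_squarefree (s : Finset (PrimePoly F)) : Squarefree (primeProd s) := by
  rw [primeProd]
  refine (Finset.squarefree_prod_of_pairwise_isCoprime ?_) fun P _ => P.2.2.squarefree
  intro P _ Q _ h
  exact (PrimePoly.isCoprime h).isRelPrime

theorem isCoprime_primeProd_iff (s t : Finset (PrimePoly F)) :
    IsCoprime (primeProd s) (primeProd t) ↔ Disjoint s t := by
  constructor
  · intro h
    rw [Finset.disjoint_left]
    intro P hs ht
    exact P.2.2.not_isUnit (h.isUnit_of_dvd' ((dvd_primeProd_iff P s).2 hs)
      ((dvd_primeProd_iff P t).2 ht))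
  · intro h
    refine IsCoprime.prod_left fun P hP => IsCoprime.prod_right fun Q hQ => ?_
    exact PrimePoly.isCoprime fun hPQ => Finset.disjoint_left.1 h hP (hPQ ▸ hQ)

theorem not_sq_dvd_primeProd (P : PrimePoly F) (s : Finset (PrimePoly F)) :
    ¬ P.1 ^ 2 ∣ primeProd s := by
  rw [pow_two]
  exact fun h => P.2.2.not_isUnit (primeProd_squarefree s _ h)

theorem exists_primePoly_dvd {G : F[X]} (hG : ¬ IsUnit G) : ∃ P : PrimePoly F, P.1 ∣ G := by
  obtain ⟨g, hg, hi, hd⟩ := exists_monic_irreducible_factor G hG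
  exact ⟨⟨g, hg, hi⟩, hd⟩

/-- The prime `X - x`. -/
def linPrime (x : F) : PrimePoly F := ⟨X - C x, monic_X_sub_C x, irreducible_X_sub_C x⟩

theorem linPrime_injective : Function.Injective (linPrime (F := F)) := by
  intro x y h
  have h1 : (X - C x : F[X]) = X - C y := congrArg Subtype.val h
  simpa using h1

@[simp] theorem natDegree_linPrime (x : F) : (linPrime x).1.natDegree = 1 := natDegree_X_sub_C x

/-- The primes `X - x` for `x` in a finite set. -/
def linSet (R : Finset F) : Finset (PrimePoly F) := R.image linPrime

theorem mem_linSet {R : Finset F} {P : PrimePoly F} : P ∈ linSet R ↔ ∃ x ∈ R, linPrime x = P := by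
  simp [linSet]

@[simp] theorem linPrime_mem_linSet {R : Finset F} {x : F} : linPrime x ∈ linSet R ↔ x ∈ R := by
  simp [linSet, linPrime_injective.eq_iff]

@[simp] theorem linSet_empty : linSet (∅ : Finset F) = ∅ := rfl

theorem primeDeg_linSet (R : Finset F) : primeDeg (linSet R) = #R := by
  rw [primeDeg, linSet, sum_image linPrime_injective.injOn]
  simp

theorem eval_primeProd_eq_zero_iff (s : Finset (PrimePoly F)) (x : F) :
    (primeProd s).eval x = 0 ↔ linPrime x ∈ s := by
  rw [← dvd_primeProd_iff, linPrime, dvd_iff_isRoot, IsRoot]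

theorem PrimePoly.eval_eq_zero_iff (P : PrimePoly F) (x : F) :
    P.1.eval x = 0 ↔ P = linPrime x := by
  have h := eval_primeProd_eq_zero_iff {P} x
  simp only [primeProd, prod_singleton, mem_singleton] at h
  rw [h, eq_comm]

end Field

/-! ### Finiteness and counting by degree -/

section Finite

variable {F : Type*} [Field F] [Fintype F]

theorem finite_monic_natDegree (F : Type*) [Field F] [Fintype F] (k : ℤ) :
    {f : F[X] | f.Monic ∧ (f.natDegree : ℤ) = k}.Finite := by
  obtain ⟨n, rfl⟩ | hk : (∃ n : ℕ, k = n) ∨ k < 0 := by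
    rcases lt_or_ge k 0 with h | h
    · exact Or.inr h
    · exact Or.inl ⟨k.toNat, by omega⟩
  · have : Finite {p : F[X] // p.Monic ∧ p.natDegree = n} :=
      Finite.of_equiv _ ((Polynomial.monicEquivDegreeLT n).trans
        (Polynomial.degreeLTEquiv F n).toEquiv).symm
    simp only [Nat.cast_inj]
    exact Set.finite_coe_iff.mp this
  · refine Set.finite_empty.subset ?_
    rintro f ⟨-, h⟩
    omega

/-- The monic polynomials of degree `k`; none for negative `k`. -/
def monicDeg (F : Type*) [Field F] [Fintype F] (k : ℤ) : Finset F[X] :=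
  (finite_monic_natDegree F k).toFinset

theorem mem_monicDeg {k : ℤ} {f : F[X]} :
    f ∈ monicDeg F k ↔ f.Monic ∧ (f.natDegree : ℤ) = k := by
  simp [monicDeg]

theorem monicDeg_of_neg {k : ℤ} (hk : k < 0) : monicDeg F k = ∅ := by
  ext f
  simp only [mem_monicDeg, notMem_empty, iff_false]
  rintro ⟨-, h⟩
  omega

theorem card_monicDeg_natCast (n : ℕ) : #(monicDeg F n) = Fintype.card F ^ n := by
  have h1 : Nat.card {p : F[X] // p.Monic ∧ p.natDegree = n} = Fintype.card F ^ n := by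
    rw [Nat.card_congr ((Polynomial.monicEquivDegreeLT n).trans
        (Polynomial.degreeLTEquiv F n).toEquiv)]
    simp
  rw [← h1, ← Nat.card_eq_finsetCard]
  exact Nat.card_congr (Equiv.subtypeEquivRight fun f => by simp [mem_monicDeg])

theorem card_monicDeg {k : ℤ} (hk : 0 ≤ k) :
    (#(monicDeg F k) : ℝ) = (Fintype.card F : ℝ) ^ k := by
  lift k to ℕ using hk
  rw [card_monicDeg_natCast]
  push_cast
  simp

theorem finite_primeDeg (F : Type*) [Field F] [Fintype F] (k : ℤ) :
    {s : Finset (PrimePoly F) | (primeDeg s : ℤ) = k}.Finite := by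
  refine Set.Finite.of_finite_image (f := primeProd)
    ((finite_monic_natDegree F k).subset ?_) primeProd_injective.injOn
  rintro _ ⟨s, hs, rfl⟩
  exact ⟨primeProd_monic s, by rw [natDegree_primeProd]; exact hs⟩

/-- The squarefree monic polynomials of degree `k`, as sets of primes. -/
def sqfDeg (F : Type*) [Field F] [Fintype F] (k : ℤ) : Finset (Finset (PrimePoly F)) :=
  (finite_primeDeg F k).toFinset

@[simp] theorem mem_sqfDeg {k : ℤ} {s : Finset (PrimePoly F)} :
    s ∈ sqfDeg F k ↔ (primeDeg s : ℤ) = k := by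
  simp [sqfDeg]

theorem sqfDeg_of_neg {k : ℤ} (hk : k < 0) : sqfDeg F k = ∅ := by
  ext f
  simp only [mem_sqfDeg, notMem_empty, iff_false]
  omega

theorem finite_primePoly_dvd {G : F[X]} (hG : G ≠ 0) : {P : PrimePoly F | P.1 ∣ G}.Finite := by
  have h : (⋃ k ∈ Finset.range (G.natDegree + 1),
      {f : F[X] | f.Monic ∧ (f.natDegree : ℤ) = k}).Finite :=
    Set.Finite.biUnion (Finset.finite_toSet _) fun k _ => finite_monic_natDegree F k
  refine Set.Finite.of_finite_image (f := Subtype.val) (h.subset ?_) Subtype.val_injective.injOn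
  rintro _ ⟨P, hP, rfl⟩
  simp only [Set.mem_iUnion]
  exact ⟨P.1.natDegree, by simpa [Nat.lt_succ_iff] using natDegree_le_of_dvd hP hG, P.2.1, rfl⟩

/-- Take all prime divisors of `f`. A prime dividing the remaining cofactor would divide `f` twice.
-/
theorem exists_primeProd_eq {f : F[X]} (hm : f.Monic) (hf : Squarefree f) :
    ∃ s : Finset (PrimePoly F), primeProd s = f := by
  set s := (finite_primePoly_dvd hm.ne_zero).toFinset with hs
  have hmem : ∀ P, P ∈ s ↔ P.1 ∣ f := by simp [hs]
  refine ⟨s, ?_⟩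
  obtain ⟨g, hg⟩ : primeProd s ∣ f := by
    have := (primeProd_pow_dvd_iff s 1 f).2 (by simpa using fun P hP => (hmem P).1 hP)
    simpa using this
  have hgm : g.Monic := (primeProd_monic s).of_mul_monic_left (hg ▸ hm)
  by_cases hu : IsUnit g
  · rw [hg, hgm.isUnit_iff.1 hu, mul_one]
  · obtain ⟨P, hP⟩ := exists_primePoly_dvd hu
    have h1 : P.1 ∣ primeProd s := (dvd_primeProd_iff P s).2
      ((hmem P).2 (hg ▸ hP.mul_left _))
    exact absurd (hf P.1 (hg ▸ mul_dvd_mul h1 hP)) P.2.2.not_isUnit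

end Finite

/-! ### Monic polynomials with prescribed values -/

section Values

theorem linSet_prod_dvd_iff {F : Type*} [Field F] (V : Finset F) (G : F[X]) :
    primeProd (linSet V) ∣ G ↔ ∀ x ∈ V, G.eval x = 0 := by
  have := primeProd_pow_dvd_iff (linSet V) 1 G
  simp only [pow_one] at this
  rw [this]
  constructor
  · intro h x hx
    have := h (linPrime x) (by simpa using hx)
    rwa [linPrime, dvd_iff_isRoot] at this
  · intro h P hP
    obtain ⟨x, hx, rfl⟩ := mem_linSet.1 hP
    rw [linPrime, dvd_iff_isRoot]
    exact h x hx

variable {F : Type*} [Field F] [Fintype F]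

theorem one_lt_card_cast (F : Type*) [Field F] [Fintype F] : (1 : ℝ) < Fintype.card F := by
  exact_mod_cast Fintype.one_lt_card

/-- The monic polynomials of degree `k` with values `b` on `V`. -/
def monicValues (V : Finset F) (b : F → F) (k : ℤ) : Finset F[X] :=
  (monicDeg F k).filter fun B => ∀ x ∈ V, B.eval x = b x

theorem mem_monicValues {V : Finset F} {b : F → F} {k : ℤ} {f : F[X]} :
    f ∈ monicValues V b k ↔ (f.Monic ∧ (f.natDegree : ℤ) = k) ∧ ∀ x ∈ V, f.eval x = b x := by
  rw [monicValues, mem_filter, mem_monicDeg]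

/-- With `W` the monic polynomial vanishing on `V` and `L` the Lagrange interpolant of `b`, the
solutions are `W * C + L` with `C` monic of degree `k - #V`; `L` has too small a degree to disturb
the leading term. -/
theorem card_monicValues_of_ge (V : Finset F) (b : F → F) {k : ℤ} (hk : (#V : ℤ) ≤ k) :
    (#(monicValues V b k) : ℝ) = (Fintype.card F : ℝ) ^ (k - #V) := by
  rw [← card_monicDeg (by omega)]
  congr 1
  set W := primeProd (linSet V) with hW
  have hWm : W.Monic := primeProd_monic _
  have hWd : W.natDegree = #V := by rw [hW, natDegree_primeProd, primeDeg_linSet]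
  have hW0 : ∀ x ∈ V, W.eval x = 0 := fun x hx => by
    rw [hW, eval_primeProd_eq_zero_iff]; simpa using hx
  set L := Lagrange.interpolate V id b with hL
  have hLd : L.degree < #V := Lagrange.degree_interpolate_lt b Function.injective_id.injOn
  have hLv : ∀ x ∈ V, L.eval x = b x := fun x hx =>
    Lagrange.eval_interpolate_at_node (v := id) b Function.injective_id.injOn hx
  symm
  refine Finset.card_bij (fun C _ => W * C + L) ?_ ?_ ?_
  · intro C hC
    rw [mem_monicDeg] at hC
    have hm : (W * C).Monic := hWm.mul hC.1
    have hd : (W * C).natDegree = #V + C.natDegree := by rw [hWm.natDegree_mul hC.1, hWd]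
    have hlt : L.degree < (W * C).degree := by
      rw [degree_eq_natDegree hm.ne_zero, hd]
      exact hLd.trans_le (by exact_mod_cast Nat.le_add_right _ _)
    rw [mem_monicValues]
    refine ⟨⟨hm.add_of_left hlt, ?_⟩, fun x hx => ?_⟩
    · rw [natDegree_add_eq_left_of_degree_lt hlt, hd]
      push_cast
      omega
    · simp [hW0 x hx, hLv x hx]
  · intro C _ D _ h
    exact mul_left_cancel₀ hWm.ne_zero (add_right_cancel h)
  · intro B hB
    rw [mem_monicValues] at hB
    obtain ⟨⟨hBm, hBd⟩, hBv⟩ := hB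
    obtain ⟨C, hC⟩ : W ∣ B - L := (linSet_prod_dvd_iff V _).2 fun x hx => by
      rw [eval_sub, hBv x hx, hLv x hx, sub_self]
    have hlt : L.degree < B.degree := by
      rw [degree_eq_natDegree hBm.ne_zero]
      exact hLd.trans_le (by exact_mod_cast (by omega : #V ≤ B.natDegree))
    have hCm : C.Monic := hWm.of_mul_monic_left (hC ▸ hBm.sub_of_left hlt)
    refine ⟨C, ?_, by rw [← hC]; ring⟩
    rw [mem_monicDeg]
    refine ⟨hCm, ?_⟩
    have h1 := hWm.natDegree_mul hCm
    rw [← hC, natDegree_eq_of_degree_eq (degree_sub_eq_left_of_degree_lt hlt), hWd] at h1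
    omega

/-- The leading terms of two solutions cancel, so their difference has degree below `#V` and
vanishes on `V`. -/
theorem card_monicValues_le_one (V : Finset F) (b : F → F) {k : ℤ} (hk : k ≤ #V) :
    #(monicValues V b k) ≤ 1 := by
  rw [card_le_one]
  intro B hB D hD
  rw [mem_monicValues] at hB hD
  obtain ⟨⟨hBm, hBd⟩, hBv⟩ := hB
  obtain ⟨⟨hDm, hDd⟩, hDv⟩ := hD
  have hdeg : B.degree = D.degree := by
    rw [degree_eq_natDegree hBm.ne_zero, degree_eq_natDegree hDm.ne_zero]
    have : B.natDegree = D.natDegree := by omega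
    rw [this]
  have hlt : (B - D).degree < B.degree :=
    degree_sub_lt_left hdeg hBm.ne_zero (by rw [hBm.leadingCoeff, hDm.leadingCoeff])
  have h0 : B - D = 0 := by
    refine eq_zero_of_degree_lt_of_eval_finset_eq_zero V (hlt.trans_le ?_) fun x hx => ?_
    · rw [degree_eq_natDegree hBm.ne_zero]
      exact_mod_cast (by omega : B.natDegree ≤ #V)
    · rw [eval_sub, hBv x hx, hDv x hx, sub_self]
  exact sub_eq_zero.1 h0

/-- The number of monic polynomials of degree `k` with given values on `V` is `q ^ (k - #V)`,
up to an error of at most `1`. -/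
theorem abs_card_monicValues_sub_le (V : Finset F) (b : F → F) (k : ℤ) :
    |(#(monicValues V b k) : ℝ) - (Fintype.card F : ℝ) ^ (k - #V)| ≤
      min 1 ((Fintype.card F : ℝ) ^ k) := by
  have hq := one_lt_card_cast F
  have hq0 : (0 : ℝ) < Fintype.card F := by linarith
  rcases le_or_gt (#V : ℤ) k with h | h
  · rw [card_monicValues_of_ge V b h, sub_self, abs_zero]
    positivity
  rcases lt_or_ge k 0 with h0 | h0
  -- In negative degree the bound `q ^ k`, smaller than 1, is what later makes the errors summable
  -- over all moduli.
  · have : #(monicValues V b k) = 0 := by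
      rw [monicValues, monicDeg_of_neg h0]; simp
    rw [this, Nat.cast_zero, zero_sub, abs_neg, abs_of_pos (by positivity)]
    refine le_min ?_ ?_
    · exact zpow_le_one_of_nonpos₀ hq.le (by omega)
    · exact zpow_le_zpow_right₀ hq.le (by omega)
  · have h1 : (#(monicValues V b k) : ℝ) ≤ 1 := by
      exact_mod_cast card_monicValues_le_one V b h.le
    have h2 : (Fintype.card F : ℝ) ^ (k - #V) ≤ 1 := zpow_le_one_of_nonpos₀ hq.le (by omega)
    have h3 : (0 : ℝ) < (Fintype.card F : ℝ) ^ (k - #V) := by positivity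
    have h4 : (0 : ℝ) ≤ #(monicValues V b k) := by positivity
    rw [min_eq_left (one_le_zpow₀ hq.le h0), abs_le]
    constructor <;> linarith

/-- Removing a factor which does not vanish on `V`. -/
theorem card_filter_dvd_monicValues (V : Finset F) (a : F → F) (n : ℤ) {M : F[X]} (hM : M.Monic)
    (hMV : ∀ x ∈ V, M.eval x ≠ 0) :
    #((monicValues V a n).filter fun G => M ∣ G) =
      #(monicValues V (fun x => a x / M.eval x) (n - M.natDegree)) := by
  symm
  refine Finset.card_bij (fun B _ => M * B) ?_ ?_ ?_
  · intro B hB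
    rw [mem_monicValues] at hB
    rw [mem_filter, mem_monicValues, hM.natDegree_mul hB.1.1]
    refine ⟨⟨⟨hM.mul hB.1.1, by push_cast; omega⟩, fun x hx => ?_⟩, dvd_mul_right _ _⟩
    rw [eval_mul, hB.2 x hx, mul_div_cancel₀ _ (hMV x hx)]
  · intro C _ D _ h
    exact mul_left_cancel₀ hM.ne_zero h
  · intro G hG
    rw [mem_filter, mem_monicValues] at hG
    obtain ⟨⟨⟨hGm, hGd⟩, hGv⟩, B, rfl⟩ := hG
    have hB : B.Monic := hM.of_mul_monic_left hGm
    rw [hM.natDegree_mul hB] at hGd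
    refine ⟨B, ?_, rfl⟩
    rw [mem_monicValues]
    refine ⟨⟨hB, by push_cast at hGd; omega⟩, fun x hx => ?_⟩
    rw [← hGv x hx, eval_mul, mul_div_cancel_left₀ _ (hMV x hx)]

theorem monicValues_empty (b : F → F) (k : ℤ) : monicValues ∅ b k = monicDeg F k := by
  simp [monicValues]

theorem card_filter_dvd_monicDeg (n : ℤ) {M : F[X]} (hM : M.Monic) :
    #((monicDeg F n).filter fun G => M ∣ G) = #(monicDeg F (n - M.natDegree)) := by
  have := card_filter_dvd_monicValues ∅ (fun _ => 1) n hM (by simp)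
  simpa only [monicValues_empty] using this

end Values

/-! ### Euler products as sums over finite sets of primes -/

section Products

variable {F : Type*} [Field F]

theorem primeDeg_singleton (P : PrimePoly F) : primeDeg {P} = P.1.natDegree := by
  simp [primeDeg]

theorem pow_primeDeg (y : ℝ) (s : Finset (PrimePoly F)) :
    y ^ primeDeg s = ∏ P ∈ s, y ^ P.1.natDegree := (prod_pow_eq_pow_sum _ _ _).symm

theorem summable_prod_primes {f : PrimePoly F → ℝ} (hf : Summable fun P => |f P|) :
    Summable fun s : Finset (PrimePoly F) => ∏ P ∈ s, f P :=
  summable_finsetProd_of_summable_norm hf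

theorem ite_disjoint_prod (f : PrimePoly F → ℝ) (R s : Finset (PrimePoly F)) :
    (if Disjoint s R then ∏ P ∈ s, f P else 0) = ∏ P ∈ s, if P ∈ R then 0 else f P := by
  split_ifs with h
  · refine prod_congr rfl fun P hP => ?_
    rw [if_neg (Finset.disjoint_left.1 h hP)]
  · rw [Finset.not_disjoint_iff] at h
    obtain ⟨P, hs, hR⟩ := h
    exact (prod_eq_zero hs (by simp [hR])).symm

theorem summable_ite {f : PrimePoly F → ℝ} (hf : Summable fun P => |f P|)
    (R : Finset (PrimePoly F)) : Summable fun P => |if P ∈ R then 0 else f P| :=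
  Summable.of_nonneg_of_le (fun _ => abs_nonneg _)
    (fun P => by split_ifs <;> simp) hf

theorem summable_ite_disjoint_prod {f : PrimePoly F → ℝ} (hf : Summable fun P => |f P|)
    (R : Finset (PrimePoly F)) :
    Summable fun s => if Disjoint s R then ∏ P ∈ s, f P else 0 := by
  simp_rw [ite_disjoint_prod]
  exact summable_prod_primes (summable_ite hf R)

theorem tsum_prod_primes {f : PrimePoly F → ℝ} (hf : Summable fun P => |f P|) :
    ∑' s : Finset (PrimePoly F), ∏ P ∈ s, f P = ∏' P, (1 + f P) :=
  (tprod_one_add (summable_prod_primes hf)).symm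

/-- Setting `f` to zero on `R` removes the Euler factors there. They are multiplied back rather than
divided out, so they need not be nonzero. -/
theorem tsum_ite_disjoint_prod {f : PrimePoly F → ℝ} (hf : Summable fun P => |f P|)
    (R : Finset (PrimePoly F)) :
    (∑' s, if Disjoint s R then ∏ P ∈ s, f P else 0) * ∏ P ∈ R, (1 + f P) =
      ∏' P, (1 + f P) := by
  simp_rw [ite_disjoint_prod]
  have h1 := summable_prod_primes (summable_ite hf R)
  rw [← tprod_one_add h1]
  have h2 : ∏' P, (1 + if P ∈ R then f P else 0) = ∏ P ∈ R, (1 + f P) := by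
    rw [tprod_eq_prod (s := R) (fun P hP => by simp [hP])]
    exact prod_congr rfl fun P hP => by simp [hP]
  rw [← h2, ← Multipliable.tprod_mul]
  · refine tprod_congr fun P => ?_
    split_ifs <;> simp
  · exact multipliable_one_add_of_summable_prod h1
  · exact multipliable_of_ne_finset_one (s := R) (fun P hP => by simp [hP])

/-- A finite family of sets lies in the powerset of its union, where the sum factors into `∏ (1 + f
P)`; then `1 + x ≤ exp x`. -/
theorem tsum_prod_le_exp_tsum {f : PrimePoly F → ℝ} (hf0 : ∀ P, 0 ≤ f P) (hf : Summable f) :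
    ∑' s : Finset (PrimePoly F), ∏ P ∈ s, f P ≤ Real.exp (∑' P, f P) := by
  refine Real.tsum_le_of_sum_le (fun s => prod_nonneg fun P _ => hf0 P) fun u => ?_
  calc ∑ s ∈ u, ∏ P ∈ s, f P ≤ ∑ s ∈ (u.sup id).powerset, ∏ P ∈ s, f P :=
        sum_le_sum_of_subset_of_nonneg (fun s hs => mem_powerset.2 (le_sup (f := id) hs))
          fun _ _ _ => prod_nonneg fun P _ => hf0 P
    _ = ∏ P ∈ u.sup id, (1 + f P) := (prod_one_add _).symm
    _ ≤ ∏ P ∈ u.sup id, Real.exp (f P) :=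
        prod_le_prod (fun P _ => by linarith [hf0 P])
          fun P _ => by linarith [Real.add_one_le_exp (f P)]
    _ = Real.exp (∑ P ∈ u.sup id, f P) := (Real.exp_sum _ _).symm
    _ ≤ _ := Real.exp_le_exp.2 (hf.sum_le_tsum _ fun P _ => hf0 P)

theorem neg_one_pow_card_mul_pow (y : ℝ) (s : Finset (PrimePoly F)) :
    ∏ P ∈ s, (-(y ^ P.1.natDegree)) = (-1) ^ #s * y ^ primeDeg s := by
  rw [prod_neg, pow_primeDeg]

end Products

/-! ### Sums over primes and squarefree polynomials compared with power series -/

section Series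

variable {F : Type*} [Field F] [Fintype F]

/-- The sets of primes whose product has degree at most `N`. -/
def sqfLe (F : Type*) [Field F] [Fintype F] (N : ℕ) : Finset (Finset (PrimePoly F)) :=
  (range (N + 1)).biUnion fun j => sqfDeg F j

theorem mem_sqfLe {N : ℕ} {s : Finset (PrimePoly F)} : s ∈ sqfLe F N ↔ primeDeg s ≤ N := by
  simp [sqfLe]

theorem sum_sqfLe {M : Type*} [AddCommMonoid M] (N : ℕ) (f : Finset (PrimePoly F) → M) :
    ∑ s ∈ sqfLe F N, f s = ∑ j ∈ range (N + 1), ∑ s ∈ sqfDeg F j, f s := by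
  refine sum_biUnion ?_
  intro i _ j _ hij
  rw [Function.onFun, Finset.disjoint_left]
  intro s hi hj
  rw [mem_sqfDeg] at hi hj
  exact hij (by omega)

theorem card_sqfDeg_le (j : ℕ) : #(sqfDeg F j) ≤ Fintype.card F ^ j := by
  rw [← card_monicDeg_natCast]
  refine card_le_card_of_injOn primeProd (fun s hs => ?_) primeProd_injective.injOn
  have hs' : (primeDeg s : ℤ) = j := by simpa using hs
  simp only [mem_coe]
  rw [mem_monicDeg]
  exact ⟨primeProd_monic s, by rw [natDegree_primeProd]; exact hs'⟩

/-- At most `q ^ j` squarefree monic polynomials have degree `j`, so grouping by degree reduces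
convergence to a power series. -/
theorem sum_comp_primeDeg_le {g : ℕ → ℝ} (hg : ∀ j, 0 ≤ g j)
    (hs : Summable fun j => (Fintype.card F : ℝ) ^ j * g j)
    (u : Finset (Finset (PrimePoly F))) :
    ∑ s ∈ u, g (primeDeg s) ≤ ∑' j, (Fintype.card F : ℝ) ^ j * g j := by
  set N := u.sup primeDeg
  have hu : u ⊆ sqfLe F N := fun s h => mem_sqfLe.2 (le_sup (f := primeDeg) h)
  calc ∑ s ∈ u, g (primeDeg s) ≤ ∑ s ∈ sqfLe F N, g (primeDeg s) :=
        sum_le_sum_of_subset_of_nonneg hu fun _ _ _ => hg _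
    _ = ∑ j ∈ range (N + 1), (#(sqfDeg F j) : ℝ) * g j := by
        rw [sum_sqfLe]
        refine sum_congr rfl fun j _ => ?_
        rw [← nsmul_eq_mul]
        refine sum_eq_card_nsmul fun s hs => ?_
        have : primeDeg s = j := by simpa using hs
        rw [this]
    _ ≤ ∑ j ∈ range (N + 1), (Fintype.card F : ℝ) ^ j * g j := by
        refine sum_le_sum fun j _ => mul_le_mul_of_nonneg_right ?_ (hg j)
        exact_mod_cast card_sqfDeg_le j
    _ ≤ _ := hs.sum_le_tsum _ fun j _ => mul_nonneg (by positivity) (hg j)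

theorem summable_comp_primeDeg {g : ℕ → ℝ} (hg : ∀ j, 0 ≤ g j)
    (hs : Summable fun j => (Fintype.card F : ℝ) ^ j * g j) :
    Summable fun s : Finset (PrimePoly F) => g (primeDeg s) :=
  summable_of_sum_le (fun _ => hg _) (sum_comp_primeDeg_le hg hs)

theorem tsum_comp_primeDeg_le {g : ℕ → ℝ} (hg : ∀ j, 0 ≤ g j)
    (hs : Summable fun j => (Fintype.card F : ℝ) ^ j * g j) :
    ∑' s : Finset (PrimePoly F), g (primeDeg s) ≤ ∑' j, (Fintype.card F : ℝ) ^ j * g j :=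
  Real.tsum_le_of_sum_le (fun _ => hg _) (sum_comp_primeDeg_le hg hs)

theorem summable_comp_natDegree {g : ℕ → ℝ} (hg : ∀ j, 0 ≤ g j)
    (hs : Summable fun j => (Fintype.card F : ℝ) ^ j * g j) :
    Summable fun P : PrimePoly F => g P.1.natDegree := by
  have := (summable_comp_primeDeg hg hs).comp_injective
    (i := fun P : PrimePoly F => {P}) Finset.singleton_injective
  simpa only [Function.comp_def, primeDeg_singleton] using this

theorem tsum_comp_natDegree_le {g : ℕ → ℝ} (hg : ∀ j, 0 ≤ g j)
    (hs : Summable fun j => (Fintype.card F : ℝ) ^ j * g j) :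
    ∑' P : PrimePoly F, g P.1.natDegree ≤ ∑' j, (Fintype.card F : ℝ) ^ j * g j := by
  refine le_trans ?_ (tsum_comp_primeDeg_le hg hs)
  have := tsum_comp_le_tsum_of_inj (summable_comp_primeDeg (F := F) hg hs) (fun _ => hg _)
    (i := fun P : PrimePoly F => {P}) Finset.singleton_injective
  simpa only [Function.comp_def, primeDeg_singleton] using this

/-- Powers of the norm: the sum over the primes of `y ^ deg P`. -/
theorem summable_pow_natDegree {y : ℝ} (hy0 : 0 ≤ y) (hy : Fintype.card F * y < 1) :
    Summable fun P : PrimePoly F => y ^ P.1.natDegree := by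
  refine summable_comp_natDegree (g := fun j => y ^ j) (fun j => by positivity) ?_
  simp_rw [← mul_pow]
  exact summable_geometric_of_lt_one (by positivity) hy

theorem tsum_pow_natDegree_le {y : ℝ} (hy0 : 0 ≤ y) (hy : Fintype.card F * y < 1) :
    ∑' P : PrimePoly F, y ^ P.1.natDegree ≤ Fintype.card F * y * (1 - Fintype.card F * y)⁻¹ := by
  -- Primes have positive degree, so the term `j = 0` can be dropped; this gains the factor `q * y`
  -- in the bound.
  set g : ℕ → ℝ := fun j => if j = 0 then 0 else y ^ j with hg
  have hs : HasSum (fun j => (Fintype.card F : ℝ) ^ j * g j)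
      (Fintype.card F * y * (1 - Fintype.card F * y)⁻¹) := by
    have h1 := (hasSum_geometric_of_lt_one (by positivity) hy).mul_left (Fintype.card F * y)
    rw [← hasSum_nat_add_iff' 1]
    simpa [hg, ← mul_pow, pow_succ', mul_assoc, mul_left_comm] using h1
  have h2 := tsum_comp_natDegree_le (F := F) (g := g)
    (fun j => by simp only [hg]; split_ifs <;> positivity) hs.summable
  rw [hs.tsum_eq] at h2
  refine le_trans (le_of_eq ?_) h2
  refine tsum_congr fun P => ?_
  simp [hg, P.natDegree_pos.ne']

theorem hasSum_sum_sqfDeg {f : Finset (PrimePoly F) → ℝ} (hf : Summable f) :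
    HasSum (fun j : ℕ => ∑ s ∈ sqfDeg F j, f s) (∑' s, f s) := by
  have h1 := (Equiv.sigmaFiberEquiv (primeDeg (F := F))).hasSum_iff.2 hf.hasSum
  refine h1.sigma fun j => ?_
  have h2 := hasSum_fintype (fun s : {s // s ∈ sqfDeg F j} => f s.1)
  rw [sum_coe_sort] at h2
  rw [← (Equiv.subtypeEquivRight (fun s => by simp) :
    {s // s ∈ sqfDeg F j} ≃ {s : Finset (PrimePoly F) // primeDeg s = j}).hasSum_iff]
  exact h2

end Series

/-! ### Möbius inversion and the inverse zeta function -/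

section Moebius

variable {F : Type*} [Field F] [Fintype F]

/-- The sets in the sum are exactly the subsets of the finite set of primes whose `k`-th power
divides `G`; their alternating sum vanishes unless that set is empty. The case `k = 1` gives Möbius
inversion, `k = 2` detects squarefreeness. -/
theorem sum_filter_pow_dvd {G : F[X]} (hG : G.Monic) {k N : ℕ} (hk : k ≠ 0)
    (hN : G.natDegree ≤ N) :
    ∑ s ∈ (sqfLe F N).filter (fun s => primeProd s ^ k ∣ G), (-1 : ℝ) ^ #s =
      if ∃ P : PrimePoly F, P.1 ^ k ∣ G then 0 else 1 := by
  have hfin : {P : PrimePoly F | P.1 ^ k ∣ G}.Finite :=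
    (finite_primePoly_dvd hG.ne_zero).subset fun P hP => (dvd_pow_self _ hk).trans hP
  have hset : (sqfLe F N).filter (fun s => primeProd s ^ k ∣ G) = hfin.toFinset.powerset := by
    ext s
    rw [mem_filter, mem_sqfLe, mem_powerset, primeProd_pow_dvd_iff]
    have : s ⊆ hfin.toFinset ↔ ∀ P ∈ s, P.1 ^ k ∣ G := by simp [Finset.subset_iff]
    rw [this, and_iff_right_iff_imp]
    intro h
    have h1 := natDegree_le_of_dvd ((primeProd_pow_dvd_iff s k G).2 h) hG.ne_zero
    rw [natDegree_pow, natDegree_primeProd] at h1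
    nlinarith [Nat.pos_of_ne_zero hk]
  rw [hset]
  have h1 := sum_powerset_neg_one_pow_card (x := hfin.toFinset)
  have h2 : ∑ s ∈ hfin.toFinset.powerset, (-1 : ℝ) ^ #s =
      ((∑ s ∈ hfin.toFinset.powerset, (-1 : ℤ) ^ #s : ℤ) : ℝ) := by push_cast; rfl
  rw [h2, h1]
  by_cases h : ∃ P : PrimePoly F, P.1 ^ k ∣ G
  · obtain ⟨P, hP⟩ := h
    have : hfin.toFinset ≠ ∅ := fun h0 => by
      have : P ∈ hfin.toFinset := by simpa using hP
      simp [h0] at this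
    rw [if_neg this, if_pos ⟨P, hP⟩]
    simp
  · have : hfin.toFinset = ∅ := by
      ext P
      simpa using fun hP => h ⟨P, hP⟩
    rw [if_pos this, if_neg h]
    simp

/-- The sum of the Möbius function over the monic polynomials of degree `n`. -/
def moebiusSum (F : Type*) [Field F] [Fintype F] (n : ℕ) : ℝ :=
  ∑ s ∈ sqfDeg F n, (-1 : ℝ) ^ #s

/-- This is `ζ⁻¹ * ζ = 1` coefficient by coefficient, proved by double counting the pairs of `G` of
degree `n` and `s` with `primeProd s ∣ G`. -/
theorem sum_moebiusSum_mul (n : ℕ) :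
    ∑ j ∈ range (n + 1), moebiusSum F j * (Fintype.card F : ℝ) ^ (n - j) =
      if n = 0 then 1 else 0 := by
  have h1 : ∑ G ∈ monicDeg F n,
      ∑ s ∈ (sqfLe F n).filter (fun s => primeProd s ∣ G), (-1 : ℝ) ^ #s =
      if n = 0 then 1 else 0 := by
    have : ∀ G ∈ monicDeg F n,
        ∑ s ∈ (sqfLe F n).filter (fun s => primeProd s ∣ G), (-1 : ℝ) ^ #s =
        if n = 0 then 1 else 0 := by
      intro G hG
      rw [mem_monicDeg] at hG
      have h := sum_filter_pow_dvd hG.1 one_ne_zero (N := n) (by omega)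
      simp only [pow_one] at h
      rw [h]
      have hu : (∃ P : PrimePoly F, P.1 ∣ G) ↔ n ≠ 0 := by
        constructor
        · rintro ⟨P, hP⟩
          have := natDegree_le_of_dvd hP hG.1.ne_zero
          have := P.natDegree_pos
          omega
        · intro hn
          refine exists_primePoly_dvd fun hGu => hn ?_
          have := natDegree_eq_zero_of_isUnit hGu
          omega
      by_cases hn : n = 0 <;> simp [hn, hu]
    rw [sum_congr rfl this, sum_const, card_monicDeg_natCast]
    split_ifs with hn <;> simp [hn]
  rw [← h1]
  simp_rw [sum_filter]
  rw [sum_comm, sum_sqfLe]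
  refine sum_congr rfl fun j hj => ?_
  rw [moebiusSum, sum_mul]
  refine sum_congr rfl fun s hs => ?_
  rw [← sum_filter, sum_const, card_filter_dvd_monicDeg n (primeProd_monic s),
    natDegree_primeProd]
  have hs' : primeDeg s = j := by simpa using hs
  have hj' : j ≤ n := by simpa [Nat.lt_succ_iff] using hj
  rw [hs', ← Nat.cast_sub hj', card_monicDeg_natCast, nsmul_eq_mul, mul_comm]
  push_cast
  rfl

theorem moebiusSum_zero : moebiusSum F 0 = 1 := by
  have := sum_moebiusSum_mul (F := F) 0
  simpa using this

/-- Subtract `q` times the convolution identity in degree `n` from the one in degree `n + 1`. The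
generating function of `moebiusSum` is thus the polynomial `1 - q * u`. -/
theorem moebiusSum_succ (n : ℕ) :
    moebiusSum F (n + 1) = if n = 0 then -(Fintype.card F : ℝ) else 0 := by
  have h1 := sum_moebiusSum_mul (F := F) (n + 1)
  have h2 := sum_moebiusSum_mul (F := F) n
  rw [sum_range_succ] at h1
  have h3 : ∑ j ∈ range (n + 1), moebiusSum F j * (Fintype.card F : ℝ) ^ (n + 1 - j) =
      Fintype.card F * ∑ j ∈ range (n + 1), moebiusSum F j * (Fintype.card F : ℝ) ^ (n - j) := by
    rw [mul_sum]
    refine sum_congr rfl fun j hj => ?_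
    have : j ≤ n := by simpa [Nat.lt_succ_iff] using hj
    rw [Nat.succ_sub this, pow_succ]
    ring
  rw [h3, h2] at h1
  simp only [Nat.succ_ne_zero, if_false, Nat.sub_self, pow_zero, mul_one] at h1
  split_ifs at h1 ⊢ with h0 <;> linarith

theorem summable_abs_neg_norm {y : ℝ} (hy0 : 0 ≤ y) (hy : Fintype.card F * y < 1) :
    Summable fun P : PrimePoly F => |-(y ^ P.1.natDegree)| := by
  refine (summable_pow_natDegree hy0 hy).congr fun P => ?_
  rw [abs_neg, abs_of_nonneg (by positivity)]

/-- The Euler product of the inverse of the zeta function. -/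
theorem tprod_one_sub_pow {y : ℝ} (hy0 : 0 ≤ y) (hy : Fintype.card F * y < 1) :
    ∏' P : PrimePoly F, (1 + -(y ^ P.1.natDegree)) = 1 - Fintype.card F * y := by
  have hs := summable_abs_neg_norm (F := F) hy0 hy
  rw [← tsum_prod_primes hs]
  have h1 := hasSum_sum_sqfDeg (summable_prod_primes hs)
  simp_rw [neg_one_pow_card_mul_pow] at h1 ⊢
  have h2 : ∀ j : ℕ, ∑ s ∈ sqfDeg F j, (-1 : ℝ) ^ #s * y ^ primeDeg s = moebiusSum F j * y ^ j := by
    intro j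
    rw [moebiusSum, sum_mul]
    refine sum_congr rfl fun s hs => ?_
    have hs' : primeDeg s = j := by simpa using hs
    rw [hs']
  simp_rw [h2] at h1
  rw [← h1.tsum_eq, tsum_eq_sum (s := range 2)]
  · rw [sum_range_succ, sum_range_one, moebiusSum_zero, moebiusSum_succ]
    simp [sub_eq_add_neg]
  · intro j hj
    obtain ⟨i, rfl⟩ : ∃ i, j = i + 2 := ⟨j - 2, by simp at hj; omega⟩
    rw [moebiusSum_succ]
    simp

end Moebius

/-! ### The total error of the square sieve -/

theorem summable_two_zpow_abs {h : ℝ} (hh : 2 ≤ h) :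
    Summable (fun i : ℤ => (h⁻¹) ^ i.natAbs) ∧ ∑' i : ℤ, (h⁻¹) ^ i.natAbs ≤ 3 := by
  have h0 : 0 ≤ h⁻¹ := by positivity
  have h1 : h⁻¹ ≤ 2⁻¹ := inv_anti₀ (by norm_num) hh
  have hg := hasSum_geometric_of_lt_one h0 (by linarith)
  have hg' := hg.mul_left h⁻¹
  have hs := HasSum.of_nat_of_neg_add_one (f := fun i : ℤ => (h⁻¹) ^ i.natAbs)
    (m := (1 - h⁻¹)⁻¹) (m' := h⁻¹ * (1 - h⁻¹)⁻¹) (by simpa using hg) (by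
      refine hg'.congr_fun fun n => ?_
      have : (-((n : ℤ) + 1)).natAbs = n + 1 := by omega
      rw [this, pow_succ'])
  refine ⟨hs.summable, ?_⟩
  rw [hs.tsum_eq]
  have h2 : (1 - h⁻¹)⁻¹ ≤ 2 := by
    rw [inv_le_comm₀ (by linarith) (by norm_num)]
    linarith
  nlinarith

/-- With `q = h ^ 2`, there are at most `q ^ j` moduli of degree `j`, each with error at most `min 1
(q ^ (n - 2 * j))`. The product peaks at `j = n / 2` and decays geometrically on both sides, so the
total is of order `h ^ n = q ^ (n / 2)`. -/
theorem pow_mul_min_eq {h : ℝ} (hh : 2 ≤ h) (n : ℤ) (j : ℕ) :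
    (h ^ 2) ^ j * min 1 ((h ^ 2) ^ (n - 2 * j)) = h ^ n * (h⁻¹) ^ (2 * (j : ℤ) - n).natAbs := by
  have h0 : h ≠ 0 := by linarith
  have h1 : (1 : ℝ) ≤ h ^ 2 := by nlinarith
  have hq : ∀ m : ℤ, (h ^ 2) ^ m = h ^ (2 * m) := fun m => by
    rw [zpow_mul]; norm_cast
  rw [inv_pow, ← zpow_natCast h (Int.natAbs _), ← zpow_neg, ← zpow_add₀ h0, ← zpow_natCast (h ^ 2), hq,
    hq]
  rcases le_total (2 * (j : ℤ)) n with hj | hj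
  · rw [min_eq_left (one_le_zpow₀ (by linarith) (by omega)), mul_one]
    congr 1
    omega
  · rw [min_eq_right (zpow_le_one_of_nonpos₀ (by linarith) (by omega)), ← zpow_add₀ h0]
    congr 1
    omega

theorem summable_pow_mul_min {h : ℝ} (hh : 2 ≤ h) (n : ℤ) :
    Summable (fun j : ℕ => (h ^ 2) ^ j * min 1 ((h ^ 2) ^ (n - 2 * j))) ∧
    ∑' j : ℕ, (h ^ 2) ^ j * min 1 ((h ^ 2) ^ (n - 2 * j)) ≤ 3 * h ^ n := by
  simp_rw [pow_mul_min_eq hh]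
  obtain ⟨h1, h2⟩ := summable_two_zpow_abs hh
  have hi : Function.Injective fun j : ℕ => 2 * (j : ℤ) - n := fun a b hab => by
    simp only at hab; omega
  refine ⟨(h1.comp_injective hi).mul_left _, ?_⟩
  rw [tsum_mul_left, mul_comm]
  have h3 := tsum_comp_le_tsum_of_inj h1 (fun _ => by positivity) hi
  refine mul_le_mul_of_nonneg_right (h3.trans h2) (by positivity)

/-! ### Squarefree polynomials with prescribed values and coprimality conditions -/

section Values

variable {F : Type*} [Field F] [Fintype F]

/-- The squarefree monic polynomials of degree `j`, prime to `Q`, with values `a` on `V`. -/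
def sqfValues (V : Finset F) (a : F → F) (Q : Finset (PrimePoly F)) (j : ℤ) :
    Finset (Finset (PrimePoly F)) :=
  (sqfDeg F j).filter fun s => Disjoint s Q ∧ ∀ x ∈ V, (primeProd s).eval x = a x

theorem mem_sqfValues {V : Finset F} {a : F → F} {Q s : Finset (PrimePoly F)} {j : ℤ} :
    s ∈ sqfValues V a Q j ↔
      (primeDeg s : ℤ) = j ∧ Disjoint s Q ∧ ∀ x ∈ V, (primeProd s).eval x = a x := by
  rw [sqfValues, mem_filter, mem_sqfDeg]

theorem sqfValues_of_neg (V : Finset F) (a : F → F) (Q : Finset (PrimePoly F)) {j : ℤ}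
    (hj : j < 0) : sqfValues V a Q j = ∅ := by
  rw [sqfValues, sqfDeg_of_neg hj, filter_empty]

theorem card_sqfValues_empty (V : Finset F) (a : F → F) (n : ℤ) :
    #(sqfValues V a ∅ n) =
      #((monicValues V a n).filter fun G => ¬ ∃ P : PrimePoly F, P.1 ^ 2 ∣ G) := by
  refine Finset.card_bij (fun s _ => primeProd s) ?_ (fun s _ t _ h => primeProd_injective h) ?_
  · intro s hs
    rw [mem_sqfValues] at hs
    rw [mem_filter, mem_monicValues, natDegree_primeProd]
    refine ⟨⟨⟨primeProd_monic s, hs.1⟩, hs.2.2⟩, ?_⟩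
    rintro ⟨P, hP⟩
    exact not_sq_dvd_primeProd P s hP
  · intro G hG
    rw [mem_filter, mem_monicValues] at hG
    obtain ⟨⟨⟨hm, hd⟩, hv⟩, hsq⟩ := hG
    have hsf : Squarefree G := by
      intro g hg
      by_contra hu
      obtain ⟨P, hP⟩ := exists_primePoly_dvd hu
      exact hsq ⟨P, by rw [pow_two]; exact (mul_dvd_mul hP hP).trans hg⟩
    obtain ⟨s, rfl⟩ := exists_primeProd_eq hm hsf
    rw [natDegree_primeProd] at hd
    exact ⟨s, mem_sqfValues.2 ⟨hd, by simp, hv⟩, rfl⟩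

/-- Inclusion-exclusion over square divisors. A modulus with a zero on `V` contributes nothing
because the values are nonzero; any other can be divided out, which changes the prescribed values.
The finite sum is stated as a series over all `s` so that it can be compared term by term with an
Euler product. -/
theorem hasSum_card_sqfValues (V : Finset F) {a : F → F} (ha : ∀ x ∈ V, a x ≠ 0) (n : ℤ) :
    HasSum (fun s : Finset (PrimePoly F) => if Disjoint s (linSet V) then (-1 : ℝ) ^ #s *
      #(monicValues V (fun x => a x / (primeProd s ^ 2).eval x) (n - 2 * primeDeg s)) else 0)
      (#(sqfValues V a ∅ n)) := by
  have hneg : ∀ (b : F → F) {k : ℤ}, k < 0 → monicValues V b k = ∅ := fun b k hk => by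
    rw [monicValues, monicDeg_of_neg hk, filter_empty]
  rcases lt_or_ge n 0 with hn | hn
  · rw [sqfValues_of_neg _ _ _ hn]
    convert hasSum_zero using 2 with s
    · rw [hneg _ (by omega)]
      simp
    · simp
  lift n to ℕ using hn
  have key : (#(sqfValues V a ∅ n) : ℝ) =
      ∑ s ∈ sqfLe F n, if Disjoint s (linSet V) then (-1 : ℝ) ^ #s *
      #(monicValues V (fun x => a x / (primeProd s ^ 2).eval x) (n - 2 * primeDeg s)) else 0 := by
    rw [card_sqfValues_empty, card_filter]
    push_cast
    have h1 : ∀ G ∈ monicValues V a n,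
        (if ¬ ∃ P : PrimePoly F, P.1 ^ 2 ∣ G then (1 : ℝ) else 0) =
        ∑ s ∈ sqfLe F n, if primeProd s ^ 2 ∣ G then (-1 : ℝ) ^ #s else 0 := by
      intro G hG
      rw [mem_monicValues] at hG
      rw [← sum_filter, sum_filter_pow_dvd hG.1.1 two_ne_zero (by omega), ite_not]
    rw [sum_congr rfl h1, sum_comm]
    refine sum_congr rfl fun s _ => ?_
    rw [← sum_filter, sum_const, nsmul_eq_mul, mul_comm]
    have hV : Disjoint s (linSet V) ↔ ∀ x ∈ V, (primeProd s ^ 2).eval x ≠ 0 := by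
      rw [Finset.disjoint_right]
      simp only [eval_pow, ne_eq, pow_eq_zero_iff two_ne_zero, eval_primeProd_eq_zero_iff]
      constructor
      · intro h x hx
        exact h (by simpa using hx)
      · intro h P hP
        obtain ⟨x, hx, rfl⟩ := mem_linSet.1 hP
        exact h x hx
    split_ifs with hd
    · rw [card_filter_dvd_monicValues V a n ((primeProd_monic s).pow 2) (hV.1 hd), natDegree_pow,
        natDegree_primeProd]
      push_cast
      rfl
    · rw [hV] at hd
      push Not at hd
      obtain ⟨x, hx, h0⟩ := hd
      rw [filter_eq_empty_iff.2, card_empty, Nat.cast_zero, mul_zero]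
      intro G hG hdvd
      rw [mem_monicValues] at hG
      refine ha x hx ?_
      rw [← hG.2 x hx]
      obtain ⟨B, rfl⟩ := hdvd
      rw [eval_mul, h0, zero_mul]
  rw [key]
  refine hasSum_sum_of_ne_finset_zero fun s hs => ?_
  rw [mem_sqfLe] at hs
  rw [hneg _ (by omega)]
  simp

/-- The density of the squarefree polynomials with given nonzero values on `V`. -/
def sqfDensity (V : Finset F) : ℝ :=
  ((Fintype.card F : ℝ) ^ #V)⁻¹ * (1 - (Fintype.card F : ℝ)⁻¹) *
    ((1 - ((Fintype.card F : ℝ) ^ 2)⁻¹) ^ #V)⁻¹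

theorem card_mul_inv_sq (F : Type*) [Field F] [Fintype F] :
    (Fintype.card F : ℝ) * ((Fintype.card F : ℝ) ^ 2)⁻¹ = (Fintype.card F : ℝ)⁻¹ := by
  have := one_lt_card_cast F
  field_simp

theorem card_mul_inv_sq_lt_one (F : Type*) [Field F] [Fintype F] :
    (Fintype.card F : ℝ) * ((Fintype.card F : ℝ) ^ 2)⁻¹ < 1 := by
  rw [card_mul_inv_sq]
  exact inv_lt_one_of_one_lt₀ (one_lt_card_cast F)

/-- The sieve series is subtracted term by term from `q ^ (n - #V)` times the expansion of `1 /
ζ(2)` with the Euler factors at `V` removed. The condition `4 ≤ q` gives `2 ≤ √q`, hence the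
constant 3. -/
theorem abs_card_sqfValues_empty_sub_le (V : Finset F) {a : F → F} (ha : ∀ x ∈ V, a x ≠ 0)
    (n : ℤ) (hq4 : 4 ≤ Fintype.card F) :
    |(#(sqfValues V a ∅ n) : ℝ) - sqfDensity V * (Fintype.card F : ℝ) ^ n| ≤
      3 * √(Fintype.card F) ^ n := by
  have hq := one_lt_card_cast F
  have hq0 : (0 : ℝ) < Fintype.card F := by linarith
  have hh : 2 ≤ √(Fintype.card F : ℝ) := by
    apply Real.le_sqrt_of_sq_le
    norm_num
    exact_mod_cast hq4
  have hh2 : √(Fintype.card F : ℝ) ^ 2 = Fintype.card F := Real.sq_sqrt hq0.le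
  set q : ℝ := (Fintype.card F : ℝ) with hqdef
  set y : ℝ := (q ^ 2)⁻¹ with hy
  have hy1 : q * y < 1 := card_mul_inv_sq_lt_one F
  have hsum := summable_abs_neg_norm (F := F) (y := y) (by positivity) hy1
  have hT := tsum_ite_disjoint_prod hsum (linSet V)
  have hS := (summable_ite_disjoint_prod hsum (linSet V)).hasSum
  set T := ∑' s, if Disjoint s (linSet V) then ∏ P ∈ s, -(y ^ P.1.natDegree) else 0
  rw [tprod_one_sub_pow (by positivity) hy1] at hT
  have hprod : ∏ P ∈ linSet V, (1 + -(y ^ P.1.natDegree)) = (1 - y) ^ #V := by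
    rw [linSet, prod_image linPrime_injective.injOn]
    simp [sub_eq_add_neg]
  rw [hprod] at hT
  have hy2 : 0 < 1 - y := by nlinarith
  have hTd : sqfDensity V * q ^ n = q ^ (n - #V) * T := by
    rw [sqfDensity, ← hqdef, ← hy, zpow_sub₀ hq0.ne', zpow_natCast]
    have : T = (1 - q * y) * ((1 - y) ^ #V)⁻¹ := by
      rw [← hT]
      field_simp
    rw [this, card_mul_inv_sq]
    ring
  rw [hTd]
  have h1 := (hasSum_card_sqfValues V ha n).sub (hS.mul_left (q ^ (n - #V)))
  obtain ⟨hg, hg3⟩ := summable_pow_mul_min hh n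
  rw [hh2] at hg hg3
  have hg0 : ∀ j : ℕ, 0 ≤ min 1 (q ^ (n - 2 * (j : ℤ))) := fun j => by positivity
  have h2 := (summable_comp_primeDeg (F := F) hg0 hg).hasSum
  refine le_trans (h1.norm_le_of_bounded h2 fun s => ?_)
    ((tsum_comp_primeDeg_le (F := F) hg0 hg).trans hg3)
  split_ifs with hd
  · have h3 := abs_card_monicValues_sub_le V (fun x => a x / (primeProd s ^ 2).eval x)
      (n - 2 * primeDeg s)
    have h4 : q ^ (n - #V) * ∏ P ∈ s, -(y ^ P.1.natDegree) =
        (-1) ^ #s * q ^ (n - 2 * (primeDeg s : ℤ) - #V) := by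
      rw [neg_one_pow_card_mul_pow, hy, inv_pow, ← pow_mul, ← zpow_natCast q (2 * _), ← zpow_neg,
        mul_left_comm, ← zpow_add₀ hq0.ne']
      congr 2
      push_cast
      ring
    rw [h4, ← mul_sub, Real.norm_eq_abs, abs_mul, abs_pow, abs_neg, abs_one, one_pow, one_mul]
    exact h3
  · simpa using hg0 _

/-- Split by whether `P` divides the polynomial, and in that case divide by `P`, which has no zero
on `V`. Both parts are prime to `P`, which makes this a recursion for the count with one more
coprimality condition. -/
theorem card_sqfValues_eq_add (V : Finset F) (a : F → F) {Q : Finset (PrimePoly F)}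
    {P : PrimePoly F} (hPQ : P ∉ Q) (hPV : P ∉ linSet V) (j : ℤ) :
    #(sqfValues V a Q j) = #(sqfValues V a (insert P Q) j) +
      #(sqfValues V (fun x => a x / P.1.eval x) (insert P Q) (j - P.1.natDegree)) := by
  have hPx : ∀ x ∈ V, P.1.eval x ≠ 0 := fun x hx h => by
    rw [PrimePoly.eval_eq_zero_iff] at h
    exact hPV (h ▸ by simpa using hx)
  rw [← card_filter_add_card_filter_not (s := sqfValues V a Q j) (p := fun s => P ∉ s)]
  congr 1
  · congr 1
    ext s
    rw [mem_filter, mem_sqfValues, mem_sqfValues, disjoint_insert_right]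
    tauto
  · symm
    refine Finset.card_bij (fun s _ => insert P s) ?_ ?_ ?_
    · intro s hs
      rw [mem_sqfValues, disjoint_insert_right] at hs
      obtain ⟨hd, ⟨hPs, hQ⟩, hv⟩ := hs
      rw [mem_filter, mem_sqfValues, primeDeg_insert hPs, primeProd_insert hPs,
        disjoint_insert_left]
      refine ⟨⟨by push_cast; omega, ⟨hPQ, hQ⟩, fun x hx => ?_⟩, by simp⟩
      rw [eval_mul, hv x hx, mul_div_cancel₀ _ (hPx x hx)]
    · intro s hs t ht h
      rw [mem_sqfValues, disjoint_insert_right] at hs ht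
      rw [← erase_insert hs.2.1.1, h, erase_insert ht.2.1.1]
    · intro s hs
      rw [mem_filter, mem_sqfValues, not_not] at hs
      obtain ⟨⟨hd, hQ, hv⟩, hPs⟩ := hs
      obtain ⟨t, hPt, rfl⟩ : ∃ t, P ∉ t ∧ insert P t = s :=
        ⟨s.erase P, notMem_erase P s, insert_erase hPs⟩
      refine ⟨t, ?_, rfl⟩
      rw [primeDeg_insert hPt] at hd
      rw [disjoint_insert_left] at hQ
      rw [mem_sqfValues, disjoint_insert_right]
      refine ⟨by push_cast at hd; omega, ⟨hPt, hQ.2⟩, fun x hx => ?_⟩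
      rw [← hv x hx, primeProd_insert hPt, eval_mul, mul_div_cancel_left₀ _ (hPx x hx)]

theorem prod_one_add_inv_le_one (Q : Finset (PrimePoly F)) :
    ∏ P ∈ Q, (1 + (polyNorm P.1)⁻¹)⁻¹ ≤ 1 := by
  refine prod_le_one (fun P _ => ?_) fun P _ => ?_
  · have := polyNorm_pos P.1
    positivity
  · have := polyNorm_pos P.1
    exact inv_le_one_of_one_le₀ (by linarith [inv_pos.2 this])

theorem prod_one_add_inv_pos (Q : Finset (PrimePoly F)) :
    0 < ∏ P ∈ Q, (1 + (polyNorm P.1)⁻¹)⁻¹ := by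
  refine prod_pos fun P _ => ?_
  have := polyNorm_pos P.1
  positivity

/-- The factor lost in the error term at the primes of `Q`. -/
def errorProd (z : ℝ) (Q : Finset (PrimePoly F)) : ℝ :=
  ∏ P ∈ Q, (1 - (z ^ P.1.natDegree)⁻¹)⁻¹

theorem one_lt_pow_natDegree {F : Type*} [Field F] {z : ℝ} (hz : 1 < z)
    (P : PrimePoly F) : 1 < z ^ P.1.natDegree :=
  one_lt_pow₀ hz P.natDegree_pos.ne'

theorem one_le_errorProd {F : Type*} [Field F] {z : ℝ} (hz : 1 < z) (Q : Finset (PrimePoly F)) :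
    1 ≤ errorProd z Q := by
  refine Finset.one_le_prod fun P _ => ?_
  have h := one_lt_pow_natDegree hz P
  have h1 := inv_lt_one_of_one_lt₀ h
  have h2 := inv_pos.2 (zero_lt_one.trans h)
  exact (one_le_inv₀ (by linarith)).2 (by linarith)

theorem errorProd_insert {F : Type*} [Field F] (z : ℝ) {Q : Finset (PrimePoly F)}
    {P : PrimePoly F} (h : P ∉ Q) :
    errorProd z (insert P Q) = (1 - (z ^ P.1.natDegree)⁻¹)⁻¹ * errorProd z Q := prod_insert h

/-- Imposing coprimality to the primes of `Q`, one at a time. -/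
theorem abs_card_sqfValues_sub_le {V : Finset F} {c C z : ℝ} (hz : 1 < z)
    (hzq : z ≤ Fintype.card F) (hc0 : 0 ≤ c) (hcC : c ≤ C)
    (base : ∀ a : F → F, (∀ x ∈ V, a x ≠ 0) → ∀ j : ℤ,
      |(#(sqfValues V a ∅ j) : ℝ) - c * (Fintype.card F : ℝ) ^ j| ≤ C * z ^ j)
    (Q : Finset (PrimePoly F)) (hQ : Disjoint Q (linSet V)) :
    ∀ a : F → F, (∀ x ∈ V, a x ≠ 0) → ∀ j : ℤ,
      |(#(sqfValues V a Q j) : ℝ) -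
        c * (Fintype.card F : ℝ) ^ j * ∏ P ∈ Q, (1 + (polyNorm P.1)⁻¹)⁻¹| ≤
      C * z ^ j * errorProd z Q := by
  have hq0 : (0 : ℝ) < Fintype.card F := by linarith
  have hC0 : 0 ≤ C := hc0.trans hcC
  have hz0 : 0 < z := by linarith
  induction Q using Finset.induction_on with
  | empty => simpa [errorProd] using base
  | insert P Q hPQ ih =>
    rw [disjoint_insert_left] at hQ
    obtain ⟨hPV, hQV⟩ := hQ
    have ih := ih hQV
    have hPx : ∀ x ∈ V, P.1.eval x ≠ 0 := fun x hx h => by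
      rw [PrimePoly.eval_eq_zero_iff] at h
      exact hPV (h ▸ by simpa using hx)
    -- In negative degree nothing is counted, and `z ≤ q` gives `q ^ j ≤ z ^ j`, so the main term
    -- itself fits into the error.
    have hneg : ∀ a : F → F, ∀ j : ℤ, j < 0 →
        |(#(sqfValues V a (insert P Q) j) : ℝ) -
        c * (Fintype.card F : ℝ) ^ j * ∏ P ∈ insert P Q, (1 + (polyNorm P.1)⁻¹)⁻¹| ≤
        C * z ^ j * errorProd z (insert P Q) := by
      intro a j hj
      have h1 := prod_one_add_inv_le_one (insert P Q)
      have h2 := prod_one_add_inv_pos (insert P Q)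
      have h3 := one_le_errorProd hz (insert P Q)
      rw [sqfValues_of_neg _ _ _ hj, card_empty, Nat.cast_zero, zero_sub, abs_neg,
        abs_of_nonneg (by positivity)]
      have h4 : (Fintype.card F : ℝ) ^ j ≤ z ^ j := by
        obtain ⟨n, rfl⟩ : ∃ n : ℕ, j = -n := ⟨j.natAbs, by omega⟩
        rw [zpow_neg, zpow_neg, zpow_natCast, zpow_natCast]
        exact inv_anti₀ (by positivity) (by gcongr)
      gcongr
      exact h1.trans h3
    -- Inner induction on a bound for the degree: the recursion lowers `j` by the degree of `P`,
    -- which is positive, and changes the values `a`.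
    suffices H : ∀ N : ℕ, ∀ j : ℤ, j < N → ∀ a : F → F, (∀ x ∈ V, a x ≠ 0) →
        |(#(sqfValues V a (insert P Q) j) : ℝ) -
        c * (Fintype.card F : ℝ) ^ j * ∏ P ∈ insert P Q, (1 + (polyNorm P.1)⁻¹)⁻¹| ≤
        C * z ^ j * errorProd z (insert P Q) from
      fun a ha j => H (j.natAbs + 1) j (by omega) a ha
    intro N
    induction N with
    | zero => exact fun j hj a _ => hneg a j (by simpa using hj)
    | succ N IH =>
      intro j hj a ha
      rcases lt_or_ge j 0 with hj0 | hj0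
      · exact hneg a j hj0
      have hd := P.natDegree_pos
      have hrec := card_sqfValues_eq_add V a hPQ hPV j
      have h1 := ih a ha j
      have h2 := IH (j - P.1.natDegree) (by push_cast at hj; omega) (fun x => a x / P.1.eval x)
        fun x hx => div_ne_zero (ha x hx) (hPx x hx)
      rw [hrec] at h1
      push_cast at h1
      have hw : 1 < z ^ P.1.natDegree := one_lt_pow_natDegree hz P
      rw [errorProd_insert z hPQ, prod_insert hPQ, zpow_sub₀ hq0.ne',
        zpow_sub₀ hz0.ne', zpow_natCast, zpow_natCast, ← polyNorm] at h2
      rw [errorProd_insert z hPQ, prod_insert hPQ]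
      have hp := polyNorm_pos P.1
      set p := polyNorm P.1
      set w := z ^ P.1.natDegree
      set D := ∏ P ∈ Q, (1 + (polyNorm P.1)⁻¹)⁻¹
      set E := errorProd z Q
      set A := (#(sqfValues V a (insert P Q) j) : ℝ)
      set B := (#(sqfValues V (fun x => a x / P.1.eval x) (insert P Q)
        (j - P.1.natDegree)) : ℝ)
      set X := (Fintype.card F : ℝ) ^ j
      set Z := z ^ j
      -- The density `x = (1 + p⁻¹)⁻¹` solves `x + x / p = 1`, so the main terms satisfy the
      -- recursion exactly.
      have e1 : A - c * X * ((1 + p⁻¹)⁻¹ * D) =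
          (A + B - c * X * D) - (B - c * (X / p) * ((1 + p⁻¹)⁻¹ * D)) := by
        field_simp
        ring
      -- Likewise `x = (1 - w⁻¹)⁻¹` solves `x = 1 + x / w`, the recursion for the error bound.
      have e2 : C * Z * ((1 - w⁻¹)⁻¹ * E) =
          C * Z * E + C * (Z / w) * ((1 - w⁻¹)⁻¹ * E) := by
        have : w - 1 ≠ 0 := by linarith
        have h3 : 1 - w⁻¹ ≠ 0 := by
          rw [ne_eq, sub_eq_zero, eq_comm, inv_eq_one]
          exact hw.ne'
        field_simp
        ring
      rw [e1, e2]
      have h4 := norm_sub_le (A + B - c * X * D) (B - c * (X / p) * ((1 + p⁻¹)⁻¹ * D))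
      simp only [Real.norm_eq_abs] at h4
      exact h4.trans (add_le_add h1 h2)

end Values

/-! ### Squarefree counts without prescribed values, and the constant `K` -/

section Coprime

variable {F : Type*} [Field F] [Fintype F]

theorem mem_sqfValues_empty {a : F → F} {Q s : Finset (PrimePoly F)} {j : ℤ} :
    s ∈ sqfValues ∅ a Q j ↔ (primeDeg s : ℤ) = j ∧ Disjoint s Q := by
  simp [mem_sqfValues]

theorem sqfValues_empty_empty (a : F → F) (j : ℤ) : sqfValues ∅ a ∅ j = sqfDeg F j := by
  ext s
  simp [mem_sqfValues]

/-- Without prescribed values, the sieve series grouped by degree has coefficients `moebiusSum`,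
which vanish from degree 2 on. -/
theorem card_sqfDeg_eq (n : ℤ) :
    (#(sqfDeg F n) : ℝ) =
      #(monicDeg F n) - (Fintype.card F : ℝ) * #(monicDeg F (n - 2)) := by
  have h1 := hasSum_card_sqfValues (F := F) ∅ (a := 0) (by simp) n
  rw [sqfValues_empty_empty] at h1
  simp only [linSet_empty, disjoint_empty_right, if_true, monicValues_empty] at h1
  have h2 := hasSum_sum_sqfDeg h1.summable
  have h3 : ∀ j : ℕ, ∑ s ∈ sqfDeg F j, (-1 : ℝ) ^ #s * #(monicDeg F (n - 2 * primeDeg s)) =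
      moebiusSum F j * #(monicDeg F (n - 2 * j)) := by
    intro j
    rw [moebiusSum, sum_mul]
    refine sum_congr rfl fun s hs => ?_
    have hs' : primeDeg s = j := by simpa using hs
    rw [hs']
  simp_rw [h3] at h2
  rw [← h1.tsum_eq, ← h2.tsum_eq, tsum_eq_sum (s := range 2)]
  · rw [sum_range_succ, sum_range_one, moebiusSum_zero, moebiusSum_succ]
    simp [sub_eq_add_neg]
  · intro j hj
    obtain ⟨i, rfl⟩ : ∃ i, j = i + 2 := ⟨j - 2, by simp at hj; omega⟩
    rw [moebiusSum_succ]
    simp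

theorem card_sqfDeg_of_two_le {n : ℤ} (hn : 2 ≤ n) :
    (#(sqfDeg F n) : ℝ) = (1 - (Fintype.card F : ℝ)⁻¹) * (Fintype.card F : ℝ) ^ n := by
  have hq := one_lt_card_cast F
  have h0 : (Fintype.card F : ℝ) ≠ 0 := by linarith
  rw [card_sqfDeg_eq, card_monicDeg (by omega), card_monicDeg (by omega), zpow_sub₀ h0]
  field_simp

theorem card_sqfDeg_of_lt_two {n : ℤ} (h0 : 0 ≤ n) (hn : n < 2) :
    (#(sqfDeg F n) : ℝ) = (Fintype.card F : ℝ) ^ n := by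
  rw [card_sqfDeg_eq, card_monicDeg h0, monicDeg_of_neg (k := n - 2) (by omega)]
  simp

theorem le_card_sqfDeg {n : ℤ} (h0 : 0 ≤ n) :
    (1 - (Fintype.card F : ℝ)⁻¹) * (Fintype.card F : ℝ) ^ n ≤ #(sqfDeg F n) := by
  have hq := one_lt_card_cast F
  rcases lt_or_ge n 2 with h | h
  · rw [card_sqfDeg_of_lt_two h0 h]
    have : 0 < (Fintype.card F : ℝ)⁻¹ := by positivity
    exact mul_le_of_le_one_left (by positivity) (by linarith)
  · rw [card_sqfDeg_of_two_le h]

theorem card_sqfDeg_le_zpow (n : ℤ) : (#(sqfDeg F n) : ℝ) ≤ (Fintype.card F : ℝ) ^ n := by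
  rcases lt_or_ge n 0 with h | h
  · rw [sqfDeg_of_neg h]
    simp
    positivity
  · lift n to ℕ using h
    rw [zpow_natCast]
    exact_mod_cast card_sqfDeg_le n

/-- The count equals its main term for `n ≥ 2`, so only smaller degrees need a bound. The freedom to
take `z` far below `√q` is what gives the exponent `1 - ε` for `d₂`. -/
theorem abs_card_sqfDeg_sub_le {z : ℝ} (hz : 1 ≤ z) (hzq : z ≤ Fintype.card F) (n : ℤ) :
    |(#(sqfDeg F n) : ℝ) - (1 - (Fintype.card F : ℝ)⁻¹) * (Fintype.card F : ℝ) ^ n| ≤ z ^ n := by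
  have hq := one_lt_card_cast F
  have hq1 : (Fintype.card F : ℝ)⁻¹ < 1 := inv_lt_one_of_one_lt₀ hq
  have hq0 : 0 < (Fintype.card F : ℝ)⁻¹ := by positivity
  have hz0 : 0 < z := by linarith
  rcases lt_or_ge n 0 with h | h
  · rw [sqfDeg_of_neg h, card_empty, Nat.cast_zero, zero_sub, abs_neg,
      abs_of_nonneg (mul_nonneg (by linarith) (by positivity))]
    obtain ⟨m, rfl⟩ : ∃ m : ℕ, n = -m := ⟨n.natAbs, by omega⟩
    rw [zpow_neg, zpow_neg, zpow_natCast, zpow_natCast]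
    calc _ ≤ 1 * ((Fintype.card F : ℝ) ^ m)⁻¹ := by gcongr; linarith
      _ ≤ _ := by rw [one_mul]; exact inv_anti₀ (by positivity) (by gcongr)
  rcases lt_or_ge n 2 with h2 | h2
  · rw [card_sqfDeg_of_lt_two h h2]
    obtain rfl | rfl : n = 0 ∨ n = 1 := by omega
    · simpa using hq1.le
    · rw [zpow_one, zpow_one, sub_mul, inv_mul_cancel₀ (by linarith)]
      simpa using hz
  · rw [card_sqfDeg_of_two_le h2, sub_self, abs_zero]
    positivity

theorem abs_card_sqfValues_empty_left_sub_le {z : ℝ} (hz : 1 < z) (hzq : z ≤ Fintype.card F)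
    (a : F → F) (Q : Finset (PrimePoly F)) (j : ℤ) :
    |(#(sqfValues ∅ a Q j) : ℝ) - (1 - (Fintype.card F : ℝ)⁻¹) * (Fintype.card F : ℝ) ^ j *
        ∏ P ∈ Q, (1 + (polyNorm P.1)⁻¹)⁻¹| ≤ z ^ j * errorProd z Q := by
  have hq := one_lt_card_cast F
  have hq1 : (Fintype.card F : ℝ)⁻¹ < 1 := inv_lt_one_of_one_lt₀ hq
  have hq0 : 0 < (Fintype.card F : ℝ)⁻¹ := by positivity
  have h := abs_card_sqfValues_sub_le (V := (∅ : Finset F)) (C := 1) hz hzq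
    (c := 1 - (Fintype.card F : ℝ)⁻¹) (by linarith) (by linarith)
    (fun a _ j => by
      rw [sqfValues_empty_empty, one_mul]
      exact abs_card_sqfDeg_sub_le hz.le hzq j) Q (by simp) a (by simp) j
  simpa only [one_mul] using h

/-- Expanding a product over the prime factors of squarefree polynomials prime to `R`. -/
theorem hasSum_sum_prod_one_add (f : PrimePoly F → ℝ) (R : Finset (PrimePoly F)) (k : ℤ) :
    HasSum (fun e : Finset (PrimePoly F) => if Disjoint e R then
        (∏ P ∈ e, f P) * #(sqfValues ∅ (0 : F → F) (e ∪ R) (k - primeDeg e)) else 0)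
      (∑ s ∈ sqfValues ∅ (0 : F → F) R k, ∏ P ∈ s, (1 + f P)) := by
  have key : ∑ s ∈ sqfValues ∅ (0 : F → F) R k, ∏ P ∈ s, (1 + f P) =
      ∑ e ∈ sqfLe F k.toNat, if Disjoint e R then
        (∏ P ∈ e, f P) * #(sqfValues ∅ (0 : F → F) (e ∪ R) (k - primeDeg e)) else 0 := by
    have h1 : ∀ s ∈ sqfValues ∅ (0 : F → F) R k, ∏ P ∈ s, (1 + f P) =
        ∑ e ∈ sqfLe F k.toNat, if e ⊆ s then ∏ P ∈ e, f P else 0 := by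
      intro s hs
      rw [mem_sqfValues_empty] at hs
      rw [prod_one_add, ← sum_filter]
      refine sum_congr ?_ fun _ _ => rfl
      ext e
      rw [mem_powerset, mem_filter, mem_sqfLe, iff_and_self]
      intro he
      have : primeDeg e ≤ primeDeg s := sum_le_sum_of_subset he
      omega
    rw [sum_congr rfl h1, sum_comm]
    refine sum_congr rfl fun e _ => ?_
    rw [← sum_filter, sum_const, nsmul_eq_mul, mul_comm]
    split_ifs with hd
    · congr 2
      symm
      refine Finset.card_bij (fun t _ => e ∪ t) ?_ ?_ ?_
      · intro t ht
        rw [mem_sqfValues_empty, disjoint_union_right] at ht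
        rw [mem_filter, mem_sqfValues_empty, primeDeg_union ht.2.1.symm, disjoint_union_left]
        exact ⟨⟨by push_cast; omega, hd, ht.2.2⟩, subset_union_left⟩
      · intro t ht u hu h
        rw [mem_sqfValues_empty, disjoint_union_right] at ht hu
        rw [← union_sdiff_cancel_left ht.2.1.symm, h, union_sdiff_cancel_left hu.2.1.symm]
      · intro s hs
        rw [mem_filter, mem_sqfValues_empty] at hs
        obtain ⟨⟨hk, hR⟩, he⟩ := hs
        refine ⟨s \ e, ?_, union_sdiff_of_subset he⟩
        rw [mem_sqfValues_empty, disjoint_union_right]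
        have := primeDeg_union (disjoint_sdiff : Disjoint e (s \ e))
        rw [union_sdiff_of_subset he] at this
        exact ⟨by omega, sdiff_disjoint, hR.mono_left sdiff_subset⟩
    · rw [filter_eq_empty_iff.2, card_empty, Nat.cast_zero, mul_zero]
      intro s hs he
      rw [mem_sqfValues_empty] at hs
      exact hd (hs.2.mono_left he)
  rw [key]
  refine hasSum_sum_of_ne_finset_zero fun e he => ?_
  rw [mem_sqfLe] at he
  rw [sqfValues_of_neg _ _ _ (by omega)]
  simp

theorem zpow_sub_primeDeg {F : Type*} [Field F] {z : ℝ} (hz : z ≠ 0) (k : ℤ) (e : Finset (PrimePoly F)) :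
    z ^ (k - primeDeg e) = z ^ k * ∏ P ∈ e, (z ^ P.1.natDegree)⁻¹ := by
  rw [zpow_sub₀ hz, zpow_natCast, div_eq_mul_inv, pow_primeDeg, prod_inv_distrib]

theorem errorProd_union {F : Type*} [Field F] (z : ℝ) {e R : Finset (PrimePoly F)} (h : Disjoint e R) :
    errorProd z (e ∪ R) = errorProd z e * errorProd z R := prod_union h

/-- The error in counting `F₁` depends on the primes of `F₂`; on average over `F₂` this costs only a
constant. Write the product as `∏ (1 + f P)` with `f P ≤ 2 * |P| ^ (-1/2)` and expand: a divisor `e`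
occurs at most `q ^ (k - primeDeg e)` times, and `∑ 2 * |P| ^ (-3/2) ≤ 2`. -/
theorem sum_errorProd_sqrt_le (hq4 : 4 ≤ Fintype.card F) (k : ℤ) :
    ∑ s ∈ sqfDeg F k, errorProd √(Fintype.card F) s ≤
      Real.exp 2 * (Fintype.card F : ℝ) ^ k := by
  have hq := one_lt_card_cast F
  have hq0 : (0 : ℝ) < Fintype.card F := by linarith
  have hh : 2 ≤ √(Fintype.card F : ℝ) := by
    apply Real.le_sqrt_of_sq_le
    norm_num
    exact_mod_cast hq4
  set q : ℝ := (Fintype.card F : ℝ) with hqdef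
  set h := √q
  set y : ℝ := (q * h)⁻¹ with hy
  have hqy : q * y = h⁻¹ := by rw [hy]; field_simp
  have hh1 : h⁻¹ ≤ 2⁻¹ := inv_anti₀ (by norm_num) hh
  have hy1 : Fintype.card F * y < 1 := by rw [← hqdef, hqy]; linarith
  set f : PrimePoly F → ℝ := fun P => (1 - (h ^ P.1.natDegree)⁻¹)⁻¹ - 1 with hf
  have hw : ∀ P : PrimePoly F, 2 ≤ h ^ P.1.natDegree := fun P =>
    hh.trans (le_self_pow₀ (by linarith) P.natDegree_pos.ne')
  have hf0 : ∀ P, 0 ≤ f P := fun P => by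
    have h1 : (h ^ P.1.natDegree)⁻¹ ≤ 2⁻¹ := inv_anti₀ (by norm_num) (hw P)
    have h2 : 0 < (h ^ P.1.natDegree)⁻¹ := by positivity
    have := (one_le_inv₀ (a := 1 - (h ^ P.1.natDegree)⁻¹) (by linarith)).2 (by linarith)
    simp only [hf]
    linarith
  have hf2 : ∀ P, f P * (q ^ P.1.natDegree)⁻¹ ≤ 2 * y ^ P.1.natDegree := fun P => by
    have h1 : f P ≤ 2 * (h ^ P.1.natDegree)⁻¹ := by
      simp only [hf]
      have h2 := hw P
      have h3 : 0 < (h ^ P.1.natDegree)⁻¹ := by positivity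
      have h4 : (h ^ P.1.natDegree)⁻¹ ≤ 2⁻¹ := inv_anti₀ (by norm_num) h2
      rw [tsub_le_iff_right, inv_le_iff_one_le_mul₀ (by linarith)]
      nlinarith
    rw [hy, inv_pow, mul_pow, mul_inv]
    calc _ ≤ 2 * (h ^ P.1.natDegree)⁻¹ * (q ^ P.1.natDegree)⁻¹ := by gcongr
      _ = _ := by ring
  have hsy := summable_pow_natDegree (F := F) (y := y) (by positivity) hy1
  have hs : Summable fun P => f P * (q ^ P.1.natDegree)⁻¹ :=
    Summable.of_nonneg_of_le (fun P => mul_nonneg (hf0 P) (by positivity)) hf2 (hsy.mul_left 2)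
  have h1 := hasSum_sum_prod_one_add f ∅ k
  simp only [disjoint_empty_right, if_true, union_empty] at h1
  have h2 : ∑ s ∈ sqfValues ∅ (0 : F → F) ∅ k, ∏ P ∈ s, (1 + f P) =
      ∑ s ∈ sqfDeg F k, errorProd h s := by
    rw [sqfValues_empty_empty]
    refine sum_congr rfl fun s _ => prod_congr rfl fun P _ => ?_
    simp [hf]
  rw [h2] at h1
  have hs' : Summable fun P => |f P * (q ^ P.1.natDegree)⁻¹| :=
    hs.congr fun P => (abs_of_nonneg (mul_nonneg (hf0 P) (by positivity))).symm
  have h3 := (summable_prod_primes hs').hasSum.mul_left (q ^ k)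
  have h4 := hasSum_le (fun e => ?_) h1 h3
  · refine h4.trans ?_
    rw [mul_comm]
    refine mul_le_mul_of_nonneg_right ?_ (by positivity)
    refine (tsum_prod_le_exp_tsum (fun P => mul_nonneg (hf0 P) (by positivity)) hs).trans ?_
    rw [Real.exp_le_exp]
    refine (hs.tsum_le_tsum hf2 (hsy.mul_left 2)).trans ?_
    rw [tsum_mul_left]
    have h5 := tsum_pow_natDegree_le (F := F) (y := y) (by positivity) hy1
    rw [← hqdef, hqy] at h5
    have h6 : (1 - h⁻¹)⁻¹ ≤ 2 := by
      rw [inv_le_comm₀ (by linarith) (by norm_num)]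
      linarith
    have h7 : 0 < h⁻¹ := by positivity
    nlinarith
  · have h5 : (#(sqfValues ∅ (0 : F → F) e (k - primeDeg e)) : ℝ) ≤ q ^ (k - primeDeg e) := by
      refine le_trans ?_ (card_sqfDeg_le_zpow _)
      exact_mod_cast card_le_card (filter_subset _ _)
    rw [prod_mul_distrib, mul_left_comm, ← zpow_sub_primeDeg hq0.ne']
    exact mul_le_mul_of_nonneg_left h5 (prod_nonneg fun P _ => hf0 P)

theorem summable_constK : Summable fun P : PrimePoly F => |-(((polyNorm P.1 + 1) ^ 2)⁻¹)| := by
  have h := summable_pow_natDegree (F := F) (y := ((Fintype.card F : ℝ) ^ 2)⁻¹) (by positivity)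
    (card_mul_inv_sq_lt_one F)
  refine Summable.of_nonneg_of_le (fun _ => abs_nonneg _) (fun P => ?_) h
  have hp := polyNorm_pos P.1
  rw [abs_neg, abs_of_pos (by positivity), inv_pow, ← pow_mul, mul_comm, pow_mul, ← polyNorm]
  gcongr
  linarith

/-- The part of the Euler product `constK` away from `R`. -/
def partialK (R : Finset (PrimePoly F)) : ℝ :=
  ∑' e, if Disjoint e R then ∏ P ∈ e, -(((polyNorm P.1 + 1) ^ 2)⁻¹) else 0

theorem partialK_mul (R : Finset (PrimePoly F)) :
    partialK R * ∏ P ∈ R, (1 - ((polyNorm P.1 + 1) ^ 2)⁻¹) = constK F := by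
  have := tsum_ite_disjoint_prod (summable_constK (F := F)) R
  simpa only [partialK, constK, sub_eq_add_neg, one_div] using this

/-- Squarefree polynomials prime to `R`, weighted by the density of the squarefree polynomials
prime to them. -/
def weightedCount (R : Finset (PrimePoly F)) (k : ℤ) : ℝ :=
  ∑ s ∈ sqfValues ∅ (0 : F → F) R k, ∏ P ∈ s, (1 + (polyNorm P.1)⁻¹)⁻¹

/-- The weight at `P` is `1 - 1 / (|P| + 1)`. Expanding, a prime of the divisor `e` contributes `-1
/ (|P| + 1)`, a degree loss `1 / |P|` and a coprimality density `(1 + 1 / |P|)⁻¹`, in total `-1 /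
(|P| + 1) ^ 2`. The errors sum to an Euler product over `1 + g P`, convergent for every `z > 1`. -/
theorem abs_weightedCount_sub_le {z : ℝ} (hz : 1 < z) (hzq : z ≤ Fintype.card F)
    (R : Finset (PrimePoly F)) (k : ℤ) :
    |weightedCount R k - (1 - (Fintype.card F : ℝ)⁻¹) * (Fintype.card F : ℝ) ^ k *
        (∏ P ∈ R, (1 + (polyNorm P.1)⁻¹)⁻¹) * partialK R| ≤
      Real.exp (((1 - z⁻¹)⁻¹) ^ 2) * z ^ k * errorProd z R := by
  have hq := one_lt_card_cast F
  have hq0 : (0 : ℝ) < Fintype.card F := by linarith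
  have hz0 : 0 < z := by linarith
  have hz1 : z⁻¹ < 1 := inv_lt_one_of_one_lt₀ hz
  have hzi : 0 < z⁻¹ := by positivity
  set q : ℝ := (Fintype.card F : ℝ) with hqdef
  set f : PrimePoly F → ℝ := fun P => -((polyNorm P.1 + 1)⁻¹) with hf
  have hW : weightedCount R k = ∑ s ∈ sqfValues ∅ (0 : F → F) R k, ∏ P ∈ s, (1 + f P) := by
    refine sum_congr rfl fun s _ => prod_congr rfl fun P _ => ?_
    have hp := polyNorm_pos P.1
    simp only [hf]
    field_simp
    ring
  have h1 := hasSum_sum_prod_one_add f R k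
  rw [← hW] at h1
  have h2 := (summable_ite_disjoint_prod (summable_constK (F := F)) R).hasSum.mul_left
    ((1 - q⁻¹) * q ^ k * ∏ P ∈ R, (1 + (polyNorm P.1)⁻¹)⁻¹)
  set y : ℝ := (q * z)⁻¹ with hy
  have hqy : q * y = z⁻¹ := by rw [hy]; field_simp
  have hy1 : Fintype.card F * y < 1 := by rw [← hqdef, hqy]; exact hz1
  have hsy := summable_pow_natDegree (F := F) (y := y) (by positivity) hy1
  set g : PrimePoly F → ℝ := fun P =>
    (polyNorm P.1 + 1)⁻¹ * (z ^ P.1.natDegree)⁻¹ * (1 - (z ^ P.1.natDegree)⁻¹)⁻¹ with hg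
  have hw : ∀ P : PrimePoly F, (z ^ P.1.natDegree)⁻¹ ≤ z⁻¹ := fun P =>
    inv_anti₀ hz0 (le_self_pow₀ hz.le P.natDegree_pos.ne')
  have hg0 : ∀ P, 0 ≤ g P := fun P => by
    have hp := polyNorm_pos P.1
    have : 0 ≤ (1 - (z ^ P.1.natDegree)⁻¹)⁻¹ := inv_nonneg.2 (by linarith [hw P])
    positivity
  have hgy : ∀ P, g P ≤ (1 - z⁻¹)⁻¹ * y ^ P.1.natDegree := fun P => by
    have hp := polyNorm_pos P.1
    have e1 : (1 - (z ^ P.1.natDegree)⁻¹)⁻¹ ≤ (1 - z⁻¹)⁻¹ :=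
      inv_anti₀ (by linarith) (by linarith [hw P])
    have e2 : (polyNorm P.1 + 1)⁻¹ * (z ^ P.1.natDegree)⁻¹ ≤ y ^ P.1.natDegree := by
      rw [hy, inv_pow, mul_pow, mul_inv, ← polyNorm]
      gcongr
      linarith
    rw [mul_comm (1 - z⁻¹)⁻¹]
    exact mul_le_mul e2 e1 (inv_nonneg.2 (by linarith [hw P])) (by positivity)
  have hsg : Summable g := Summable.of_nonneg_of_le hg0 hgy (hsy.mul_left _)
  have hsg' : Summable fun P => |g P| := hsg.congr fun P => (abs_of_nonneg (hg0 P)).symm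
  have h3 := (summable_prod_primes hsg').hasSum.mul_left (z ^ k * errorProd z R)
  have hER := one_le_errorProd hz R
  refine le_trans ((h1.sub h2).norm_le_of_bounded h3 fun e => ?_) ?_
  · split_ifs with hd
    · have e1 : (1 - q⁻¹) * q ^ k * (∏ P ∈ R, (1 + (polyNorm P.1)⁻¹)⁻¹) *
          ∏ P ∈ e, -(((polyNorm P.1 + 1) ^ 2)⁻¹) = (∏ P ∈ e, f P) *
          ((1 - q⁻¹) * q ^ (k - primeDeg e) *
            ∏ P ∈ e ∪ R, (1 + (polyNorm P.1)⁻¹)⁻¹) := by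
        rw [zpow_sub_primeDeg hq0.ne', prod_union hd]
        have : ∏ P ∈ e, -(((polyNorm P.1 + 1) ^ 2)⁻¹) =
            (∏ P ∈ e, f P) * (∏ P ∈ e, (q ^ P.1.natDegree)⁻¹) *
              ∏ P ∈ e, (1 + (polyNorm P.1)⁻¹)⁻¹ := by
          rw [← prod_mul_distrib, ← prod_mul_distrib]
          refine prod_congr rfl fun P _ => ?_
          have hp := polyNorm_pos P.1
          rw [← polyNorm]
          simp only [hf]
          field_simp
        rw [this]
        ring
      have h4 := abs_card_sqfValues_empty_left_sub_le hz hzq (0 : F → F) (e ∪ R) (k - primeDeg e)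
      rw [e1, ← mul_sub, Real.norm_eq_abs, abs_mul]
      refine (mul_le_mul_of_nonneg_left h4 (abs_nonneg _)).trans (le_of_eq ?_)
      rw [errorProd_union z hd, zpow_sub_primeDeg hz0.ne', abs_prod]
      have : ∏ P ∈ e, g P = (∏ P ∈ e, |f P|) * (∏ P ∈ e, (z ^ P.1.natDegree)⁻¹) *
          errorProd z e := by
        rw [errorProd, ← prod_mul_distrib, ← prod_mul_distrib]
        refine prod_congr rfl fun P _ => ?_
        have hp := polyNorm_pos P.1
        simp only [hf, hg]
        rw [abs_neg, abs_of_pos (a := (polyNorm P.1 + 1)⁻¹) (by positivity)]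
      rw [this]
      ring
    · simp only [mul_zero, sub_self, norm_zero]
      have : 0 ≤ ∏ P ∈ e, g P := prod_nonneg fun P _ => hg0 P
      positivity
  · rw [mul_comm, mul_assoc (Real.exp _)]
    refine mul_le_mul_of_nonneg_right ?_ (by positivity)
    refine (tsum_prod_le_exp_tsum hg0 hsg).trans (Real.exp_le_exp.2 ?_)
    refine (hsg.tsum_le_tsum hgy (hsy.mul_left _)).trans ?_
    rw [tsum_mul_left, pow_two]
    have h5 := tsum_pow_natDegree_le (F := F) (y := y) (by positivity) hy1
    rw [← hqdef, hqy] at h5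
    have h6 : 0 < (1 - z⁻¹)⁻¹ := inv_pos.2 (by linarith)
    refine mul_le_mul_of_nonneg_left (h5.trans ?_) h6.le
    exact mul_le_of_le_one_left h6.le hz1.le

end Coprime

/-! ### Cubic character conditions and the decomposition of pairs -/

section CubicCharacter

variable {F : Type*} [Field F] [Fintype F]

theorem mulChar_pow_three {F : Type*} [Field F] {χ : MulChar F ℂ} (hχ : orderOf χ = 3) {a : F}
    (ha : a ≠ 0) : χ a ^ 3 = 1 := by
  have h1 : χ ^ 3 = 1 := hχ ▸ pow_orderOf_eq_one χ
  rw [← MulChar.pow_apply' χ (by norm_num), h1, MulChar.one_apply ha.isUnit]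

theorem mulChar_ne_zero_iff {F : Type*} [Field F] (χ : MulChar F ℂ) (a : F) :
    χ a ≠ 0 ↔ a ≠ 0 := by
  constructor
  · rintro h rfl
    exact h (MulChar.map_zero χ)
  · intro h
    exact (h.isUnit.map χ).ne_zero

/-- A cubic character takes each cube root of unity equally often. -/
theorem three_mul_card_mulChar_eq {χ : MulChar F ℂ} (hχ : orderOf χ = 3) {c : ℂ}
    (hc : c ^ 3 = 1) : 3 * #(univ.filter fun a : F => χ a = c) + 1 = Fintype.card F := by
  obtain ⟨u, hu⟩ : ∃ u : Fˣ, χ u ≠ 1 := by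
    rw [← MulChar.ne_one_iff]
    rintro rfl
    simp at hχ
  set g := χ u with hg
  have hg3 : g ^ 3 = 1 := mulChar_pow_three hχ u.ne_zero
  have hg2 : 1 + g + g ^ 2 = 0 := by
    have : (g - 1) * (1 + g + g ^ 2) = 0 := by linear_combination hg3
    exact (mul_eq_zero.1 this).resolve_left (sub_ne_zero.2 hu)
  have hcases : ∀ c : ℂ, c ^ 3 = 1 → c = 1 ∨ c = g ∨ c = g ^ 2 := by
    intro c hc
    have : (c - 1) * ((c - g) * (c - g ^ 2)) = 0 := by
      linear_combination hc + (-c ^ 2 + c * g) * hg2 - hg3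
    rcases mul_eq_zero.1 this with h | h
    · exact Or.inl (sub_eq_zero.1 h)
    · rcases mul_eq_zero.1 h with h | h
      · exact Or.inr (Or.inl (sub_eq_zero.1 h))
      · exact Or.inr (Or.inr (sub_eq_zero.1 h))
  set f : Fˣ →* ℂ := (χ.toMonoidHom).comp (Units.coeHom F) with hf
  have hfv : ∀ v : Fˣ, f v = χ v := fun v => rfl
  have hrange : ∀ c : ℂ, c ^ 3 = 1 → c ∈ Set.range f := by
    intro c hc
    rcases hcases c hc with rfl | rfl | rfl
    · exact ⟨1, map_one f⟩
    · exact ⟨u, rfl⟩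
    · exact ⟨u ^ 2, by rw [map_pow, hfv]⟩
  have hfib : ∀ c : ℂ, c ^ 3 = 1 → #(univ.filter fun v : Fˣ => f v = c) =
      #(univ.filter fun a : F => χ a = c) := by
    intro c hc
    refine Finset.card_bij (fun v _ => (v : F)) ?_ (fun v _ w _ h => Units.ext h) ?_
    · intro v hv
      simpa [hfv] using hv
    · intro a ha
      have ha' : χ a = c := by simpa using ha
      have h0 : a ≠ 0 := by
        rw [← mulChar_ne_zero_iff χ, ha']
        rintro rfl
        norm_num at hc
      exact ⟨Units.mk0 a h0, by simpa [hfv] using ha', rfl⟩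
  -- The fibres of a homomorphism over its range have equal size, and the range contains all three
  -- cube roots of unity.
  have heq : ∀ d : ℂ, d ^ 3 = 1 → #(univ.filter fun v : Fˣ => f v = d) =
      #(univ.filter fun a : F => χ a = c) := by
    intro d hd
    rw [← hfib c hc]
    exact MonoidHom.card_fiber_eq_of_mem_range f (hrange d hd) (hrange c hc)
  have hgg : g ^ 2 ≠ g := fun h => hu (by
    have : g ≠ 0 := by rintro h0; simp [h0] at hg3
    have h2 : g * (g - 1) = 0 := by linear_combination h
    exact sub_eq_zero.1 ((mul_eq_zero.1 h2).resolve_left this))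
  have hg1 : g ^ 2 ≠ 1 := fun h => hu (by linear_combination hg3 - g * h)
  have hsum := card_eq_sum_card_fiberwise (s := (univ : Finset Fˣ)) (t := {1, g, g ^ 2})
    (f := f) (fun v _ => by
      have := hcases (f v) (mulChar_pow_three hχ v.ne_zero)
      simpa using this)
  rw [sum_insert (by simp [hu.symm, hg1.symm]), sum_insert (by simpa using hgg.symm),
    sum_singleton, heq 1 (by norm_num), heq g hg3, heq (g ^ 2) (by
      linear_combination (g ^ 3 + 1) * hg3), card_univ, Fintype.card_units] at hsum
  have := Fintype.one_lt_card (α := F)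
  omega

theorem card_mulChar_eq {χ : MulChar F ℂ} (hχ : orderOf χ = 3) {c : ℂ} (hc : c ^ 3 = 1) :
    (#(univ.filter fun a : F => χ a = c) : ℝ) = ((Fintype.card F : ℝ) - 1) / 3 := by
  rw [← three_mul_card_mulChar_eq hχ hc]
  push_cast
  ring

/-- The squarefree monic polynomials of degree `n`, prime to `Q`, at whose values on `V` the
character `χ` has the values `c`. -/
def charValues (χ : MulChar F ℂ) (V : Finset F) (c : F → ℂ) (Q : Finset (PrimePoly F)) (n : ℤ) :
    Finset (Finset (PrimePoly F)) :=
  (sqfDeg F n).filter fun u => Disjoint u Q ∧ ∀ x ∈ V, χ ((primeProd u).eval x) = c x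

theorem mem_charValues {χ : MulChar F ℂ} {V : Finset F} {c : F → ℂ} {Q u : Finset (PrimePoly F)}
    {n : ℤ} : u ∈ charValues χ V c Q n ↔
      (primeDeg u : ℤ) = n ∧ Disjoint u Q ∧ ∀ x ∈ V, χ ((primeProd u).eval x) = c x := by
  rw [charValues, mem_filter, mem_sqfDeg]

theorem sqfDensity_nonneg (V : Finset F) : 0 ≤ sqfDensity V := by
  have hq := one_lt_card_cast F
  have h1 : (Fintype.card F : ℝ)⁻¹ < 1 := inv_lt_one_of_one_lt₀ hq
  have h2 : ((Fintype.card F : ℝ) ^ 2)⁻¹ < 1 := inv_lt_one_of_one_lt₀ (by nlinarith)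
  have h3 : 0 < 1 - ((Fintype.card F : ℝ) ^ 2)⁻¹ := by linarith
  exact mul_nonneg (mul_nonneg (by positivity) (by linarith)) (by positivity)

theorem sqfDensity_le_one (V : Finset F) : sqfDensity V ≤ 1 := by
  have hq := one_lt_card_cast F
  have hq2 : (2 : ℝ) ≤ Fintype.card F := by exact_mod_cast Fintype.one_lt_card (α := F)
  have h1 : (Fintype.card F : ℝ)⁻¹ < 1 := inv_lt_one_of_one_lt₀ hq
  have h0 : 0 < (Fintype.card F : ℝ)⁻¹ := by positivity
  have h2 : (1 : ℝ) ≤ Fintype.card F * (1 - ((Fintype.card F : ℝ) ^ 2)⁻¹) := by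
    rw [mul_sub, card_mul_inv_sq]
    linarith
  have h3 : sqfDensity V = (1 - (Fintype.card F : ℝ)⁻¹) *
      ((Fintype.card F * (1 - ((Fintype.card F : ℝ) ^ 2)⁻¹)) ^ #V)⁻¹ := by
    rw [sqfDensity, mul_pow, mul_inv]
    ring
  rw [h3]
  have h4 := inv_le_one_of_one_le₀ (one_le_pow₀ h2 (n := #V))
  have h5 : 0 ≤ ((Fintype.card F * (1 - ((Fintype.card F : ℝ) ^ 2)⁻¹)) ^ #V)⁻¹ := by positivity
  nlinarith

/-- The condition is a disjoint union of `((q - 1) / 3) ^ #V` conditions on the values themselves,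
and the estimate for each is independent of the values. -/
theorem abs_card_charValues_sub_le {χ : MulChar F ℂ} (hχ : orderOf χ = 3)
    (hq4 : 4 ≤ Fintype.card F) (V : Finset F) {c : F → ℂ} (hc : ∀ x ∈ V, c x ^ 3 = 1)
    (Q : Finset (PrimePoly F)) (hQ : Disjoint Q (linSet V)) (n : ℤ) :
    |(#(charValues χ V c Q n) : ℝ) - (((Fintype.card F : ℝ) - 1) / 3) ^ #V *
        (sqfDensity V * (Fintype.card F : ℝ) ^ n * ∏ P ∈ Q, (1 + (polyNorm P.1)⁻¹)⁻¹)| ≤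
      (((Fintype.card F : ℝ) - 1) / 3) ^ #V *
        (3 * √(Fintype.card F) ^ n * errorProd √(Fintype.card F) Q) := by
  have hq := one_lt_card_cast F
  have hq4' : (4 : ℝ) ≤ Fintype.card F := by exact_mod_cast hq4
  have hh : 1 < √(Fintype.card F : ℝ) := by
    rw [Real.lt_sqrt (by norm_num)]
    linarith
  have hhq : √(Fintype.card F : ℝ) ≤ Fintype.card F := by
    rw [Real.sqrt_le_left (by linarith)]
    nlinarith
  have hest := abs_card_sqfValues_sub_le (V := V) (C := 3) hh hhq (sqfDensity_nonneg V)
    ((sqfDensity_le_one V).trans (by norm_num))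
    (fun a ha j => abs_card_sqfValues_empty_sub_le V ha j hq4) Q hQ
  -- The default `{0}` off `V` makes functions on all of `F` stand for tuples indexed by `V`.
  set A : F → Finset F := fun x => if x ∈ V then univ.filter fun a => χ a = c x else {0} with hA
  have hcardA : (#(Fintype.piFinset A) : ℝ) = (((Fintype.card F : ℝ) - 1) / 3) ^ #V := by
    rw [Fintype.card_piFinset, ← prod_subset (subset_univ V)]
    · push_cast
      rw [prod_congr rfl fun x hx => ?_, prod_const]
      simp only [hA, if_pos hx]
      exact card_mulChar_eq hχ (hc x hx)
    · intro x _ hx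
      simp [hA, hx]
  set φ : Finset (PrimePoly F) → F → F := fun u x => if x ∈ V then (primeProd u).eval x else 0
  have hfib := card_eq_sum_card_fiberwise (s := charValues χ V c Q n) (t := Fintype.piFinset A)
    (f := φ) (fun u hu => by
      have hu' := (mem_charValues.1 (mem_coe.1 hu)).2.2
      rw [mem_coe, Fintype.mem_piFinset]
      intro x
      by_cases hx : x ∈ V
      · simp [φ, hA, hx, hu' x hx]
      · simp [φ, hA, hx])
  have hval : ∀ a ∈ Fintype.piFinset A,
      (charValues χ V c Q n).filter (fun u => φ u = a) = sqfValues V a Q n := by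
    intro a ha
    rw [Fintype.mem_piFinset] at ha
    ext u
    rw [mem_filter, mem_charValues, mem_sqfValues]
    constructor
    · rintro ⟨⟨hd, hQ, -⟩, rfl⟩
      exact ⟨hd, hQ, fun x hx => by simp [φ, hx]⟩
    · rintro ⟨hd, hQ, hv⟩
      refine ⟨⟨hd, hQ, fun x hx => ?_⟩, ?_⟩
      · have := ha x
        simp only [hA, if_pos hx, mem_filter, mem_univ, true_and] at this
        rw [hv x hx, this]
      · funext x
        by_cases hx : x ∈ V
        · simp [φ, hx, hv x hx]
        · have := ha x
          simp only [hA, if_neg hx, mem_singleton] at this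
          simp [φ, hx, this]
  rw [sum_congr rfl fun a ha => congrArg card (hval a ha)] at hfib
  rw [hfib, ← hcardA, ← nsmul_eq_mul, ← nsmul_eq_mul, ← sum_const, ← sum_const]
  push_cast
  rw [← sum_sub_distrib]
  refine (abs_sum_le_sum_abs _ _).trans (sum_le_sum fun a ha => hest a (fun x hx => ?_) n)
  rw [Fintype.mem_piFinset] at ha
  have := ha x
  simp only [hA, if_pos hx, mem_filter, mem_univ, true_and] at this
  rw [← mulChar_ne_zero_iff χ, this]
  intro h0
  have := hc x hx
  simp [h0] at this

/-- The pairs of coprime squarefree monic polynomials `F₁`, `F₂` of degrees `d₁`, `d₂` for which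
`χ` has the values `e` at the values of `F₁ * F₂ ^ 2` on `R`. -/
def pairValues (χ : MulChar F ℂ) (R : Finset F) (e : F → ℂ) (d₁ d₂ : ℤ) :
    Finset (Finset (PrimePoly F) × Finset (PrimePoly F)) :=
  (sqfDeg F d₁ ×ˢ sqfDeg F d₂).filter fun p => Disjoint p.1 p.2 ∧
    ∀ x ∈ R, χ ((primeProd p.1 * primeProd p.2 ^ 2).eval x) = e x

theorem mem_pairValues {χ : MulChar F ℂ} {R : Finset F} {e : F → ℂ} {d₁ d₂ : ℤ}
    {p : Finset (PrimePoly F) × Finset (PrimePoly F)} : p ∈ pairValues χ R e d₁ d₂ ↔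
      ((primeDeg p.1 : ℤ) = d₁ ∧ (primeDeg p.2 : ℤ) = d₂) ∧ Disjoint p.1 p.2 ∧
        ∀ x ∈ R, χ ((primeProd p.1 * primeProd p.2 ^ 2).eval x) = e x := by
  rw [pairValues, mem_filter, mem_product, mem_sqfDeg, mem_sqfDeg]

/-- The value that `χ` has to take at the part of `F₁` which is prime to the zeros. -/
def residualValue (χ : MulChar F ℂ) (e : F → ℂ) (U : Finset F) (t : Finset (PrimePoly F))
    (x : F) : ℂ :=
  e x / (χ ((primeProd (linSet U)).eval x) * χ ((primeProd t).eval x) ^ 2)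

theorem disjoint_linSet_iff {F : Type*} [Field F] {s : Finset (PrimePoly F)} {R : Finset F} :
    Disjoint s (linSet R) ↔ ∀ x ∈ R, linPrime x ∉ s := by
  rw [Finset.disjoint_right]
  constructor
  · exact fun h x hx => h (by simpa using hx)
  · intro h P hP
    obtain ⟨x, hx, rfl⟩ := mem_linSet.1 hP
    exact h x hx

theorem linSet_subset {F : Type*} [Field F] {S R : Finset F} (h : S ⊆ R) :
    linSet S ⊆ linSet R := image_subset_image h

/-- Sorting the pairs by the zeros of `F₂`, and removing the zeros. -/
theorem card_pairValues_eq (χ : MulChar F ℂ) (R : Finset F) (e : F → ℂ) (d₁ d₂ : ℤ) :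
    #(pairValues χ R e d₁ d₂) =
      ∑ T ∈ (R.filter fun x => e x = 0).powerset,
        ∑ s ∈ sqfValues ∅ (0 : F → F) (linSet R) (d₂ - #T),
          #(charValues χ (R.filter fun x => e x ≠ 0)
            (residualValue χ e ((R.filter fun x => e x = 0) \ T) (linSet T ∪ s))
            (linSet (R.filter fun x => e x = 0) ∪ s)
            (d₁ - #((R.filter fun x => e x = 0) \ T))) := by
  set S := R.filter fun x => e x = 0 with hS
  set V := R.filter fun x => e x ≠ 0 with hV
  have hmS : ∀ x, x ∈ S ↔ x ∈ R ∧ e x = 0 := fun x => by rw [hS, mem_filter]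
  have hmV : ∀ x, x ∈ V ↔ x ∈ R ∧ e x ≠ 0 := fun x => by rw [hV, mem_filter]
  have hSR : S ⊆ R := filter_subset _ _
  simp_rw [← card_sigma]
  symm
  have hlin0 : ∀ (U : Finset F) (x : F), x ∉ U → χ ((primeProd (linSet U)).eval x) ≠ 0 := by
    intro U x hx
    rw [mulChar_ne_zero_iff, Ne, eval_primeProd_eq_zero_iff]
    simpa using hx
  have hval : ∀ (U : Finset F) (u t : Finset (PrimePoly F)) (x : F), Disjoint (linSet U) u →
      χ ((primeProd (linSet U ∪ u) * primeProd t ^ 2).eval x) =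
        χ ((primeProd u).eval x) *
          (χ ((primeProd (linSet U)).eval x) * χ ((primeProd t).eval x) ^ 2) := by
    intro U u t x h
    rw [primeProd_union h, eval_mul, eval_mul, eval_pow, map_mul, map_mul, map_pow]
    ring
  -- `T` is the set of zeros of `F₂` in `R`; then `F₁` vanishes on the rest of `S`. The cofactor `s`
  -- of `F₂` is prime to all of `R`. The cofactor `u` of `F₁` is prime to `S` and `s`, while its
  -- nonvanishing on `V` is part of the character condition.
  refine Finset.card_bij
    (fun w _ => (linSet (S \ w.1) ∪ w.2.2, linSet w.1 ∪ w.2.1)) ?_ ?_ ?_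
  · rintro ⟨T, s, u⟩ hw
    simp only [mem_sigma, mem_powerset] at hw
    obtain ⟨hT, hs, hu⟩ := hw
    rw [mem_sqfValues_empty] at hs
    rw [mem_charValues, disjoint_union_right] at hu
    obtain ⟨hsd, hsR⟩ := hs
    obtain ⟨hud, ⟨huS, hus⟩, huv⟩ := hu
    have d1 : Disjoint (linSet (S \ T)) u := (huS.mono_right (linSet_subset sdiff_subset)).symm
    have d2 : Disjoint (linSet T) s := (hsR.mono_right (linSet_subset (hT.trans hSR))).symm
    rw [mem_pairValues]
    dsimp only
    rw [primeDeg_union d1, primeDeg_union d2, primeDeg_linSet, primeDeg_linSet]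
    refine ⟨⟨by push_cast; omega, by push_cast; omega⟩, ?_, ?_⟩
    · rw [disjoint_union_left, disjoint_union_right, disjoint_union_right]
      refine ⟨⟨?_, (hsR.mono_right (linSet_subset (sdiff_subset.trans hSR))).symm⟩,
        huS.mono_right (linSet_subset hT), hus⟩
      rw [disjoint_linSet_iff]
      intro x hx
      simp [hx]
    · intro x hx
      rw [hval _ _ _ _ d1]
      by_cases hex : e x = 0
      · rw [hex]
        by_cases hxT : x ∈ T
        · have : (primeProd (linSet T ∪ s)).eval x = 0 := by
            rw [eval_primeProd_eq_zero_iff]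
            simp [hxT]
          rw [this, MulChar.map_zero]
          simp
        · have : (primeProd (linSet (S \ T))).eval x = 0 := by
            rw [eval_primeProd_eq_zero_iff]
            simp [hxT, (hmS x).2 ⟨hx, hex⟩]
          rw [this, MulChar.map_zero]
          simp
      · have hxS : x ∉ S := fun h => hex ((hmS x).1 h).2
        rw [huv x ((hmV x).2 ⟨hx, hex⟩), residualValue, div_mul_cancel₀]
        refine mul_ne_zero (hlin0 _ _ fun h => hxS (mem_sdiff.1 h).1) (pow_ne_zero _ ?_)
        rw [mulChar_ne_zero_iff, Ne, eval_primeProd_eq_zero_iff, mem_union, not_or]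
        exact ⟨by simpa using fun h => hxS (hT h), disjoint_linSet_iff.1 hsR x hx⟩
  · rintro ⟨T, s, u⟩ hw ⟨T', s', u'⟩ hw' h
    simp only [mem_sigma, mem_powerset] at hw hw'
    obtain ⟨hT, hs, hu⟩ := hw
    obtain ⟨hT', hs', hu'⟩ := hw'
    rw [mem_sqfValues_empty] at hs hs'
    rw [mem_charValues, disjoint_union_right] at hu hu'
    simp only [Prod.mk.injEq] at h
    -- `T` is recovered as the set of points of `R` whose linear prime divides `F₂`.
    have hTT : T = T' := by
      have hmem : ∀ T s, T ⊆ S → Disjoint s (linSet R) →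
          T = R.filter fun x => linPrime x ∈ linSet T ∪ s := by
        intro T s hT hs
        ext x
        rw [mem_filter, mem_union, linPrime_mem_linSet]
        constructor
        · exact fun hx => ⟨hSR (hT hx), Or.inl hx⟩
        · rintro ⟨hx, hx' | hx'⟩
          · exact hx'
          · exact absurd hx' (disjoint_linSet_iff.1 hs x hx)
      rw [hmem T s hT hs.2, h.2, ← hmem T' s' hT' hs'.2]
    subst hTT
    have d1 : ∀ {u}, Disjoint u (linSet S) → Disjoint (linSet (S \ T)) u := fun hu =>
      (hu.mono_right (linSet_subset sdiff_subset)).symm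
    have d2 : ∀ {s}, Disjoint s (linSet R) → Disjoint (linSet T) s := fun hs =>
      (hs.mono_right (linSet_subset (hT.trans hSR))).symm
    have hs2 : s = s' := by
      rw [← union_sdiff_cancel_left (d2 hs.2), h.2, union_sdiff_cancel_left (d2 hs'.2)]
    have hu2 : u = u' := by
      rw [← union_sdiff_cancel_left (d1 hu.2.1.1), h.1, union_sdiff_cancel_left (d1 hu'.2.1.1)]
    rw [hs2, hu2]
  · rintro ⟨p₁, p₂⟩ hp
    rw [mem_pairValues] at hp
    dsimp only at hp
    obtain ⟨⟨hd₁, hd₂⟩, hdis, hv⟩ := hp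
    have hmul : ∀ x, χ ((primeProd p₁ * primeProd p₂ ^ 2).eval x) ≠ 0 ↔
        linPrime x ∉ p₁ ∧ linPrime x ∉ p₂ := by
      intro x
      rw [mulChar_ne_zero_iff, eval_mul, eval_pow, mul_ne_zero_iff, pow_ne_zero_iff two_ne_zero,
        Ne, Ne, eval_primeProd_eq_zero_iff, eval_primeProd_eq_zero_iff]
    have hVn : ∀ x ∈ V, linPrime x ∉ p₁ ∧ linPrime x ∉ p₂ := fun x hx => by
      rw [← hmul, hv x ((hmV x).1 hx).1]
      exact ((hmV x).1 hx).2
    have hSn : ∀ x ∈ S, linPrime x ∈ p₁ ∨ linPrime x ∈ p₂ := fun x hx => by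
      by_contra hcon
      rw [not_or, ← hmul, hv x ((hmS x).1 hx).1] at hcon
      exact hcon ((hmS x).1 hx).2
    have hRSV : ∀ x ∈ R, x ∈ S ∨ x ∈ V := fun x hx => by
      rw [hmS, hmV]
      tauto
    set T := S.filter fun x => linPrime x ∈ p₂ with hTdef
    have hTS : T ⊆ S := filter_subset _ _
    have hmT : ∀ x, x ∈ T ↔ x ∈ S ∧ linPrime x ∈ p₂ := fun x => by rw [hTdef, mem_filter]
    have hT₂ : linSet T ⊆ p₂ := by
      intro P hP
      obtain ⟨x, hx, rfl⟩ := mem_linSet.1 hP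
      exact (mem_filter.1 hx).2
    have hT₁ : linSet (S \ T) ⊆ p₁ := by
      intro P hP
      obtain ⟨x, hx, rfl⟩ := mem_linSet.1 hP
      rw [mem_sdiff, hmT] at hx
      rcases hSn x hx.1 with h | h
      · exact h
      · exact absurd ⟨hx.1, h⟩ hx.2
    have e1 := union_sdiff_of_subset hT₁
    have e2 := union_sdiff_of_subset hT₂
    have hsR : Disjoint (p₂ \ linSet T) (linSet R) := by
      rw [disjoint_linSet_iff]
      intro x hx hx2
      rw [mem_sdiff, linPrime_mem_linSet, hmT] at hx2
      rcases hRSV x hx with h | h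
      · exact hx2.2 ⟨h, hx2.1⟩
      · exact (hVn x h).2 hx2.1
    have huS : Disjoint (p₁ \ linSet (S \ T)) (linSet S) := by
      rw [disjoint_linSet_iff]
      intro x hx hx2
      rw [mem_sdiff, linPrime_mem_linSet, mem_sdiff, hmT] at hx2
      exact hx2.2 ⟨hx, fun h => Finset.disjoint_left.1 hdis hx2.1 h.2⟩
    have hdeg₁ := primeDeg_union (disjoint_sdiff : Disjoint (linSet (S \ T)) (p₁ \ linSet (S \ T)))
    have hdeg₂ := primeDeg_union (disjoint_sdiff : Disjoint (linSet T) (p₂ \ linSet T))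
    rw [e1, primeDeg_linSet] at hdeg₁
    rw [e2, primeDeg_linSet] at hdeg₂
    refine ⟨⟨T, p₂ \ linSet T, p₁ \ linSet (S \ T)⟩, ?_, by simp only [e1, e2]⟩
    simp only [mem_sigma, mem_powerset, mem_sqfValues_empty, mem_charValues, disjoint_union_right]
    refine ⟨hTS, ⟨by omega, hsR⟩, by omega, ⟨huS, ?_⟩, ?_⟩
    · exact (hdis.mono_left sdiff_subset).mono_right sdiff_subset
    · intro x hx
      have hxn := hVn x hx
      have h1 := hval (S \ T) (p₁ \ linSet (S \ T)) p₂ x disjoint_sdiff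
      rw [e1, hv x ((hmV x).1 hx).1] at h1
      rw [residualValue, e2, h1, mul_div_cancel_right₀]
      refine mul_ne_zero (hlin0 _ _ fun h => ?_) (pow_ne_zero _ ?_)
      · exact ((hmV x).1 hx).2 ((hmS x).1 (mem_sdiff.1 h).1).2
      · rw [mulChar_ne_zero_iff, Ne, eval_primeProd_eq_zero_iff]
        exact hxn.2

end CubicCharacter

/-! ### Bounds for the Euler factors, uniform in `q` -/

section Constants

variable {F : Type*} [Field F] [Fintype F]

theorem hasProd_constK (F : Type*) [Field F] [Fintype F] :
    HasProd (fun P : PrimePoly F => 1 - 1 / (polyNorm P.1 + 1) ^ 2) (constK F) :=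
  (multipliable_constK F).hasProd

theorem one_sub_inv_sq_mem (P : PrimePoly F) :
    0 < 1 - ((polyNorm P.1 + 1) ^ 2)⁻¹ ∧ 1 - ((polyNorm P.1 + 1) ^ 2)⁻¹ ≤ 1 := by
  have hp := polyNorm_pos P.1
  have h1 : ((polyNorm P.1 + 1) ^ 2)⁻¹ < 1 := inv_lt_one_of_one_lt₀ (by nlinarith)
  have h2 : 0 < ((polyNorm P.1 + 1) ^ 2)⁻¹ := by positivity
  constructor <;> linarith

theorem constK_le_one (F : Type*) [Field F] [Fintype F] : constK F ≤ 1 := by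
  refine le_of_tendsto' (hasProd_constK F) fun s => prod_le_one (fun P _ => ?_) fun P _ => ?_
  · simpa only [one_div] using (one_sub_inv_sq_mem P).1.le
  · simpa only [one_div] using (one_sub_inv_sq_mem P).2

/-- Factor by factor, `K` dominates `∏ (1 - |P| ^ (-2)) = 1 / ζ(2) = 1 - 1 / q`. -/
theorem le_constK (F : Type*) [Field F] [Fintype F] :
    1 - (Fintype.card F : ℝ)⁻¹ ≤ constK F := by
  have hq := one_lt_card_cast F
  have hy := card_mul_inv_sq_lt_one F
  have h1 := tprod_one_sub_pow (F := F) (y := ((Fintype.card F : ℝ) ^ 2)⁻¹) (by positivity) hy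
  have h2 : Multipliable fun P : PrimePoly F =>
      1 + -((((Fintype.card F : ℝ) ^ 2)⁻¹) ^ P.1.natDegree) :=
    multipliable_one_add_of_summable_prod
      (summable_prod_primes (summable_abs_neg_norm (by positivity) hy))
  have h3 := h2.hasProd
  rw [h1, card_mul_inv_sq] at h3
  refine le_of_tendsto_of_tendsto' h3 (hasProd_constK F) fun s => prod_le_prod (fun P _ => ?_)
    fun P _ => ?_
  · have : (((Fintype.card F : ℝ) ^ 2)⁻¹) ^ P.1.natDegree ≤ 1 :=
      pow_le_one₀ (by positivity) (inv_le_one_of_one_le₀ (by nlinarith))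
    linarith
  · have hp := polyNorm_pos P.1
    rw [inv_pow, ← pow_mul, mul_comm, pow_mul, ← polyNorm, one_div, ← sub_eq_add_neg]
    gcongr
    linarith

theorem constK_le_partialK (R : Finset (PrimePoly F)) : constK F ≤ partialK R := by
  have hq := one_lt_card_cast F
  have h0 : 0 < constK F :=
    lt_of_lt_of_le (by linarith [inv_lt_one_of_one_lt₀ hq]) (le_constK F)
  have h1 := partialK_mul R
  have h2 : 0 < ∏ P ∈ R, (1 - ((polyNorm P.1 + 1) ^ 2)⁻¹) :=
    prod_pos fun P _ => (one_sub_inv_sq_mem P).1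
  have h3 : ∏ P ∈ R, (1 - ((polyNorm P.1 + 1) ^ 2)⁻¹) ≤ 1 :=
    prod_le_one (fun P _ => (one_sub_inv_sq_mem P).1.le) fun P _ => (one_sub_inv_sq_mem P).2
  have h4 : 0 < partialK R := by
    by_contra hcon
    have := mul_nonpos_of_nonpos_of_nonneg (not_lt.1 hcon) h2.le
    linarith
  nlinarith

theorem prod_linSet {F : Type*} [Field F] {M : Type*} [CommMonoid M] (f : ℕ → M) (R : Finset F) :
    ∏ P ∈ linSet R, f P.1.natDegree = f 1 ^ #R := by
  rw [linSet, prod_image linPrime_injective.injOn]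
  simp

theorem prod_linSet_inv (R : Finset F) :
    ∏ P ∈ linSet R, (1 + (polyNorm P.1)⁻¹)⁻¹ = ((1 + (Fintype.card F : ℝ)⁻¹)⁻¹) ^ #R := by
  have := prod_linSet (fun j => (1 + ((Fintype.card F : ℝ) ^ j)⁻¹)⁻¹) R
  simpa only [pow_one, polyNorm] using this

theorem errorProd_linSet {F : Type*} [Field F] (z : ℝ) (R : Finset F) :
    errorProd z (linSet R) = ((1 - z⁻¹)⁻¹) ^ #R := by
  have := prod_linSet (fun j => (1 - (z ^ j)⁻¹)⁻¹) R
  simpa only [pow_one, errorProd] using this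

theorem partialK_linSet (R : Finset F) :
    partialK (linSet R) * (1 - (((Fintype.card F : ℝ) + 1) ^ 2)⁻¹) ^ #R = constK F := by
  have := prod_linSet (fun j => 1 - (((Fintype.card F : ℝ) ^ j + 1) ^ 2)⁻¹) R
  rw [← partialK_mul (linSet R)]
  congr 1
  simpa only [pow_one, polyNorm] using this.symm

/-- Keeps the implied constants independent of `q` and of the number of prescribed points, which is
at most `q`. -/
theorem one_add_inv_pow_le {q : ℕ} {r : ℕ} (hr : r ≤ q) :
    (1 + (q : ℝ)⁻¹) ^ r ≤ Real.exp 1 := by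
  rcases Nat.eq_zero_or_pos q with rfl | hq
  · obtain rfl : r = 0 := by omega
    simp
  have hq' : (0 : ℝ) < q := by exact_mod_cast hq
  calc (1 + (q : ℝ)⁻¹) ^ r ≤ (Real.exp (q : ℝ)⁻¹) ^ r := by
        gcongr
        linarith [Real.add_one_le_exp (q : ℝ)⁻¹]
    _ = Real.exp (r * (q : ℝ)⁻¹) := (Real.exp_nat_mul _ _).symm
    _ ≤ _ := by
        rw [Real.exp_le_exp, ← div_eq_mul_inv, div_le_one hq']
        exact_mod_cast hr

end Constants

/-! ### The main term -/

section Asymptotics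

variable {F : Type*} [Field F] [Fintype F]

/-- The main term, for a given set of zeros of `F₂`. -/
def mainTerm (F : Type*) [Field F] [Fintype F] (d₁ d₂ : ℤ) (m v : ℕ) : ℝ :=
  constK F * (1 - (Fintype.card F : ℝ)⁻¹) ^ 2 * (Fintype.card F : ℝ) ^ (d₁ + d₂) *
    (1 / ((Fintype.card F : ℝ) + 2)) ^ m *
      ((Fintype.card F : ℝ) / (3 * ((Fintype.card F : ℝ) + 2))) ^ v

/-- `t` only moves a power of `q` between the counts of `F₁` and `F₂`, so every set of zeros of `F₂`
contributes equally. The rest is one identity per point, `e2` at a zero and `e3` elsewhere, after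
restoring the factors of `K` at `R`. -/
theorem mainTerm_eq (R S : Finset F) (V : Finset F) (hR : #R = #S + #V) (d₁ d₂ : ℤ) (t : ℤ) :
    mainTerm F d₁ d₂ #S #V =
      (((Fintype.card F : ℝ) - 1) / 3) ^ #V * sqfDensity V *
        (Fintype.card F : ℝ) ^ (d₁ - (#S - t)) * ((1 + (Fintype.card F : ℝ)⁻¹)⁻¹) ^ #S *
        ((1 - (Fintype.card F : ℝ)⁻¹) * (Fintype.card F : ℝ) ^ (d₂ - t) *
          ((1 + (Fintype.card F : ℝ)⁻¹)⁻¹) ^ #R * partialK (linSet R)) := by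
  have hq := one_lt_card_cast F
  have hK := partialK_linSet R
  rw [mainTerm, sqfDensity, ← hK, hR]
  set q : ℝ := (Fintype.card F : ℝ)
  have hq0 : q ≠ 0 := by linarith
  have hq1 : q - 1 ≠ 0 := by linarith
  have hq2 : q + 1 ≠ 0 := by linarith
  have hq3 : q + 2 ≠ 0 := by linarith
  have e1 : q ^ (d₁ + d₂) = q ^ (d₁ - (#S - t)) * q ^ (d₂ - t) * q ^ #S := by
    rw [← zpow_natCast q #S, ← zpow_add₀ hq0, ← zpow_add₀ hq0]
    congr 1
    ring
  have e2 : (1 - ((q + 1) ^ 2)⁻¹) * (1 / (q + 2)) * q =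
      (1 + q⁻¹)⁻¹ * (1 + q⁻¹)⁻¹ := by
    field_simp
    ring
  have e3 : (1 - ((q + 1) ^ 2)⁻¹) * (q / (3 * (q + 2))) =
      (q - 1) / 3 * q⁻¹ * (1 - (q ^ 2)⁻¹)⁻¹ * (1 + q⁻¹)⁻¹ := by
    have h1 : q ^ 2 - 1 ≠ 0 := by
      have : q ^ 2 - 1 = (q - 1) * (q + 1) := by ring
      rw [this]
      exact mul_ne_zero hq1 hq2
    have h2 : 1 - (q ^ 2)⁻¹ = (q ^ 2 - 1) / q ^ 2 := by field_simp
    rw [h2]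
    field_simp
    ring
  have e2' := congrArg (· ^ #S) e2
  have e3' := congrArg (· ^ #V) e3
  simp only [mul_pow] at e2' e3'
  rw [e1]
  clear e2 e3 hK e1
  generalize 1 - ((q + 1) ^ 2)⁻¹ = A at *
  generalize (1 + q⁻¹)⁻¹ = B at *
  generalize 1 / (q + 2) = D at *
  generalize q / (3 * (q + 2)) = E at *
  generalize 1 - (q ^ 2)⁻¹ = G at *
  generalize (q - 1) / 3 = k at *
  rw [inv_pow, inv_pow] at e3'
  rw [pow_add, pow_add]
  linear_combination (partialK (linSet R) * (1 - q⁻¹) ^ 2 * q ^ (d₁ - (#S - t)) * q ^ (d₂ - t) *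
    (A ^ #V * E ^ #V)) * e2' +
    (partialK (linSet R) * (1 - q⁻¹) ^ 2 * q ^ (d₁ - (#S - t)) * q ^ (d₂ - t) *
    (B ^ #S * B ^ #S)) * e3'

end Asymptotics

/-! ### Errors for a fixed set of zeros, relative to the main term -/

section Estimates

variable {F : Type*} [Field F] [Fintype F]

theorem residualValue_pow_three {F : Type*} [Field F] {χ : MulChar F ℂ} (hχ : orderOf χ = 3)
    {e : F → ℂ} {U : Finset F} {t : Finset (PrimePoly F)} {x : F} (he : e x ^ 3 = 1) (hU : x ∉ U)
    (ht : linPrime x ∉ t) : residualValue χ e U t x ^ 3 = 1 := by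
  have h1 : (primeProd (linSet U)).eval x ≠ 0 := by
    rw [Ne, eval_primeProd_eq_zero_iff]
    simpa using hU
  have h2 : (primeProd t).eval x ≠ 0 := by rwa [Ne, eval_primeProd_eq_zero_iff]
  rw [residualValue, div_pow, he, mul_pow, mulChar_pow_three hχ h1, ← pow_mul, mul_comm 2 3,
    pow_mul, mulChar_pow_three hχ h2]
  norm_num

/-- Replacing the count of `F₁` by its main term costs the first error, averaged over `F₂`. What
remains is a multiple of `weightedCount`, whose estimate gives the second error and the main term.
-/
theorem abs_sum_charValues_sub_le {χ : MulChar F ℂ} (hχ : orderOf χ = 3)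
    (hq4 : 4 ≤ Fintype.card F) {R S V T : Finset F} {e : F → ℂ}
    (hS : S ⊆ R) (hV : V = R \ S) (he : ∀ x ∈ V, e x ^ 3 = 1) (hT : T ⊆ S) (d₁ d₂ : ℤ)
    {z : ℝ} (hz : 1 < z) (hzq : z ≤ Fintype.card F) :
    |∑ s ∈ sqfValues ∅ (0 : F → F) (linSet R) (d₂ - #T),
        (#(charValues χ V (residualValue χ e (S \ T) (linSet T ∪ s)) (linSet S ∪ s)
          (d₁ - #(S \ T))) : ℝ) - mainTerm F d₁ d₂ #S #V| ≤
      (((Fintype.card F : ℝ) - 1) / 3) ^ #V * (3 * √(Fintype.card F) ^ (d₁ - (#S - #T : ℤ)) *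
          (((1 - (√(Fintype.card F))⁻¹)⁻¹) ^ #S *
            (Real.exp 2 * (Fintype.card F : ℝ) ^ (d₂ - #T)))) +
        (((Fintype.card F : ℝ) - 1) / 3) ^ #V * sqfDensity V *
          (Fintype.card F : ℝ) ^ (d₁ - (#S - #T : ℤ)) *
            ((1 + (Fintype.card F : ℝ)⁻¹)⁻¹) ^ #S *
            (Real.exp (((1 - z⁻¹)⁻¹) ^ 2) * z ^ (d₂ - #T) * ((1 - z⁻¹)⁻¹) ^ #R) := by
  have hq := one_lt_card_cast F
  have hq4' : (4 : ℝ) ≤ Fintype.card F := by exact_mod_cast hq4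
  have hh : 1 < √(Fintype.card F : ℝ) := by
    rw [Real.lt_sqrt (by norm_num)]
    linarith
  have hVR : V ⊆ R := hV ▸ sdiff_subset
  have hSV : Disjoint S V := hV ▸ disjoint_sdiff
  have hRcard : #R = #S + #V := by
    rw [hV, card_sdiff_of_subset hS]
    have := card_le_card hS
    omega
  have hn : d₁ - (#(S \ T) : ℤ) = d₁ - (#S - #T : ℤ) := by
    rw [card_sdiff_of_subset hT, Nat.cast_sub (card_le_card hT)]
  rw [hn]
  set q : ℝ := (Fintype.card F : ℝ) with hqdef
  set n := d₁ - (#S - #T : ℤ) with hndef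
  set h := √q
  set k := ((q - 1) / 3) ^ #V with hk
  have hk0 : 0 ≤ k := pow_nonneg (by linarith) _
  set B := ((1 + q⁻¹)⁻¹) ^ #S with hB
  have hB0 : 0 ≤ B := by positivity
  set Sg := sqfValues ∅ (0 : F → F) (linSet R) (d₂ - #T) with hSg
  have hsR : ∀ s ∈ Sg, Disjoint s (linSet R) := fun s hs => (mem_sqfValues_empty.1 hs).2
  have hA := sqfDensity_nonneg V
  have hmain : ∑ s ∈ Sg, k * (sqfDensity V * q ^ n *
      ∏ P ∈ linSet S ∪ s, (1 + (polyNorm P.1)⁻¹)⁻¹) =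
      k * sqfDensity V * q ^ n * B * weightedCount (linSet R) (d₂ - #T) := by
    rw [weightedCount, mul_sum]
    refine sum_congr rfl fun s hs => ?_
    rw [prod_union ((hsR s hs).mono_right (linSet_subset hS)).symm, prod_linSet_inv]
    ring
  have herr : ∑ s ∈ Sg, k * (3 * h ^ n * errorProd h (linSet S ∪ s)) ≤
      k * (3 * h ^ n * (((1 - h⁻¹)⁻¹) ^ #S * (Real.exp 2 * q ^ (d₂ - #T)))) := by
    have h1 : ∑ s ∈ Sg, k * (3 * h ^ n * errorProd h (linSet S ∪ s)) =
        k * (3 * h ^ n * (((1 - h⁻¹)⁻¹) ^ #S * ∑ s ∈ Sg, errorProd h s)) := by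
      simp_rw [mul_sum]
      refine sum_congr rfl fun s hs => ?_
      rw [errorProd_union h ((hsR s hs).mono_right (linSet_subset hS)).symm, errorProd_linSet]
    have h2 : ∑ s ∈ Sg, errorProd h s ≤ Real.exp 2 * q ^ (d₂ - #T) :=
      (sum_le_sum_of_subset_of_nonneg (filter_subset _ _)
        fun s _ _ => zero_le_one.trans (one_le_errorProd hh s)).trans
          (sum_errorProd_sqrt_le hq4 _)
    have h3 : 0 ≤ (1 - h⁻¹)⁻¹ := inv_nonneg.2 (by linarith [inv_lt_one_of_one_lt₀ hh])
    rw [h1]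
    gcongr
  have hW := abs_weightedCount_sub_le hz hzq (linSet R) (d₂ - #T)
  rw [prod_linSet_inv, errorProd_linSet, ← hqdef] at hW
  have hM := mainTerm_eq R S V hRcard d₁ d₂ #T
  rw [← hqdef, ← hndef, ← hk, ← hB] at hM
  have hsplit : ∑ s ∈ Sg, (#(charValues χ V (residualValue χ e (S \ T) (linSet T ∪ s))
        (linSet S ∪ s) n) : ℝ) - mainTerm F d₁ d₂ #S #V =
      ∑ s ∈ Sg, ((#(charValues χ V (residualValue χ e (S \ T) (linSet T ∪ s))
        (linSet S ∪ s) n) : ℝ) - k * (sqfDensity V * q ^ n *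
          ∏ P ∈ linSet S ∪ s, (1 + (polyNorm P.1)⁻¹)⁻¹)) +
      k * sqfDensity V * q ^ n * B * (weightedCount (linSet R) (d₂ - #T) -
        (1 - q⁻¹) * q ^ (d₂ - (#T : ℤ)) * ((1 + q⁻¹)⁻¹) ^ #R * partialK (linSet R)) := by
    rw [sum_sub_distrib, hmain, hM]
    ring
  rw [hsplit]
  refine (abs_add_le _ _).trans (add_le_add ?_ ?_)
  · refine ((abs_sum_le_sum_abs _ _).trans (sum_le_sum fun s hs => ?_)).trans herr
    refine abs_card_charValues_sub_le hχ hq4 V (fun x hx => ?_) _ ?_ n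
    · have hxS : x ∉ S := fun h => Finset.disjoint_left.1 hSV h hx
      refine residualValue_pow_three hχ (he x hx) (fun h => hxS (mem_sdiff.1 h).1) ?_
      rw [mem_union, not_or, linPrime_mem_linSet]
      exact ⟨fun h => hxS (hT h), disjoint_linSet_iff.1 (hsR s hs) x (hVR hx)⟩
    · rw [disjoint_union_left]
      refine ⟨?_, (hsR s hs).mono_right (linSet_subset hVR)⟩
      rw [disjoint_linSet_iff]
      intro x hx hx'
      exact Finset.disjoint_left.1 hSV (linPrime_mem_linSet.1 hx') hx
  · rw [abs_mul, abs_of_nonneg (by positivity)]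
    exact mul_le_mul_of_nonneg_left hW (by positivity)

theorem constK_mul_sq_ge (hq4 : 4 ≤ Fintype.card F) :
    1 / 3 ≤ constK F * (1 - (Fintype.card F : ℝ)⁻¹) ^ 2 := by
  have hq4' : (4 : ℝ) ≤ Fintype.card F := by exact_mod_cast hq4
  have h1 : (Fintype.card F : ℝ)⁻¹ ≤ 4⁻¹ := inv_anti₀ (by norm_num) hq4'
  have h2 : (3 : ℝ) / 4 ≤ 1 - (Fintype.card F : ℝ)⁻¹ := by linarith
  have h3 := h2.trans (le_constK F)
  have h4 : (3 / 4 : ℝ) ^ 2 ≤ (1 - (Fintype.card F : ℝ)⁻¹) ^ 2 := by gcongr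
  calc (1 / 3 : ℝ) ≤ 3 / 4 * (3 / 4) ^ 2 := by norm_num
    _ ≤ _ := by gcongr

theorem mainTerm_pos (hq4 : 4 ≤ Fintype.card F) (d₁ d₂ : ℤ) (m v : ℕ) :
    0 < mainTerm F d₁ d₂ m v := by
  have h := constK_mul_sq_ge (F := F) hq4
  have hq := one_lt_card_cast F
  have h' : 0 < constK F * (1 - (Fintype.card F : ℝ)⁻¹) ^ 2 := by linarith
  rw [mainTerm]
  positivity

/-- The error from counting the polynomials `F₁`, relative to the main term. -/
theorem first_error_le (hq4 : 4 ≤ Fintype.card F) {m v t : ℕ} (hv : v ≤ Fintype.card F)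
    (d₁ d₂ : ℤ) :
    (((Fintype.card F : ℝ) - 1) / 3) ^ v * (3 * √(Fintype.card F) ^ (d₁ - (m - t : ℤ)) *
          (((1 - (√(Fintype.card F))⁻¹)⁻¹) ^ m *
            (Real.exp 2 * (Fintype.card F : ℝ) ^ (d₂ - t)))) ≤
      mainTerm F d₁ d₂ m v *
        (9 * Real.exp 3 * (√(Fintype.card F) ^ (-(d₁ - m)) * (Fintype.card F : ℝ) ^ (m + v))) := by
  have hq := one_lt_card_cast F
  have hq4' : (4 : ℝ) ≤ Fintype.card F := by exact_mod_cast hq4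
  have hh : 2 ≤ √(Fintype.card F : ℝ) := by
    apply Real.le_sqrt_of_sq_le
    linarith
  have hh2 : √(Fintype.card F : ℝ) ^ 2 = Fintype.card F := Real.sq_sqrt (by linarith)
  have hK := constK_mul_sq_ge (F := F) hq4
  have hexp := one_add_inv_pow_le hv
  rw [mainTerm]
  set q : ℝ := (Fintype.card F : ℝ) with hqdef
  set h := √q
  have hh0 : h ≠ 0 := by linarith
  have hq0 : 0 < q := by linarith
  set K := constK F * (1 - q⁻¹) ^ 2
  have hqz : ∀ j : ℤ, q ^ j = h ^ (2 * j) := fun j => by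
    rw [← hh2, zpow_mul]
    norm_cast
  -- Equality at `t = 0`; each zero moved to `F₂` improves the left side by a factor `√q`.
  have e1 : h ^ (d₁ - (m - t : ℤ)) * q ^ (d₂ - t) ≤
      q ^ (d₁ + d₂) * h ^ (-(d₁ - m)) * (q⁻¹) ^ m := by
    have : (q⁻¹) ^ m = h ^ (-2 * (m : ℤ)) := by
      rw [inv_pow, ← zpow_natCast q, hqz, ← zpow_neg]
      congr 1
    rw [this, hqz, hqz, ← zpow_add₀ hh0, ← zpow_add₀ hh0, ← zpow_add₀ hh0]
    refine zpow_le_zpow_right₀ (by linarith) ?_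
    have : (0 : ℤ) ≤ t := by positivity
    linarith
  have hhi : h⁻¹ ≤ 2⁻¹ := inv_anti₀ (by norm_num) hh
  have e2 : ((1 - h⁻¹)⁻¹) ^ m * (q⁻¹) ^ m ≤ (1 / (q + 2)) ^ m * q ^ m := by
    rw [← mul_pow, ← mul_pow]
    refine pow_le_pow_left₀ (mul_nonneg (inv_nonneg.2 (by linarith)) (by positivity)) ?_ m
    have h1 : (1 - h⁻¹)⁻¹ ≤ 2 := by
      rw [inv_le_comm₀ (by linarith) (by norm_num)]
      linarith
    calc (1 - h⁻¹)⁻¹ * q⁻¹ ≤ 2 * q⁻¹ := by gcongr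
      _ ≤ _ := by
        rw [← div_eq_mul_inv, one_div, inv_mul_eq_div, div_le_div_iff₀ hq0 (by linarith)]
        nlinarith
  -- The errors of all value conditions are added up without cancellation, so each point loses a
  -- factor of about `q` against its density. This is the source of the `+ q` in the exponent.
  have e3 : ((q - 1) / 3) ^ v ≤ Real.exp 1 * ((q / (3 * (q + 2))) ^ v * q ^ v) := by
    calc ((q - 1) / 3) ^ v ≤ ((1 + q⁻¹) * (q / (3 * (q + 2)) * q)) ^ v := by
          refine pow_le_pow_left₀ (by linarith) ?_ v
          have : (1 + q⁻¹) * (q / (3 * (q + 2)) * q) = (q ^ 2 + q) / (3 * (q + 2)) := by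
            field_simp
          rw [this, div_le_div_iff₀ (by norm_num) (by linarith)]
          nlinarith
      _ = (1 + q⁻¹) ^ v * ((q / (3 * (q + 2))) ^ v * q ^ v) := by
          rw [mul_pow, mul_pow (q / _)]
      _ ≤ _ := by gcongr
  have hE3 : Real.exp 3 = Real.exp 1 * Real.exp 2 := by
    rw [← Real.exp_add]
    norm_num
  have hb0 : 0 ≤ (1 - h⁻¹)⁻¹ := inv_nonneg.2 (by linarith)
  have hk0 : 0 ≤ (q - 1) / 3 := by linarith
  calc ((q - 1) / 3) ^ v * (3 * h ^ (d₁ - (m - t : ℤ)) *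
          (((1 - h⁻¹)⁻¹) ^ m * (Real.exp 2 * q ^ (d₂ - t))))
      = 3 * Real.exp 2 * ((q - 1) / 3) ^ v * ((1 - h⁻¹)⁻¹) ^ m *
          (h ^ (d₁ - (m - t : ℤ)) * q ^ (d₂ - t)) := by ring
    _ ≤ 3 * Real.exp 2 * ((q - 1) / 3) ^ v * ((1 - h⁻¹)⁻¹) ^ m *
          (q ^ (d₁ + d₂) * h ^ (-(d₁ - m)) * (q⁻¹) ^ m) := by gcongr
    _ = 3 * Real.exp 2 * (q ^ (d₁ + d₂) * h ^ (-(d₁ - m))) * ((q - 1) / 3) ^ v *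
          (((1 - h⁻¹)⁻¹) ^ m * (q⁻¹) ^ m) := by ring
    _ ≤ 3 * Real.exp 2 * (q ^ (d₁ + d₂) * h ^ (-(d₁ - m))) *
          (Real.exp 1 * ((q / (3 * (q + 2))) ^ v * q ^ v)) *
          ((1 / (q + 2)) ^ m * q ^ m) := by gcongr
    _ = 1 / 3 * (q ^ (d₁ + d₂) * (1 / (q + 2)) ^ m * (q / (3 * (q + 2))) ^ v *
          (9 * Real.exp 3 * (h ^ (-(d₁ - m)) * q ^ (m + v)))) := by
        rw [hE3, pow_add]
        ring
    _ ≤ K * (q ^ (d₁ + d₂) * (1 / (q + 2)) ^ m * (q / (3 * (q + 2))) ^ v *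
          (9 * Real.exp 3 * (h ^ (-(d₁ - m)) * q ^ (m + v)))) := by gcongr
    _ = _ := by ring

/-- The error from counting the polynomials `F₂`, relative to the main term. -/
theorem second_error_le (hq4 : 4 ≤ Fintype.card F) (R S V : Finset F) (hR : #R = #S + #V)
    {t : ℕ} (ht : t ≤ #S) (d₁ d₂ : ℤ) {z c : ℝ} (hz : 1 < z) (hzq : z ≤ Fintype.card F)
    (hc : 0 ≤ c) :
    (((Fintype.card F : ℝ) - 1) / 3) ^ #V * sqfDensity V *
          (Fintype.card F : ℝ) ^ (d₁ - (#S - t : ℤ)) * ((1 + (Fintype.card F : ℝ)⁻¹)⁻¹) ^ #S *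
            (c * z ^ (d₂ - t) * ((1 - z⁻¹)⁻¹) ^ #R) ≤
      mainTerm F d₁ d₂ #S #V * (2 * Real.exp 1 * c *
        ((z / Fintype.card F) ^ (d₂ - #S) * ((1 - z⁻¹)⁻¹) ^ #R)) := by
  have hq := one_lt_card_cast F
  have hq4' : (4 : ℝ) ≤ Fintype.card F := by exact_mod_cast hq4
  have hexp := one_add_inv_pow_le (card_le_univ R)
  have hA := sqfDensity_nonneg V
  rw [mainTerm_eq R S V hR d₁ d₂ t]
  have hKp := (le_constK F).trans (constK_le_partialK (linSet R))
  set q : ℝ := (Fintype.card F : ℝ) with hqdef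
  have hq0 : 0 < q := by linarith
  have hqi : q⁻¹ ≤ 4⁻¹ := inv_anti₀ (by norm_num) hq4'
  have hk0 : 0 ≤ (q - 1) / 3 := by linarith
  have hzi := inv_lt_one_of_one_lt₀ hz
  have hE : 0 ≤ ((1 - z⁻¹)⁻¹) ^ #R := pow_nonneg (inv_nonneg.2 (by linarith)) _
  have hz0 : 0 < z := by linarith
  have e1 : z ^ (d₂ - t) ≤ q ^ (d₂ - t) * (z / q) ^ (d₂ - #S) := by
    calc z ^ (d₂ - t) = q ^ (d₂ - t) * (z / q) ^ (d₂ - t) := by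
          rw [div_zpow, mul_div_cancel₀]
          positivity
      _ ≤ _ := by
          refine mul_le_mul_of_nonneg_left ?_ (by positivity)
          refine zpow_le_zpow_right_of_le_one₀ (by positivity) ((div_le_one hq0).2 hzq) ?_
          omega
  -- Both `1 - q⁻¹` and `partialK` are at least `3 / 4`, and `9 / 16 ≥ 1 / 2`.
  have e2 : 1 ≤ 2 * Real.exp 1 * ((1 - q⁻¹) * ((1 + q⁻¹)⁻¹) ^ #R * partialK (linSet R)) := by
    have h1 : 1 ≤ Real.exp 1 * ((1 + q⁻¹)⁻¹) ^ #R := by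
      rw [inv_pow, ← div_eq_mul_inv, one_le_div (by positivity)]
      exact hexp
    have h2 : (1 : ℝ) ≤ 2 * ((1 - q⁻¹) * partialK (linSet R)) := by nlinarith
    calc (1 : ℝ) = 1 * 1 := by norm_num
      _ ≤ (Real.exp 1 * ((1 + q⁻¹)⁻¹) ^ #R) * (2 * ((1 - q⁻¹) * partialK (linSet R))) := by gcongr
      _ = _ := by ring
  have hX : 0 ≤ ((q - 1) / 3) ^ #V * sqfDensity V * q ^ (d₁ - (#S - t : ℤ)) *
      ((1 + q⁻¹)⁻¹) ^ #S := by positivity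
  set Y := ((q - 1) / 3) ^ #V * sqfDensity V * q ^ (d₁ - (#S - t : ℤ)) * ((1 + q⁻¹)⁻¹) ^ #S
  set E := ((1 - z⁻¹)⁻¹) ^ #R
  calc Y * (c * z ^ (d₂ - t) * E)
      ≤ Y * (c * (q ^ (d₂ - t) * (z / q) ^ (d₂ - #S)) * E) := by gcongr
    _ = Y * (c * (q ^ (d₂ - t) * (z / q) ^ (d₂ - #S)) * E) * 1 := by ring
    _ ≤ Y * (c * (q ^ (d₂ - t) * (z / q) ^ (d₂ - #S)) * E) *
        (2 * Real.exp 1 * ((1 - q⁻¹) * ((1 + q⁻¹)⁻¹) ^ #R * partialK (linSet R))) := by gcongr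
    _ = _ := by ring

end Estimates

/-! ### The shape of the error term and its dependence on `ε` -/

/-- The relative error: `m` zeros are prescribed among `r` values. -/
def errorBound (ε q : ℝ) (m r d₁ d₂ : ℕ) : ℝ :=
  q ^ (-(1 - ε) * ((d₂ : ℝ) - m) + ε * r) + q ^ (-((d₁ : ℝ) - m) / 2 + r)

theorem errorBound_nonneg (ε : ℝ) {q : ℝ} (hq : 0 ≤ q) (m r d₁ d₂ : ℕ) :
    0 ≤ errorBound ε q m r d₁ d₂ :=
  add_nonneg (Real.rpow_nonneg hq _) (Real.rpow_nonneg hq _)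

/-- The exponent contains `ε` through `ε * (d₂ - m + r)`, which is nonnegative since `m ≤ r`. This
reduces the theorem to `ε ≤ 1`. -/
theorem errorBound_mono {ε ε' q : ℝ} (hε : ε' ≤ ε) (hq : 1 ≤ q) {m r : ℕ} (hm : m ≤ r)
    (d₁ d₂ : ℕ) : errorBound ε' q m r d₁ d₂ ≤ errorBound ε q m r d₁ d₂ := by
  have hm' : (m : ℝ) ≤ r := by exact_mod_cast hm
  have hd : (0 : ℝ) ≤ d₂ := by positivity
  refine add_le_add_left (Real.rpow_le_rpow_of_exponent_le hq ?_) _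
  nlinarith

theorem errorBound_zero_le {ε q : ℝ} (hε : 0 ≤ ε) (hε1 : ε ≤ 1) (hq : 1 ≤ q) (m r d₁ d₂ : ℕ) :
    errorBound ε q 0 0 d₁ d₂ ≤ errorBound ε q m r d₁ d₂ := by
  have hm : (0 : ℝ) ≤ m := by positivity
  have hr : (0 : ℝ) ≤ r := by positivity
  refine add_le_add (Real.rpow_le_rpow_of_exponent_le hq ?_)
    (Real.rpow_le_rpow_of_exponent_le hq ?_)
  · have h1 : 0 ≤ (1 - ε) * m := mul_nonneg (by linarith) hm
    have h2 : 0 ≤ ε * r := mul_nonneg hε hr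
    push_cast
    linarith
  · push_cast
    linarith

/-- If `q ^ ε ≥ 2`, the base on the left is at most `2 ≤ q ^ ε`. Otherwise `q < 2 ^ (1 / ε)`, so `r
≤ q` is bounded in terms of `ε` and a constant suffices. -/
theorem exists_inv_pow_le {ε : ℝ} (hε : 0 < ε) : ∃ C : ℝ, 0 ≤ C ∧ ∀ q r : ℕ, 4 ≤ q → r ≤ q →
    ((1 - ((q : ℝ) ^ ε)⁻¹)⁻¹) ^ r ≤ C * ((q : ℝ) ^ ε) ^ r := by
  set B : ℝ := (1 - ((4 : ℝ) ^ ε)⁻¹)⁻¹ with hB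
  set N : ℕ := ⌈(2 : ℝ) ^ (1 / ε)⌉₊ with hN
  have h4 : (1 : ℝ) < (4 : ℝ) ^ ε := Real.one_lt_rpow (by norm_num) hε
  have hB1 : 1 ≤ B := by
    have h1 := inv_lt_one_of_one_lt₀ h4
    have h2 : 0 < ((4 : ℝ) ^ ε)⁻¹ := by positivity
    exact (one_le_inv₀ (by linarith)).2 (by linarith)
  refine ⟨B ^ N, by positivity, fun q r hq hr => ?_⟩
  have hq' : (4 : ℝ) ≤ q := by exact_mod_cast hq
  have hz4 : (4 : ℝ) ^ ε ≤ (q : ℝ) ^ ε := Real.rpow_le_rpow (by norm_num) hq' hε.le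
  set z := (q : ℝ) ^ ε with hz
  have hBN : 1 ≤ B ^ N := one_le_pow₀ hB1
  have hz1 : 1 < z := h4.trans_le hz4
  have hzi := inv_lt_one_of_one_lt₀ hz1
  rcases le_or_gt 2 z with h2 | h2
  · have h3 : (1 - z⁻¹)⁻¹ ≤ z := by
      have : z⁻¹ ≤ 2⁻¹ := inv_anti₀ (by norm_num) h2
      refine le_trans ?_ h2
      rw [inv_le_comm₀ (by linarith) (by norm_num)]
      linarith
    calc ((1 - z⁻¹)⁻¹) ^ r ≤ z ^ r := pow_le_pow_left₀ (inv_nonneg.2 (by linarith)) h3 r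
      _ ≤ B ^ N * z ^ r := le_mul_of_one_le_left (by positivity) hBN
  · have h3 : (1 - z⁻¹)⁻¹ ≤ B := by
      have : z⁻¹ ≤ ((4 : ℝ) ^ ε)⁻¹ := inv_anti₀ (by positivity) hz4
      exact inv_anti₀ (by linarith [inv_lt_one_of_one_lt₀ h4]) (by linarith)
    have h5 : (q : ℝ) ≤ (2 : ℝ) ^ (1 / ε) := by
      have h6 := Real.rpow_le_rpow (by positivity) h2.le (by positivity : 0 ≤ 1 / ε)
      rwa [hz, ← Real.rpow_mul (by positivity), mul_one_div_cancel hε.ne', Real.rpow_one] at h6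
    have hqN : q ≤ N := by exact_mod_cast h5.trans (Nat.le_ceil _)
    calc ((1 - z⁻¹)⁻¹) ^ r ≤ B ^ r := pow_le_pow_left₀ (inv_nonneg.2 (by linarith)) h3 r
      _ ≤ B ^ N := pow_le_pow_right₀ hB1 (hr.trans hqN)
      _ ≤ B ^ N * z ^ r := le_mul_of_one_le_right (by positivity) (one_le_pow₀ hz1.le)

/-! ### The asymptotic formula for pairs, and the return to polynomials -/

section Main

/-- The asymptotic formula for the pairs, for small `ε`. -/
theorem exists_abs_card_pairValues_sub_le {ε : ℝ} (hε : 0 < ε) (hε1 : ε ≤ 1) :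
    ∃ C : ℝ, 0 ≤ C ∧ ∀ (F : Type*) [Field F] [Fintype F], 4 ≤ Fintype.card F →
      ∀ χ : MulChar F ℂ, orderOf χ = 3 → ∀ (R : Finset F) (e : F → ℂ),
        (∀ x ∈ R, e x = 0 ∨ e x ^ 3 = 1) → ∀ d₁ d₂ m : ℕ, m = #(R.filter fun x => e x = 0) →
          |(#(pairValues χ R e d₁ d₂) : ℝ) - 2 ^ m * mainTerm F d₁ d₂ m (#R - m)| ≤
            2 ^ m * mainTerm F d₁ d₂ m (#R - m) *
              (C * errorBound ε (Fintype.card F) m #R d₁ d₂) := by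
  obtain ⟨A, hA0, hA⟩ := exists_inv_pow_le hε
  -- The constant from `abs_weightedCount_sub_le` decreases in `z`, and `z = q ^ ε ≥ 4 ^ ε`.
  set D := Real.exp (((1 - ((4 : ℝ) ^ ε)⁻¹)⁻¹) ^ 2) with hD
  refine ⟨max (9 * Real.exp 3) (2 * Real.exp 1 * D * A), le_max_of_le_left (by positivity), ?_⟩
  set C := max (9 * Real.exp 3) (2 * Real.exp 1 * D * A) with hC
  intro F _ _ hq4 χ hχ R e he d₁ d₂ m hm
  have hq4' : (4 : ℝ) ≤ Fintype.card F := by exact_mod_cast hq4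
  have hq0 : (0 : ℝ) < Fintype.card F := by linarith
  set S := R.filter fun x => e x = 0 with hS
  set V := R.filter fun x => e x ≠ 0 with hV
  have hSR : S ⊆ R := filter_subset _ _
  have hVS : V = R \ S := by rw [hV, hS, filter_not]
  have hRc : #R = #S + #V := by
    rw [hVS, card_sdiff_of_subset hSR]
    have := card_le_card hSR
    omega
  have hv : #R - m = #V := by omega
  rw [hv, hm]
  have heV : ∀ x ∈ V, e x ^ 3 = 1 := fun x hx => by
    have := mem_filter.1 (hV ▸ hx)
    exact (he x this.1).resolve_left this.2
  have hM := mainTerm_pos (F := F) hq4 d₁ d₂ #S #V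
  have hAq := hA (Fintype.card F) #R hq4 (card_le_univ R)
  have hz4 : (4 : ℝ) ^ ε ≤ (Fintype.card F : ℝ) ^ ε :=
    Real.rpow_le_rpow (by norm_num) hq4' hε.le
  have h4 : (1 : ℝ) < (4 : ℝ) ^ ε := Real.one_lt_rpow (by norm_num) hε
  have hzq : (Fintype.card F : ℝ) ^ ε ≤ Fintype.card F := by
    have := Real.rpow_le_rpow_of_exponent_le (by linarith : (1 : ℝ) ≤ Fintype.card F) hε1
    rwa [Real.rpow_one] at this
  have hz1 : 1 < (Fintype.card F : ℝ) ^ ε := h4.trans_le hz4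
  have hE1 : √(Fintype.card F : ℝ) ^ (-((d₁ : ℤ) - #S)) * (Fintype.card F : ℝ) ^ (#S + #V) =
      (Fintype.card F : ℝ) ^ (-((d₁ : ℝ) - #S) / 2 + #R) := by
    rw [Real.sqrt_eq_rpow, ← Real.rpow_intCast, ← Real.rpow_mul hq0.le, ← Real.rpow_natCast,
      ← Real.rpow_add hq0, hRc]
    congr 1
    push_cast
    ring
  have hE2 : ((Fintype.card F : ℝ) ^ ε / Fintype.card F) ^ ((d₂ : ℤ) - #S) *
      ((Fintype.card F : ℝ) ^ ε) ^ #R =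
      (Fintype.card F : ℝ) ^ (-(1 - ε) * ((d₂ : ℝ) - #S) + ε * #R) := by
    have : (Fintype.card F : ℝ) ^ ε / Fintype.card F = (Fintype.card F : ℝ) ^ (ε - 1) := by
      rw [Real.rpow_sub hq0, Real.rpow_one]
    rw [this, ← Real.rpow_intCast, ← Real.rpow_mul hq0.le, ← Real.rpow_natCast,
      ← Real.rpow_mul hq0.le, ← Real.rpow_add hq0]
    congr 1
    push_cast
    ring
  set z := (Fintype.card F : ℝ) ^ ε with hz
  have hzi := inv_lt_one_of_one_lt₀ hz1
  have hDz : Real.exp (((1 - z⁻¹)⁻¹) ^ 2) ≤ D := by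
    rw [hD, Real.exp_le_exp]
    have h5 := inv_lt_one_of_one_lt₀ h4
    have h6 : z⁻¹ ≤ ((4 : ℝ) ^ ε)⁻¹ := inv_anti₀ (by positivity) hz4
    have h7 : (1 - z⁻¹)⁻¹ ≤ (1 - ((4 : ℝ) ^ ε)⁻¹)⁻¹ := inv_anti₀ (by linarith) (by linarith)
    exact pow_le_pow_left₀ (inv_nonneg.2 (by linarith)) h7 2
  have hT : ∀ T ∈ S.powerset,
      |∑ s ∈ sqfValues ∅ (0 : F → F) (linSet R) (d₂ - #T),
        (#(charValues χ V (residualValue χ e (S \ T) (linSet T ∪ s)) (linSet S ∪ s)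
          (d₁ - #(S \ T))) : ℝ) - mainTerm F d₁ d₂ #S #V| ≤
      mainTerm F d₁ d₂ #S #V * (C * errorBound ε (Fintype.card F) #S #R d₁ d₂) := by
    intro T hT
    rw [mem_powerset] at hT
    refine (abs_sum_charValues_sub_le hχ hq4 hSR hVS heV hT d₁ d₂ hz1 hzq).trans ?_
    have h1 := first_error_le (F := F) hq4 (m := #S) (v := #V) (t := #T) (card_le_univ V) d₁ d₂
    have h2 := second_error_le hq4 R S V hRc (card_le_card hT) d₁ d₂ hz1 hzq
      (Real.exp_pos (((1 - z⁻¹)⁻¹) ^ 2)).le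
    refine (add_le_add h1 h2).trans ?_
    rw [errorBound, hE1, ← hE2, add_comm, ← mul_add, mul_add C]
    refine mul_le_mul_of_nonneg_left (add_le_add ?_ ?_) hM.le
    · calc 2 * Real.exp 1 * Real.exp (((1 - z⁻¹)⁻¹) ^ 2) *
            ((z / Fintype.card F) ^ ((d₂ : ℤ) - #S) * ((1 - z⁻¹)⁻¹) ^ #R)
          ≤ 2 * Real.exp 1 * D * ((z / Fintype.card F) ^ ((d₂ : ℤ) - #S) * (A * z ^ #R)) := by
            gcongr
        _ = (2 * Real.exp 1 * D * A) * ((z / Fintype.card F) ^ ((d₂ : ℤ) - #S) * z ^ #R) := by ring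
        _ ≤ _ := by
            gcongr
            exact le_max_right _ _
    · gcongr
      exact le_max_left _ _
  rw [card_pairValues_eq, ← hS, ← hV]
  push_cast
  have hsum : (2 : ℝ) ^ #S * mainTerm F d₁ d₂ #S #V =
      ∑ T ∈ S.powerset, mainTerm F d₁ d₂ #S #V := by
    rw [sum_const, card_powerset, nsmul_eq_mul]
    push_cast
    rfl
  rw [hsum, ← sum_sub_distrib, sum_mul]
  exact (abs_sum_le_sum_abs _ _).trans (sum_le_sum hT)

variable {F : Type*} [Field F] [Fintype F]

theorem card_filter_mem_sqfDeg_le (P : PrimePoly F) (d : ℤ) :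
    (#((sqfDeg F d).filter fun s => P ∈ s) : ℝ) ≤
      (Fintype.card F : ℝ) ^ d * ((Fintype.card F : ℝ) ^ P.1.natDegree)⁻¹ := by
  have hq := one_lt_card_cast F
  have h1 : #((sqfDeg F d).filter fun s => P ∈ s) ≤ #(sqfDeg F (d - P.1.natDegree)) := by
    refine card_le_card_of_injOn (fun s => s.erase P) (fun s hs => ?_) ?_
    · rw [mem_coe, mem_filter, mem_sqfDeg] at hs
      rw [mem_coe, mem_sqfDeg]
      change (primeDeg (s.erase P) : ℤ) = _
      have := primeDeg_insert (notMem_erase P s)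
      rw [insert_erase hs.2] at this
      omega
    · intro s hs t ht h
      rw [mem_coe, mem_filter] at hs ht
      rw [← insert_erase hs.2, ← insert_erase ht.2]
      exact congrArg _ h
  calc (#((sqfDeg F d).filter fun s => P ∈ s) : ℝ) ≤ #(sqfDeg F (d - P.1.natDegree)) := by
        exact_mod_cast h1
    _ ≤ (Fintype.card F : ℝ) ^ (d - P.1.natDegree) := card_sqfDeg_le_zpow _
    _ = _ := by rw [zpow_sub₀ (by linarith), zpow_natCast, div_eq_mul_inv]

/-- A positive proportion of the pairs is coprime and squarefree. -/
theorem le_card_pairValues_empty (hq4 : 4 ≤ Fintype.card F) (χ : MulChar F ℂ) (e : F → ℂ)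
    (d₁ d₂ : ℕ) :
    1 / 5 * (Fintype.card F : ℝ) ^ (d₁ + d₂) ≤ #(pairValues χ ∅ e d₁ d₂) := by
  have hq4' : (4 : ℝ) ≤ Fintype.card F := by exact_mod_cast hq4
  -- A pair that is not coprime shares a prime. These pairs are at most `∑ |P| ^ (-2) ≤ 1 / (q - 1)
  -- ≤ 1 / 3` of `q ^ (d₁ + d₂)`, against at least `(1 - 1 / q) ^ 2 ≥ 9 / 16` for all squarefree
  -- pairs; and `9 / 16 - 1 / 3 ≥ 1 / 5`.
  have hsplit : (sqfDeg F d₁ ×ˢ sqfDeg F d₂) ⊆ pairValues χ ∅ e d₁ d₂ ∪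
      ((sqfDeg F d₁).sup id).biUnion fun P =>
        ((sqfDeg F d₁).filter fun s => P ∈ s) ×ˢ ((sqfDeg F d₂).filter fun s => P ∈ s) := by
    rintro ⟨s, t⟩ hst
    rw [mem_product] at hst
    by_cases hd : Disjoint s t
    · rw [mem_union]
      left
      rw [pairValues, mem_filter, mem_product]
      exact ⟨hst, hd, by simp⟩
    · obtain ⟨P, hs, ht⟩ := Finset.not_disjoint_iff.1 hd
      rw [mem_union]
      right
      rw [mem_biUnion]
      refine ⟨P, le_sup (f := id) hst.1 hs, ?_⟩
      rw [mem_product, mem_filter, mem_filter]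
      exact ⟨⟨hst.1, hs⟩, hst.2, ht⟩
  have hcard : (#(sqfDeg F d₁) : ℝ) * #(sqfDeg F d₂) ≤ #(pairValues χ ∅ e d₁ d₂) +
      ∑ P ∈ (sqfDeg F d₁).sup id, (#((sqfDeg F d₁).filter fun s => P ∈ s) : ℝ) *
        #((sqfDeg F d₂).filter fun s => P ∈ s) := by
    have h1 := (card_le_card hsplit).trans ((card_union_le _ _).trans
      (Nat.add_le_add_left card_biUnion_le _))
    simp only [card_product] at h1
    exact_mod_cast h1
  set q : ℝ := (Fintype.card F : ℝ) with hq
  set y : ℝ := (q ^ 2)⁻¹ with hy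
  have hy1 : Fintype.card F * y < 1 := card_mul_inv_sq_lt_one F
  have hyq : q * y = q⁻¹ := card_mul_inv_sq F
  have hqi : q⁻¹ ≤ 4⁻¹ := inv_anti₀ (by norm_num) hq4'
  have hqi0 : 0 < q⁻¹ := by positivity
  have hsum : ∑ P ∈ (sqfDeg F d₁).sup id, (#((sqfDeg F d₁).filter fun s => P ∈ s) : ℝ) *
        #((sqfDeg F d₂).filter fun s => P ∈ s) ≤ q ^ (d₁ + d₂) * (1 / 3) := by
    calc _ ≤ ∑ P ∈ (sqfDeg F d₁).sup id, q ^ (d₁ + d₂) * y ^ P.1.natDegree := by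
          refine sum_le_sum fun P _ => ?_
          refine (mul_le_mul (card_filter_mem_sqfDeg_le P d₁) (card_filter_mem_sqfDeg_le P d₂)
            (by positivity) (by positivity)).trans (le_of_eq ?_)
          rw [← hq, hy, inv_pow, ← pow_mul, mul_comm 2, pow_mul, zpow_natCast, zpow_natCast, pow_add]
          field_simp
      _ = q ^ (d₁ + d₂) * ∑ P ∈ (sqfDeg F d₁).sup id, y ^ P.1.natDegree := (mul_sum _ _ _).symm
      _ ≤ _ := by
          refine mul_le_mul_of_nonneg_left ?_ (by positivity)
          refine ((summable_pow_natDegree (by positivity) hy1).sum_le_tsum _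
            fun P _ => by positivity).trans ((tsum_pow_natDegree_le (by positivity) hy1).trans ?_)
          rw [← hq, hyq, ← div_eq_mul_inv, div_le_iff₀ (by linarith)]
          linarith
  have h1 := le_card_sqfDeg (F := F) (n := d₁) (by positivity)
  have h2 := le_card_sqfDeg (F := F) (n := d₂) (by positivity)
  rw [← hq, zpow_natCast] at h1 h2
  have h3 : (1 - q⁻¹) ^ 2 * q ^ (d₁ + d₂) ≤ (#(sqfDeg F d₁) : ℝ) * #(sqfDeg F d₂) := by
    have := mul_le_mul h1 h2 (mul_nonneg (by linarith) (by positivity)) (by positivity)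
    refine le_trans (le_of_eq ?_) this
    rw [pow_add]
    ring
  have h4 : (9 / 16 : ℝ) ≤ (1 - q⁻¹) ^ 2 := by nlinarith
  have h5 : 9 / 16 * q ^ (d₁ + d₂) ≤ (1 - q⁻¹) ^ 2 * q ^ (d₁ + d₂) := by gcongr
  have h6 : 0 < q ^ (d₁ + d₂) := by positivity
  linarith

/-- The primes of the second factor are exactly those whose square divides the product. -/
theorem primeProd_mul_sq_injective {F : Type*} [Field F] {s t s' t' : Finset (PrimePoly F)} (h : Disjoint s t)
    (h' : Disjoint s' t') (heq : primeProd s * primeProd t ^ 2 = primeProd s' * primeProd t' ^ 2) :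
    s = s' ∧ t = t' := by
  have key : ∀ {s t : Finset (PrimePoly F)}, Disjoint s t → ∀ P : PrimePoly F,
      P.1 ^ 2 ∣ primeProd s * primeProd t ^ 2 ↔ P ∈ t := by
    intro s t h P
    constructor
    · intro hd
      by_contra hP
      have hc : IsCoprime (P.1 ^ 2) (primeProd t ^ 2) := by
        refine IsCoprime.pow (P.2.2.coprime_iff_not_dvd.2 ?_)
        rwa [dvd_primeProd_iff]
      exact not_sq_dvd_primeProd P s (hc.dvd_of_dvd_mul_right hd)
    · intro hP
      exact (pow_dvd_pow_of_dvd ((dvd_primeProd_iff P t).2 hP) 2).mul_left _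
  have ht : t = t' := by
    ext P
    rw [← key h, heq, key h']
  subst ht
  refine ⟨primeProd_injective (mul_right_cancel₀ ?_ heq), rfl⟩
  exact pow_ne_zero _ (primeProd_monic t).ne_zero

theorem ncard_pairs (p : F[X] → Prop) (d₁ d₂ : ℕ) :
    {G | G ∈ cubeFreePolys F d₁ d₂ ∧ p G}.ncard =
      #((sqfDeg F d₁ ×ˢ sqfDeg F d₂).filter fun w =>
        Disjoint w.1 w.2 ∧ p (primeProd w.1 * primeProd w.2 ^ 2)) := by
  set D := (sqfDeg F d₁ ×ˢ sqfDeg F d₂).filter fun w =>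
        Disjoint w.1 w.2 ∧ p (primeProd w.1 * primeProd w.2 ^ 2)
  have hset : {G | G ∈ cubeFreePolys F d₁ d₂ ∧ p G} =
      (fun w : Finset (PrimePoly F) × Finset (PrimePoly F) =>
        primeProd w.1 * primeProd w.2 ^ 2) '' D := by
    ext G
    constructor
    · rintro ⟨⟨F₁, F₂, hm₁, hm₂, hs₁, hs₂, hc, hd₁, hd₂, rfl⟩, hp⟩
      obtain ⟨s, rfl⟩ := exists_primeProd_eq hm₁ hs₁
      obtain ⟨t, rfl⟩ := exists_primeProd_eq hm₂ hs₂
      rw [natDegree_primeProd] at hd₁ hd₂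
      refine ⟨(s, t), ?_, rfl⟩
      rw [mem_coe, mem_filter, mem_product, mem_sqfDeg, mem_sqfDeg]
      exact ⟨⟨by exact_mod_cast hd₁, by exact_mod_cast hd₂⟩,
        (isCoprime_primeProd_iff s t).1 hc, hp⟩
    · rintro ⟨⟨s, t⟩, hw, rfl⟩
      rw [mem_coe, mem_filter, mem_product, mem_sqfDeg, mem_sqfDeg] at hw
      obtain ⟨⟨hd₁, hd₂⟩, hdis, hp⟩ := hw
      refine ⟨⟨primeProd s, primeProd t, primeProd_monic s, primeProd_monic t,
        primeProd_squarefree s, primeProd_squarefree t, (isCoprime_primeProd_iff s t).2 hdis,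
        ?_, ?_, rfl⟩, hp⟩
      · rw [natDegree_primeProd]
        exact_mod_cast hd₁
      · rw [natDegree_primeProd]
        exact_mod_cast hd₂
  rw [hset, Set.InjOn.ncard_image, Set.ncard_coe_finset]
  rintro ⟨s, t⟩ hw ⟨s', t'⟩ hw' h
  obtain ⟨h1, h2⟩ := primeProd_mul_sq_injective (mem_filter.1 (mem_coe.1 hw)).2.1
    (mem_filter.1 (mem_coe.1 hw')).2.1 h
  exact Prod.ext h1 h2

theorem ncard_cubeFreePolys (χ : MulChar F ℂ) (e : F → ℂ) (d₁ d₂ : ℕ) :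
    (cubeFreePolys F d₁ d₂).ncard = #(pairValues χ ∅ e d₁ d₂) := by
  have := ncard_pairs (F := F) (fun _ => True) d₁ d₂
  simpa [pairValues] using this

theorem ncard_cubeFreePolysWithValues {ι : Type*} (χ : MulChar F ℂ) (x : ι ≃ F) (e : ι → ℂ)
    (d₁ d₂ : ℕ) : (cubeFreePolysWithValues χ x e d₁ d₂).ncard =
      #(pairValues χ univ (fun a => e (x.symm a)) d₁ d₂) := by
  have h := ncard_pairs (F := F) (fun G => ∀ i, χ (G.eval (x i)) = e i) d₁ d₂
  rw [cubeFreePolysWithValues, h, pairValues]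
  congr 1
  refine filter_congr fun w _ => and_congr_right fun _ => ?_
  constructor
  · intro hw a _
    have := hw (x.symm a)
    rwa [Equiv.apply_symm_apply] at this
  · intro hw i
    have := hw (x i) (mem_univ _)
    rwa [Equiv.symm_apply_apply] at this

theorem zetaQ_two (F : Type*) [Field F] [Fintype F] :
    zetaQ F 2 = (1 - (Fintype.card F : ℝ)⁻¹)⁻¹ := by
  rw [zetaQ, (hasSum_zetaQ F 2 (by norm_num)).tsum_eq]
  norm_num
  rw [Real.rpow_neg_one]

theorem two_pow_mul_mainTerm (F : Type*) [Field F] [Fintype F] (d₁ d₂ m v : ℕ) :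
    2 ^ m * mainTerm F d₁ d₂ m v =
      constK F * (Fintype.card F : ℝ) ^ (d₁ + d₂) / zetaQ F 2 ^ 2 *
        (2 / ((Fintype.card F : ℝ) + 2)) ^ m *
          ((Fintype.card F : ℝ) / (3 * ((Fintype.card F : ℝ) + 2))) ^ v := by
  rw [mainTerm, zetaQ_two, ← Nat.cast_add, zpow_natCast, inv_pow, div_inv_eq_mul, div_pow, div_pow,
    one_pow]
  ring

theorem exists_eq_mul_one_add {N M X : ℝ} (hM : 0 < M) (h : |N - M| ≤ M * X) :
    ∃ θ : ℝ, |θ| ≤ X ∧ N = M * (1 + θ) := by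
  refine ⟨N / M - 1, ?_, by field_simp; ring⟩
  have : N / M - 1 = (N - M) / M := by field_simp
  rw [this, abs_div, abs_of_pos hM, div_le_iff₀ hM, mul_comm]
  exact h

end Main

end

end TrigonalCount

/-- Counting the polynomials `F₁ * F₂ ^ 2` with prescribed values of a cubic character at all points
of a finite field. The implied constant `C` depends on `ε` only. -/
theorem theorem3p1 (ε : ℝ) (hε : 0 < ε) :
    ∃ C : ℝ, ∀ (F : Type*) [Field F] [Fintype F] (q d₁ d₂ : ℕ),
      Fintype.card F = q → q % 3 = 1 →
      (∃ θ : ℝ,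
        |θ| ≤ C * ((q : ℝ) ^ (-(1 - ε) * (d₂ : ℝ)) + (q : ℝ) ^ (-(d₁ : ℝ) / 2)) ∧
        ((TrigonalCount.cubeFreePolys F d₁ d₂).ncard : ℝ) =
          TrigonalCount.constK F * (q : ℝ) ^ (d₁ + d₂) / TrigonalCount.zetaQ F 2 ^ 2 * (1 + θ)) ∧
      ∀ (χ : MulChar F ℂ) (ω : ℂ), orderOf χ = 3 → IsPrimitiveRoot ω 3 →
        ∀ (x : Fin q ≃ F) (e : Fin q → ℂ), (∀ i, e i ∈ ({0, 1, ω, ω ^ 2} : Set ℂ)) →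
        ∀ m : ℕ, m = {i | e i = 0}.ncard →
          (∃ θ : ℝ,
            |θ| ≤ C * ((q : ℝ) ^ (-(1 - ε) * ((d₂ : ℝ) - m) + ε * q) +
              (q : ℝ) ^ (-((d₁ : ℝ) - m) / 2 + q)) ∧
            ((TrigonalCount.cubeFreePolysWithValues χ x e d₁ d₂).ncard : ℝ) =
              TrigonalCount.constK F * (q : ℝ) ^ (d₁ + d₂) / TrigonalCount.zetaQ F 2 ^ 2 *
                (2 / ((q : ℝ) + 2)) ^ m * ((q : ℝ) / (3 * ((q : ℝ) + 2))) ^ (q - m) *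
                (1 + θ)) ∧
          (∃ θ : ℝ,
            |θ| ≤ C * ((q : ℝ) ^ (-(1 - ε) * ((d₂ : ℝ) - m) + ε * q) +
              (q : ℝ) ^ (-((d₁ : ℝ) - m) / 2 + q)) ∧
            ((TrigonalCount.cubeFreePolysWithValues χ x e d₁ d₂).ncard : ℝ) /
                ((TrigonalCount.cubeFreePolys F d₁ d₂).ncard : ℝ) =
              (2 / ((q : ℝ) + 2)) ^ m * ((q : ℝ) / (3 * ((q : ℝ) + 2))) ^ (q - m) *
                (1 + θ)) := by
  classical
  have hε' : 0 < min ε 1 := lt_min hε one_pos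
  obtain ⟨C, hC0, hC⟩ :=
    TrigonalCount.exists_abs_card_pairValues_sub_le hε' (min_le_right ε 1)
  -- The quotient has relative error `(θ - θ₀) / (1 + θ₀)`: the numerator costs a factor 2, and `1 +
  -- θ₀ ≥ 1 / 5` costs a factor 5.
  refine ⟨10 * C, ?_⟩
  intro F _ _ q d₁ d₂ hqF hq3
  have hq4 : 4 ≤ q := by
    have := Fintype.one_lt_card (α := F)
    omega
  have hq4F : 4 ≤ Fintype.card F := by omega
  have hq4' : (4 : ℝ) ≤ q := by exact_mod_cast hq4
  have hq1 : (1 : ℝ) ≤ q := by linarith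
  -- Counting the whole family uses the pair estimate with no points prescribed, which still
  -- requires some cubic character; one exists because 3 divides `q - 1`.
  obtain ⟨χ₀, hχ₀⟩ := MulChar.exists_mulChar_orderOf F (n := 3) (R := ℂ)
    (by rw [hqF]; omega) (Complex.isPrimitiveRoot_exp 3 (by norm_num))
  have hmain := TrigonalCount.two_pow_mul_mainTerm F d₁ d₂
  rw [hqF] at hmain
  have hM0 : 0 < TrigonalCount.constK F * (q : ℝ) ^ (d₁ + d₂) / TrigonalCount.zetaQ F 2 ^ 2 := by
    have h1 := TrigonalCount.mainTerm_pos (F := F) hq4F d₁ d₂ 0 0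
    have h2 := hmain 0 0
    simp only [pow_zero, one_mul, mul_one] at h2
    rwa [h2] at h1
  have hM1 : TrigonalCount.constK F * (q : ℝ) ^ (d₁ + d₂) / TrigonalCount.zetaQ F 2 ^ 2 ≤
      (q : ℝ) ^ (d₁ + d₂) := by
    have h1 : 1 ≤ TrigonalCount.zetaQ F 2 := by
      have h2 : (q : ℝ)⁻¹ < 1 := inv_lt_one_of_one_lt₀ (by linarith)
      have h3 : 0 < (q : ℝ)⁻¹ := by positivity
      rw [TrigonalCount.zetaQ_two, hqF]
      exact (one_le_inv₀ (by linarith)).2 (by linarith)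
    refine (div_le_self ?_ (one_le_pow₀ h1)).trans
      (mul_le_of_le_one_left (by positivity) (TrigonalCount.constK_le_one F))
    have h2 : 0 < TrigonalCount.zetaQ F 2 ^ 2 := by positivity
    exact ((div_pos_iff_of_pos_right h2).1 hM0).le
  set M := TrigonalCount.constK F * (q : ℝ) ^ (d₁ + d₂) / TrigonalCount.zetaQ F 2 ^ 2 with hM
  obtain ⟨θ₀, hθ₀, hF⟩ : ∃ θ : ℝ,
      |θ| ≤ C * TrigonalCount.errorBound (min ε 1) q 0 0 d₁ d₂ ∧
      ((TrigonalCount.cubeFreePolys F d₁ d₂).ncard : ℝ) = M * (1 + θ) := by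
    refine TrigonalCount.exists_eq_mul_one_add hM0 ?_
    have h := hC F hq4F χ₀ hχ₀ ∅ 0 (by simp) d₁ d₂ 0 (by simp)
    rw [TrigonalCount.ncard_cubeFreePolys χ₀ 0]
    rw [hqF, Finset.card_empty, hmain] at h
    simpa only [Nat.sub_zero, pow_zero, mul_one] using h
  -- `M * (1 + θ₀)` is at least `q ^ (d₁ + d₂) / 5`, while `M ≤ q ^ (d₁ + d₂)`.
  have hθ₀5 : 1 / 5 ≤ 1 + θ₀ := by
    have h := TrigonalCount.le_card_pairValues_empty hq4F χ₀ 0 d₁ d₂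
    rw [← TrigonalCount.ncard_cubeFreePolys χ₀ 0, hF, hqF] at h
    by_contra hcon
    rw [not_le] at hcon
    nlinarith
  refine ⟨⟨θ₀, hθ₀.trans ?_, hF⟩, ?_⟩
  · have h1 := TrigonalCount.errorBound_mono (min_le_left ε 1) hq1 (le_refl 0) d₁ d₂
    have h2 := TrigonalCount.errorBound_nonneg (min ε 1) (zero_le_one.trans hq1) 0 0 d₁ d₂
    have h3 : TrigonalCount.errorBound ε q 0 0 d₁ d₂ =
        (q : ℝ) ^ (-(1 - ε) * (d₂ : ℝ)) + (q : ℝ) ^ (-(d₁ : ℝ) / 2) := by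
      simp [TrigonalCount.errorBound]
    rw [← h3]
    exact mul_le_mul (by linarith) h1 h2 (by linarith)
  intro χ ω hχ hω x e he m hm
  have hcard : (Finset.univ.filter fun a : F => e (x.symm a) = 0).card = m := by
    rw [hm, ← Set.ncard_coe_finset, ← Set.ncard_image_of_injective _ x.symm.injective]
    congr 1
    ext i
    simp
  have hmq : m ≤ q := by
    exact (hcard.symm.le.trans (Finset.card_le_univ _)).trans hqF.le
  have hen : ∀ a ∈ (Finset.univ : Finset F), e (x.symm a) = 0 ∨ e (x.symm a) ^ 3 = 1 := by
    intro a _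
    have h3 := hω.pow_eq_one
    rcases he (x.symm a) with h | h | h | h
    · exact Or.inl h
    · exact Or.inr (by rw [h, one_pow])
    · exact Or.inr (by rw [h, h3])
    · refine Or.inr ?_
      rw [h, ← pow_mul, mul_comm, pow_mul, h3, one_pow]
  have h := hC F hq4F χ hχ Finset.univ (fun a => e (x.symm a)) hen d₁ d₂ m hcard.symm
  rw [← TrigonalCount.ncard_cubeFreePolysWithValues, Finset.card_univ, hqF, hmain] at h
  have hD : 0 < (2 / ((q : ℝ) + 2)) ^ m * ((q : ℝ) / (3 * ((q : ℝ) + 2))) ^ (q - m) := by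
    positivity
  obtain ⟨θ, hθ, hN⟩ := TrigonalCount.exists_eq_mul_one_add
    (by rw [mul_assoc]; exact mul_pos hM0 hD) h
  have hE := TrigonalCount.errorBound_mono (min_le_left ε 1) hq1 hmq d₁ d₂
  have hE0 := TrigonalCount.errorBound_nonneg (min ε 1) (zero_le_one.trans hq1) m q d₁ d₂
  have hE00 := TrigonalCount.errorBound_zero_le hε'.le (min_le_right ε 1) hq1 m q d₁ d₂
  refine ⟨⟨θ, hθ.trans (mul_le_mul (by linarith) hE hE0 (by linarith)), hN⟩,
    (θ - θ₀) / (1 + θ₀), ?_, ?_⟩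
  · have h1 : |θ - θ₀| ≤ |θ| + |θ₀| := by
      simpa only [Real.norm_eq_abs] using norm_sub_le θ θ₀
    have h2 := mul_le_mul_of_nonneg_left hE00 hC0
    have h3 := mul_le_mul_of_nonneg_left hE hC0
    have h4 : 0 ≤ C * TrigonalCount.errorBound ε q m q d₁ d₂ :=
      mul_nonneg hC0 (hE0.trans hE)
    rw [abs_div, abs_of_pos (by linarith : 0 < 1 + θ₀), div_le_iff₀ (by linarith)]
    change |θ - θ₀| ≤ 10 * C * TrigonalCount.errorBound ε q m q d₁ d₂ * (1 + θ₀)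
    nlinarith
  · have h1 : 1 + θ₀ ≠ 0 := by linarith
    rw [hN, hF]
    field_simp
    ring
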